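/- Let $G$ be a finite group, $K\trianglelefteq G$ and $H\le G$ with $G=HK$, and put $L=H\cap K$. Let $F\subseteq\mathbb{C}$ be a field, and let $\theta\in\operatorname{Irr}K$ and $\varphi\in\operatorname{Irr}L$ be complex irreducible characters such that (i) $n=(\theta_L,\varphi)>0$; (ii) $F(\varphi)=F(\theta)$; (iii) for every $h\in H$ there is $\gamma\in\operatorname{Gal}(F(\varphi)/F)$ with $\theta^{h\gamma}=\theta$ and $\varphi^{h\gamma}=\varphi$. Here $\theta^h(k^h)=\theta(k)$ with $x^h=h^{-1}xh$, and $\theta^\gamma(k)=\theta(k)^\gamma$. All group algebras are viewed inside $\mathbb{C}G$, and class functions are extended linearly to group algebras. For an irreducible character $\chi$ of a subgroup $U$ let $e_\chi=\frac{\chi(1)}{|U|}\sum_{u\in U}\chi(u^{-1})u$. Put $e_{(\theta,F)}=\sum_{\gamma\in\operatorname{Gal}(F(\theta)/F)}e_\theta^\gamma$, define $e_{(\varphi,F)}$ in the same way, and put $$i=\sum_{\gamma\in\operatorname{Gal}(F(\varphi)/F)}e_\varphi^\gamma e_\theta^\gamma,\qquad S=(iFKi)^L,\qquad Z=\mathbf{Z}(iFKi)=\mathbf{Z}(S),\qquad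 Z_0=Z^H .$$ Let $S_0\subseteq S$ be an $F$-subalgebra with identity $i$ such that $\mathbf{Z}(S_0)=Z_0$ and $S=S_0Z$. For $h\in H$ let $\varepsilon(h)$ be the automorphism of $S$ with $(s_0z)^{\varepsilon(h)}=s_0z^h$ for $s_0\in S_0$, $z\in Z$; it depends only on $Lh$. A *magic crossed representation* (with respect to $S_0$) is a map $\sigma\colon H/L\to S^*$ such that $\sigma(x)^{\varepsilon(y)}\sigma(y)=\sigma(xy)$ for all $x,y\in H/L$, and $s^x=\sigma(x)^{-1}s^{\varepsilon(x)}\sigma(x)$ for all $x\in H/L$, $s\in S$. For an idempotent $e$ let $\operatorname{Irr}(U\mid e)=\{\chi\in\operatorname{Irr}U\mid\chi(e)\ne0\}$, and let $\mathbb{C}[\operatorname{Irr}(U\mid e)]$ be its $\mathbb{C}$-span in the space of class functions. For $\chi\in\operatorname{Irr}U$ let $[\chi]_F$ be the class of the central simple algebra $F(\chi)U e_\chi$ in the Brauer group of $F(\chi)$. **Theorem.** Let $\sigma$ be a magic crossed representation with respect to $S_0$. There is $s_0\in S_0$ with reduced trace $\operatorname{tr}_{S_0/Z_0}(s_0)=1$.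 For all subgroups $U$ with $K\le U\le G$, the formula $$\chi^\iota(h)=\chi\bigl(s_0\,\sigma(Lh)^{-1}h\bigr)\qquad(h\in U\cap H)$$ defines, independently of the choice of such an $s_0$, a bijective linear map $\iota=\iota(\sigma)\colon\mathbb{C}[\operatorname{Irr}(U\mid e_{(\theta,F)})]\to\mathbb{C}[\operatorname{Irr}(U\cap H\mid e_{(\varphi,F)})]$. These maps have the following properties (it is part of the claims that the functions to which $\iota$ is applied lie in its domain): 1. $\chi\in\operatorname{Irr}(U\mid e_{(\theta,F)})$ if and only if $\chi^\iota\in\operatorname{Irr}(U\cap H\mid e_{(\varphi,F)})$. 2. $(\chi_1^\iota,\chi_2^\iota)_{U\cap H}=(\chi_1,\chi_2)_U$ for $\chi_1,\chi_2\in\mathbb{C}[\operatorname{Irr}(U\mid e_{(\theta,F)})]$. 3. $\chi(1)/\theta(1)=\chi^\iota(1)/\varphi(1)$. 4. $(\chi_{U_1})^\iota=(\chi^\iota)_{U_1\cap H}$ for $K\le U_1\le U_2\le G$ and $\chi\in\mathbb{C}[\operatorname{Irr}(U_2\mid e_{(\theta,F)})]$. 5. $(\tau^{U_2})^\iota=(\tau^\iota)^{U_2\cap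 H}$ for $K\le U_1\le U_2\le G$ and $\tau\in\mathbb{C}[\operatorname{Irr}(U_1\mid e_{(\theta,F)})]$. 6. $(\chi^\iota)^h=(\chi^h)^\iota$ for $h\in H$. 7. $(\beta\chi)^\iota=\beta\chi^\iota$ for $\beta\in\mathbb{C}[\operatorname{Irr}(U/K)]$. 8. $(\chi^\alpha)^\iota=(\chi^\iota)^\alpha$ for every automorphism $\alpha$ of $\mathbb{C}$ fixing $F$ elementwise, and $F(\chi)=F(\chi^\iota)$. 9. For $\chi\in\operatorname{Irr}(U\mid e_{(\theta,F)})$ we have $[\chi]_F=[S_0\otimes_{Z_0}F(\chi)]\,[\chi^\iota]_F$ in the Brauer group of $F(\chi)$, where $F(\chi)$ is a $Z_0$-algebra through the ring homomorphism $z\mapsto\chi(z)/\chi(i)$. -/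

import Mathlib

open scoped MonoidAlgebra TensorProduct

noncomputable section

namespace MagicCrossed

universe u

attribute [local instance] Fintype.ofFinite

/-! ### Characters and class functions -/

/-- `χ` is an irreducible complex character of the (finite) group `Γ`. -/
def IsIrrChar {Γ : Type*} [Group Γ] (χ : Γ → ℂ) : Prop :=
  ∃ (d : ℕ) (ρ : Representation ℂ Γ (Fin d → ℂ)), ρ.IsIrreducible ∧ ρ.character = χ

/-- The inner product `(χ, ψ) = |Γ|⁻¹ ∑ χ(g) conj ψ(g)` of class functions. -/
def charInner {Γ : Type*} [Group Γ] [Finite Γ] (χ ψ : Γ → ℂ) : ℂ :=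
  (Nat.card Γ : ℂ)⁻¹ * ∑ g : Γ, χ g * (starRingEnd ℂ) (ψ g)

/-- `F(χ)`, the field generated over `F` by the values of `χ`. -/
def valueField (F : Subfield ℂ) {X : Type*} (χ : X → ℂ) : IntermediateField F ℂ :=
  IntermediateField.adjoin F (Set.range χ)

/-- The action of `γ ∈ Gal(E/F)` on `E`-valued functions, `χ^γ(x) = γ(χ(x))`.
(It is only used for functions with values in `E`.) -/
def galChar {F : Subfield ℂ} {E : IntermediateField F ℂ} (γ : E ≃ₐ[F] E) {X : Type*}
    (χ : X → ℂ) : X → ℂ := by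
  classical
  exact fun x => if h : χ x ∈ E then (γ ⟨χ x, h⟩ : ℂ) else χ x

/-- The linear extension of `χ : U → ℂ` to the group algebra `ℂU`, evaluated at an element of
`ℂG` with support in `U`. -/
def linExt {G : Type u} [Group G] [Finite G] {U : Subgroup G} (χ : U → ℂ) (a : ℂ[G]) : ℂ :=
  ∑ x : U, a.coeff (x : G) * χ x

/-- The idempotent `e_χ = χ(1)/|U| ∑ χ(x⁻¹) x` of `ℂU ⊆ ℂG`. -/
def charIdem {G : Type u} [Group G] [Finite G] {U : Subgroup G} (χ : U → ℂ) : ℂ[G] :=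
  ∑ x : U, MonoidAlgebra.single (x : G) (χ 1 / (Nat.card U : ℂ) * χ x⁻¹)

/-- The idempotent `e_(χ,F) = ∑_γ (e_χ)^γ`, where `γ` runs over the (finite) Galois group
`Gal(F(χ)/F)`; here `(e_χ)^γ = e_(χ^γ)`. -/
def galIdem {G : Type u} [Group G] [Finite G] (F : Subfield ℂ) {U : Subgroup G} (χ : U → ℂ) :
    ℂ[G] :=
  ∑ᶠ γ : valueField F χ ≃ₐ[F] valueField F χ, charIdem (galChar γ χ)

/-- `Irr(U | e)`: the irreducible characters `χ` of `U` with `χ(e) ≠ 0`. -/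
def irrOver {G : Type u} [Group G] [Finite G] (U : Subgroup G) (e : ℂ[G]) : Set (U → ℂ) :=
  {χ | IsIrrChar χ ∧ linExt χ e ≠ 0}

/-- `ℂ[Irr(U | e)]`, the space of class functions spanned by `Irr(U | e)`. -/
def irrSpan {G : Type u} [Group G] [Finite G] (U : Subgroup G) (e : ℂ[G]) :
    Submodule ℂ (U → ℂ) :=
  Submodule.span ℂ (irrOver U e)

/-- Restriction of functions to a subgroup. -/
def resFun {G : Type u} [Group G] {V W : Subgroup G} (h : V ≤ W) (χ : W → ℂ) : V → ℂ :=
  fun x => χ (Subgroup.inclusion h x)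

/-- Induction of class functions from `V` to `W` (for `V ≤ W`):
`τ^W(x) = |V|⁻¹ ∑ τ(y x y⁻¹)`, the sum over all `y ∈ W` with `y x y⁻¹ ∈ V`. -/
def indFun {G : Type u} [Group G] [Finite G] (V W : Subgroup G) (τ : V → ℂ) : W → ℂ := by
  classical
  exact fun x => (Nat.card V : ℂ)⁻¹ *
    ∑ y : W, if h : ((y : G) * x * (y : G)⁻¹) ∈ V then τ ⟨(y : G) * x * (y : G)⁻¹, h⟩ else 0

/-- The conjugate subgroup `U^h = h⁻¹ U h`. -/
def conjSub {G : Type u} [Group G] (h : G) (U : Subgroup G) : Subgroup G :=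
  U.comap (MulAut.conj h).toMonoidHom

/-- The conjugate `χ^h` on `U^h` of a function `χ` on `U`: `χ^h(u^h) = χ(u)`. -/
def conjFun {G : Type u} [Group G] (h : G) {U : Subgroup G} (χ : U → ℂ) : conjSub h U → ℂ :=
  fun x => χ ⟨h * x * h⁻¹, x.2⟩

theorem le_conjSub {G : Type u} [Group G] {K U : Subgroup G} [hK : K.Normal] (h : G)
    (hU : K ≤ U) : K ≤ conjSub h U :=
  fun k hk => hU (hK.conj_mem k hk h)

/-! ### Subalgebras with an identity of their own -/

/-- A subset of the `k`-algebra `R`, closed under addition, multiplication and scalars, that has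
an identity element (which may differ from the identity of `R`). -/
structure CornerSubalgebra (k : Type*) (R : Type*) [Field k] [Ring R] [Algebra k R] extends
    NonUnitalSubalgebra k R where
  /-- the identity element -/
  unit : R
  unit_mem : unit ∈ carrier
  unit_mul : ∀ a ∈ carrier, unit * a = a
  mul_unit : ∀ a ∈ carrier, a * unit = a

namespace CornerSubalgebra

variable {k : Type*} {R : Type*} [Field k] [Ring R] [Algebra k R]

instance : CoeSort (CornerSubalgebra k R) (Type _) := ⟨fun S => S.toNonUnitalSubalgebra⟩

instance (S : CornerSubalgebra k R) : Ring S :=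
  { (inferInstance : NonUnitalRing S.toNonUnitalSubalgebra) with
    one := ⟨S.unit, S.unit_mem⟩
    one_mul := fun a => Subtype.ext (S.unit_mul a a.2)
    mul_one := fun a => Subtype.ext (S.mul_unit a a.2) }

instance (S : CornerSubalgebra k R) : Algebra k S :=
  Algebra.ofModule (fun r a b => Subtype.ext (smul_mul_assoc r (a : R) (b : R)))
    (fun r a b => Subtype.ext (mul_smul_comm r (a : R) (b : R)))

end CornerSubalgebra

/-! ### Central simple algebras -/

/-- `t` is the reduced trace of the element `a` of the central simple `Z`-algebra `A`: for a field
`E ≥ Z` and an isomorphism `E ⊗ A ≅ Mat_m(E)`, it is the matrix trace of the image of `1 ⊗ a`. -/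
def IsReducedTrace (Z A : Type u) [CommRing Z] [Ring A] [Algebra Z A] (a : A) (t : Z) : Prop :=
  ∃ (E : Type u) (_ : Field E) (_ : Algebra Z E) (m : ℕ)
    (f : (E ⊗[Z] A) ≃ₐ[E] Matrix (Fin m) (Fin m) E),
    Matrix.trace (f (1 ⊗ₜ[Z] a)) = algebraMap Z E t

/-- `A` is a finite-dimensional central simple `k`-algebra. -/
structure IsCSA (k : Type*) (A : Type*) [Field k] [Ring A] [Algebra k A] : Prop where
  central : Algebra.IsCentral k A
  simple : IsSimpleRing A
  finite : FiniteDimensional k A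

/-- The class of a central simple `k`-algebra in the Brauer group of `k`. -/
def brauerClass {k : Type*} {A : Type u} [Field k] [Ring A] [Algebra k A] (h : IsCSA k A) :
    BrauerGroup.{_, u} k :=
  Quotient.mk (Brauer.CSA_Setoid k)
    { toAlgCat := AlgCat.of k A
      isCentral := h.central
      isSimple := h.simple
      fin_dim := h.finite }

/-- `A`, `B`, `C` are central simple `k`-algebras with `[A] = [B][C]` in the Brauer group of `k`
(whose multiplication is induced by the tensor product). -/
def BrauerMulEq (k : Type) (A B C : Type u) [Field k] [Ring A] [Algebra k A] [Ring B]
    [Algebra k B] [Ring C] [Algebra k C] : Prop :=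
  IsCSA k A ∧ IsCSA k B ∧ IsCSA k C ∧
    ∃ (hA : IsCSA k A) (hBC : IsCSA k (B ⊗[k] C)), brauerClass hA = brauerClass hBC

/-- `[A] = [k ⊗_Z S][B]` in the Brauer group of `k`, where `k` is regarded as a `Z`-algebra through
the ring homomorphism `ω : Z → k`. -/
def BrauerBaseChangeEq {Z : Type u} {k : Type} (A S B : Type u) [CommRing Z] [Field k]
    [Ring A] [Algebra k A] [Ring S] [Algebra Z S] [Ring B] [Algebra k B] (ω : Z →+* k) : Prop :=
  letI := ω.toAlgebra
  BrauerMulEq k A (k ⊗[Z] S) B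

/-! ### The algebra `kUe_χ` -/

/-- The group algebra `kU ⊆ ℂG`: the `k`-subalgebra of `ℂG` generated by `U`. -/
def groupAlg {G : Type u} [Group G] (k : Type*) [Field k] [Algebra k ℂ] (U : Subgroup G) :
    Subalgebra k ℂ[G] :=
  Algebra.adjoin k (Set.range fun x : U => MonoidAlgebra.single (x : G) (1 : ℂ))

theorem IsIrrChar.map_conj {Γ : Type*} [Group Γ] {χ : Γ → ℂ} (h : IsIrrChar χ) (x y : Γ) :
    χ (x * y) = χ (y * x) := by
  obtain ⟨d, ρ, -, rfl⟩ := h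
  exact ρ.char_mul_comm y x

/-- The convolution identity `χ(1)/|Γ| ∑ χ(g⁻¹) χ(g x) = χ(x)`. -/
theorem IsIrrChar.convolution {Γ : Type*} [Group Γ] [Finite Γ] {χ : Γ → ℂ} (h : IsIrrChar χ)
    (x : Γ) : χ 1 / (Nat.card Γ : ℂ) * ∑ g : Γ, χ g⁻¹ * χ (g * x) = χ x := by
  obtain ⟨d, ρ, hρ, rfl⟩ := h
  have hcard : (Nat.card Γ : ℂ) ≠ 0 := by exact_mod_cast Nat.card_pos.ne'
  have : Invertible (Nat.card Γ : ℂ) := invertibleOfNonzero hcard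
  let T : Module.End ℂ (Fin d → ℂ) := ∑ g : Γ, ρ.character g⁻¹ • ρ g
  have hT : ∀ y : Γ, T ∘ₗ ρ y = ρ y ∘ₗ T := by
    intro y
    change T * ρ y = ρ y * T
    simp only [T, Finset.sum_mul, Finset.mul_sum, smul_mul_assoc, mul_smul_comm, ← map_mul]
    refine Fintype.sum_equiv (MulAut.conj y⁻¹).toEquiv _ _ fun g => ?_
    simp only [MulEquiv.toEquiv_eq_coe, MulEquiv.coe_toEquiv, MulAut.conj_apply, inv_inv]
    congr 1
    · have : (y⁻¹ * g * y)⁻¹ = y⁻¹ * g⁻¹ * y := by group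
      rw [this, ρ.char_mul_comm, mul_inv_cancel_left]
    · congr 1
      group
  let f : Representation.IntertwiningMap ρ ρ := ⟨T, hT⟩
  obtain ⟨c, hc⟩ :=
    (Representation.IsIrreducible.algebraMap_intertwiningMap_bijective_of_isAlgClosed
      (ρ := ρ)).2 f
  have hTc : T = c • LinearMap.id := by
    have := congrArg Representation.IntertwiningMap.toLinearMap hc
    rw [← show f.toLinearMap = T from rfl, ← this]
    rfl
  have htr : ∀ y : Γ, ∑ g : Γ, ρ.character g⁻¹ * ρ.character (g * y) = c * ρ.character y := by
    intro y
    have h1 : LinearMap.trace ℂ (Fin d → ℂ) (T * ρ y) = c * ρ.character y := by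
      rw [hTc]
      simp [Representation.character, ← Module.End.one_eq_id]
    rw [← h1]
    simp [T, Finset.sum_mul, Representation.character, ← map_mul]
  have horth := Representation.char_orthonormal ρ ρ
  rw [if_pos ⟨Representation.Equiv.refl ρ⟩] at horth
  have h1 := htr 1
  simp only [mul_one] at h1
  have h2 : ∑ g : Γ, ρ.character g⁻¹ * ρ.character g = (Nat.card Γ : ℂ) := by
    rw [inv_mul_eq_iff_eq_mul₀ hcard, mul_one] at horth
    rw [← horth]
    exact Finset.sum_congr rfl fun g _ => mul_comm _ _
  rw [htr x, div_mul_eq_mul_div, ← mul_assoc, mul_comm _ c, ← h1, h2, mul_div_assoc,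
    mul_div_cancel₀ _ hcard]

theorem charIdem_mul_self {G : Type u} [Group G] [Finite G] {U : Subgroup G} {χ : U → ℂ}
    (h : IsIrrChar χ) : charIdem χ * charIdem χ = charIdem χ := by
  have key : ∀ x : U, MonoidAlgebra.single (x : G) (χ 1 / (Nat.card U : ℂ) * χ x⁻¹) *
      charIdem χ = ∑ z : U, MonoidAlgebra.single (z : G)
        (χ 1 / (Nat.card U : ℂ) * (χ 1 / (Nat.card U : ℂ) * (χ x⁻¹ * χ (x * z⁻¹)))) := by
    intro x
    simp only [charIdem, Finset.mul_sum, MonoidAlgebra.single_mul_single]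
    refine Fintype.sum_equiv (Equiv.mulLeft x) _ _ fun y => ?_
    simp only [Equiv.coe_mulLeft, Subgroup.coe_mul, mul_inv_rev]
    rw [h.map_conj x, inv_mul_cancel_right]
    congr 1
    ring
  calc charIdem χ * charIdem χ
      = ∑ x : U, MonoidAlgebra.single (x : G) (χ 1 / (Nat.card U : ℂ) * χ x⁻¹) *
          charIdem χ := by
        rw [← Finset.sum_mul]
        rfl
    _ = charIdem χ := by
        simp only [key]
        rw [Finset.sum_comm]
        simp only [charIdem]
        refine Finset.sum_congr rfl fun z _ => ?_
        have hadd : ∀ f : U → ℂ, ∑ x : U, MonoidAlgebra.single (z : G) (f x) =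
            MonoidAlgebra.single (z : G) (∑ x : U, f x) := fun f =>
          (map_sum (MonoidAlgebra.singleAddHom (z : G)) f Finset.univ).symm
        rw [hadd, ← Finset.mul_sum, ← Finset.mul_sum, h.convolution]

theorem charIdem_comm {G : Type u} [Group G] [Finite G] {U : Subgroup G} {χ : U → ℂ}
    (h : IsIrrChar χ) {k : Type*} [Field k] [Algebra k ℂ] {a : ℂ[G]} (ha : a ∈ groupAlg k U) :
    a * charIdem χ = charIdem χ * a := by
  have hle : groupAlg k U ≤ Subalgebra.centralizer k {charIdem χ} := by
    refine Algebra.adjoin_le ?_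
    rintro _ ⟨u, rfl⟩
    simp only [SetLike.mem_coe, Subalgebra.mem_centralizer_iff, Set.mem_singleton_iff,
      forall_eq]
    simp only [charIdem, Finset.sum_mul, Finset.mul_sum, MonoidAlgebra.single_mul_single,
      one_mul, mul_one]
    refine Fintype.sum_equiv (MulAut.conj u⁻¹).toEquiv _ _ fun x => ?_
    simp only [MulEquiv.toEquiv_eq_coe, MulEquiv.coe_toEquiv, MulAut.conj_apply, inv_inv,
      Subgroup.coe_mul, Subgroup.coe_inv]
    have h1 : (u : G) * ((u : G)⁻¹ * x * u) = x * u := by group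
    have h2 : (u⁻¹ * x * u)⁻¹ = u⁻¹ * (x⁻¹ * u) := by group
    rw [h1, h2, h.map_conj u⁻¹, mul_inv_cancel_right]
  exact ((Subalgebra.mem_centralizer_iff k).1 (hle ha) _ rfl).symm

/-- The algebra `kUe_χ` with identity `e_χ`, for an irreducible character `χ` of `U`. -/
def blockAlg {G : Type u} [Group G] [Finite G] (k : Type*) [Field k] [Algebra k ℂ]
    {U : Subgroup G} (χ : U → ℂ) (h : IsIrrChar χ) : CornerSubalgebra k ℂ[G] where
  carrier := {b | ∃ a ∈ groupAlg k U, b = a * charIdem χ}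
  add_mem' := by
    rintro _ _ ⟨a, ha, rfl⟩ ⟨b, hb, rfl⟩
    exact ⟨a + b, add_mem ha hb, (add_mul _ _ _).symm⟩
  zero_mem' := ⟨0, zero_mem _, (zero_mul _).symm⟩
  mul_mem' := by
    rintro _ _ ⟨a, ha, rfl⟩ ⟨b, hb, rfl⟩
    refine ⟨a * b, mul_mem ha hb, ?_⟩
    rw [mul_assoc, ← mul_assoc _ b, ← charIdem_comm h hb, mul_assoc b, charIdem_mul_self h,
      mul_assoc]
  smul_mem' := by
    rintro c _ ⟨a, ha, rfl⟩
    exact ⟨c • a, Subalgebra.smul_mem _ ha c, (smul_mul_assoc _ _ _).symm⟩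
  unit := charIdem χ
  unit_mem := ⟨1, one_mem _, (one_mul _).symm⟩
  unit_mul := by
    rintro _ ⟨a, ha, rfl⟩
    rw [← mul_assoc, ← charIdem_comm h ha, mul_assoc, charIdem_mul_self h]
  mul_unit := by
    rintro _ ⟨a, ha, rfl⟩
    rw [mul_assoc, charIdem_mul_self h]

/-! ### The semi-invariant configuration and magic crossed representations -/

/-- The standing hypothesis over `F ≤ ℂ`, with `L = H ∩ K`:
`G = HK`, `θ ∈ Irr K`, `φ ∈ Irr L`, `n = (θ_L, φ) > 0`, `F(φ) = F(θ)`, and for every `h ∈ H` there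
is `γ ∈ Gal(F(φ)/F)` with `θ^{hγ} = θ` and `φ^{hγ} = φ`. -/
structure SemiInvariantConfig {G : Type u} [Group G] [Finite G] (F : Subfield ℂ)
    (H K : Subgroup G) [K.Normal] (θ : K → ℂ) (φ : ↥(H ⊓ K) → ℂ) : Prop where
  factor : ∀ g : G, ∃ h ∈ H, ∃ k ∈ K, g = h * k
  theta_irr : IsIrrChar θ
  phi_irr : IsIrrChar φ
  mult_pos : ∃ n : ℕ, 0 < n ∧ charInner (resFun inf_le_right θ) φ = n
  valueField_eq : valueField F φ = valueField F θ
  semi : ∀ h ∈ H, ∃ γ : valueField F φ ≃ₐ[F] valueField F φ,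
    (∀ (k : K) (k' : K), (k' : G) = h * k * h⁻¹ → galChar γ θ k' = θ k) ∧
    (∀ (l : ↥(H ⊓ K)) (l' : ↥(H ⊓ K)), (l' : G) = h * l * h⁻¹ → galChar γ φ l' = φ l)

section Config

variable {G : Type u} [Group G] [Finite G]

/-- `s^h = h⁻¹ s h` in the group algebra. -/
def gconj {G : Type u} [Group G] (s : ℂ[G]) (h : G) : ℂ[G] :=
  MonoidAlgebra.single h⁻¹ 1 * s * MonoidAlgebra.single h 1

/-- The idempotent `i = ∑_γ (e_φ)^γ (e_θ)^γ`, where `γ` runs over `Gal(F(φ)/F)`. -/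
def idem (F : Subfield ℂ) {H K : Subgroup G} (θ : K → ℂ) (φ : ↥(H ⊓ K) → ℂ) : ℂ[G] :=
  ∑ᶠ γ : valueField F φ ≃ₐ[F] valueField F φ, charIdem (galChar γ φ) * charIdem (galChar γ θ)

/-- The algebra `iFKi`. -/
def cornerSet (F : Subfield ℂ) {H K : Subgroup G} (θ : K → ℂ) (φ : ↥(H ⊓ K) → ℂ) : Set ℂ[G] :=
  {s | ∃ a ∈ groupAlg F K, s = idem F θ φ * a * idem F θ φ}

/-- `S = (iFKi)^L`. -/
def fixedSet (F : Subfield ℂ) {H K : Subgroup G} (θ : K → ℂ) (φ : ↥(H ⊓ K) → ℂ) : Set ℂ[G] :=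
  {s | s ∈ cornerSet F θ φ ∧ ∀ l ∈ H ⊓ K, gconj s l = s}

/-- `Z = Z(iFKi)`, which is also the centre of `S`. -/
def centerSet (F : Subfield ℂ) {H K : Subgroup G} (θ : K → ℂ) (φ : ↥(H ⊓ K) → ℂ) : Set ℂ[G] :=
  {z | z ∈ cornerSet F θ φ ∧ ∀ s ∈ cornerSet F θ φ, z * s = s * z}

/-- `S₀` is a subalgebra of `S` with identity `i`, with centre `Z₀ = Z^H`, and with `S = S₀ Z`. -/
structure IsBaseSubalgebra (F : Subfield ℂ) {H K : Subgroup G} (θ : K → ℂ)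
    (φ : ↥(H ⊓ K) → ℂ) (S₀ : CornerSubalgebra F ℂ[G]) : Prop where
  subset : ∀ s ∈ S₀.toNonUnitalSubalgebra, s ∈ fixedSet F θ φ
  unit_eq : S₀.unit = idem F θ φ
  center_eq : ∀ z : ℂ[G],
    (z ∈ S₀.toNonUnitalSubalgebra ∧ ∀ s ∈ S₀.toNonUnitalSubalgebra, z * s = s * z) ↔
      (z ∈ centerSet F θ φ ∧ ∀ h ∈ H, gconj z h = z)
  span_eq : (Submodule.span F {x : ℂ[G] | ∃ s ∈ S₀.toNonUnitalSubalgebra,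
    ∃ z ∈ centerSet F θ φ, x = s * z} : Set ℂ[G]) = fixedSet F θ φ

/-- The graph of the automorphism `ε(h)` of `S = S₀ Z` determined by `(s₀ z)^ε(h) = s₀ z^h` for
`s₀ ∈ S₀` and `z ∈ Z`. -/
def epsGraph (F : Subfield ℂ) {H K : Subgroup G} (θ : K → ℂ) (φ : ↥(H ⊓ K) → ℂ)
    (S₀ : CornerSubalgebra F ℂ[G]) (h : G) : AddSubgroup (ℂ[G] × ℂ[G]) :=
  AddSubgroup.closure {p | ∃ s ∈ S₀.toNonUnitalSubalgebra, ∃ z ∈ centerSet F θ φ,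
    p = (s * z, s * gconj z h)}

/-- `s^ε(h)` for `s ∈ S` (and `0` for `s ∉ S`). -/
def eps (F : Subfield ℂ) {H K : Subgroup G} (θ : K → ℂ) (φ : ↥(H ⊓ K) → ℂ)
    (S₀ : CornerSubalgebra F ℂ[G]) (h : G) (s : ℂ[G]) : ℂ[G] := by
  classical
  exact if hs : ∃ t, (s, t) ∈ epsGraph F θ φ S₀ h then hs.choose else 0

/-- A magic `ε`-crossed representation `σ : H/L → S` with respect to `S₀`, with values in the units
of `S`:
`σ(x)^ε(y) σ(y) = σ(xy)` and `s^x = s^(ε(x)σ(x)) = σ(x)⁻¹ s^ε(x) σ(x)` for `s ∈ S`. -/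
structure MagicCrossedRep (F : Subfield ℂ) {H K : Subgroup G} [K.Normal] (θ : K → ℂ)
    (φ : ↥(H ⊓ K) → ℂ) (S₀ : CornerSubalgebra F ℂ[G]) where
  /-- the map `σ` -/
  toFun : H ⧸ K.subgroupOf H → ℂ[G]
  /-- `σ(x)⁻¹`, the inverse of `σ(x)` in `S` -/
  inv : H ⧸ K.subgroupOf H → ℂ[G]
  mem : ∀ x, toFun x ∈ fixedSet F θ φ
  inv_mem : ∀ x, inv x ∈ fixedSet F θ φ
  mul_inv : ∀ x, toFun x * inv x = idem F θ φ
  inv_mul : ∀ x, inv x * toFun x = idem F θ φ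
  crossed : ∀ x y : H, eps F θ φ S₀ y (toFun x) * toFun y = toFun (x * y : H)
  magic : ∀ x : H, ∀ s ∈ fixedSet F θ φ,
    gconj s x = inv x * eps F θ φ S₀ x s * toFun x

end Config

end MagicCrossed

end

noncomputable section
namespace MagicCrossed
universe u
attribute [local instance] Fintype.ofFinite
set_option linter.unusedSectionVars false
local notation "⟪" x "⟫" => MonoidAlgebra.single x (1 : ℂ)

/-! ### Linear extensions of functions, the algebras kU inside ℂG, and conjugation sums. -/

section GroupAlgebra

variable {G : Type u} [Group G] [Finite G] {U V : Subgroup G}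

/-! The map κ(h) = h σ(Lh)⁻¹ carries the whole theorem. The cocycle identity of σ and the formula
s^h = σ(h)⁻¹ s^ε(h) σ(h) combine to σ(y) σ(x)^y = σ(xy), from which ε has disappeared; this says
that κ is multiplicative (`κ_mul`). Since ε is the identity on S₀, the values of κ centralize S₀
(`base_mul_κ`). On L one has κ(l) = l i, so the linear extension of κ sends e_(φ,F) to i
(`κLin_galIdem`). Moreover iFKi is spanned by L S, S by S₀ Z, and Z is contained in (FL)i; hence
iFUi is spanned by the products κ(h)s with h in U ∩ H and s in S₀ (`corner_mem_span`). In effect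
iFUi is the tensor product of S₀ and F(U ∩ H)e_(φ,F) over Z₀.

Nondegeneracy of the trace forms shows that S₀ is simple with the field Z₀ as its centre, and a
trace computation gives it dimension n² (`finrank_center_base`). For a class function f of U, each
map s ↦ f(κ(h)s) is a trace function on S₀, hence factors through the reduced trace, and n f(κ(h)s₀)
= f(κ(h)) whenever s₀ has reduced trace one. So f^ι(h) = f(κ(h))/n, which is `corr`; the choice of
s₀ does not matter. Restriction, multiplication by β and field automorphisms can be read off from
this formula. Conjugation and induction need in addition that g κ(x) g⁻¹ and κ(gxg⁻¹) have the same
value under class functions (`linExt_conj_κ`), and a count of cosets.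

Injectivity: e_(θ,F) is a rational multiple of the sum of the K-conjugates of i, so f is known from
its values on the corner iFUi, and these are F-linear combinations of the values of f^ι
(`mem_span_range_corr`). The equality of the fields of values comes from the same fact.

Irreducibility: for ψ irreducible, κ(e_ψ) commutes with the corner and so acts as a scalar on the
χ-part; therefore χ^ι is a multiple cψ of a single ψ (`corr_eq_smul_of_ne`). Comparing the regular
characters of the two blocks (`corr_blockReg`) with the degree formula yields c² = 1, and c is a
quotient of natural numbers, so c = 1 (`exists_corr_eq`). The isometry follows from orthonormality.
For the Brauer classes, (k ⊗ S₀) ⊗ k(U ∩ H)e_ψ with k = F(χ) maps isomorphically onto the corner i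
kUe_χ i, and a nonzero corner of a simple algebra is Brauer equivalent to it
(`brauerClass_eq_of_corner`).

Galois conjugates of θ and φ are never realized by representations. Only the identities in
`IsCharLike` are used for them, and these survive any field embedding. -/

theorem linExt_add (χ : U → ℂ) (a b : ℂ[G]) : linExt χ (a + b) = linExt χ a + linExt χ b := by
  simp [linExt, add_mul, Finset.sum_add_distrib]

theorem linExt_smul (χ : U → ℂ) (c : ℂ) (a : ℂ[G]) : linExt χ (c • a) = c * linExt χ a := by
  simp [linExt, Finset.mul_sum, mul_assoc]

/-- The linear extension of `χ` as a linear form on `ℂG`. -/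
def linForm (χ : U → ℂ) : ℂ[G] →ₗ[ℂ] ℂ where
  toFun := linExt χ
  map_add' := linExt_add χ
  map_smul' := linExt_smul χ

@[simp] theorem linExt_zero (χ : U → ℂ) : linExt χ (0 : ℂ[G]) = 0 := (linForm χ).map_zero

theorem linExt_sum {ι : Type*} (s : Finset ι) (χ : U → ℂ) (a : ι → ℂ[G]) :
    linExt χ (∑ j ∈ s, a j) = ∑ j ∈ s, linExt χ (a j) :=
  map_sum (linForm χ) a s

theorem linExt_smul_of_algebra {k : Type*} [Field k] [Algebra k ℂ] (χ : U → ℂ) (c : k) (a : ℂ[G]) :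
    linExt χ (c • a) = algebraMap k ℂ c * linExt χ a := by
  rw [← linExt_smul, algebraMap_smul]

theorem linExt_single_mem (χ : U → ℂ) {x : G} (hx : x ∈ U) (c : ℂ) :
    linExt χ (MonoidAlgebra.single x c) = c * χ ⟨x, hx⟩ := by
  classical
  rw [linExt, Finset.sum_eq_single (⟨x, hx⟩ : U)]
  · simp
  · intro y _ hy
    have : x ≠ y := fun h => hy (Subtype.ext h.symm)
    simp [MonoidAlgebra.coeff_single, this]
  · simp

@[simp] theorem linExt_single (χ : U → ℂ) (x : U) : linExt χ ⟪(x : G)⟫ = χ x := by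
  rw [linExt_single_mem χ x.2, one_mul]

theorem linExt_single_notMem (χ : U → ℂ) {x : G} (hx : x ∉ U) (c : ℂ) :
    linExt χ (MonoidAlgebra.single x c) = 0 := by
  classical
  refine Finset.sum_eq_zero fun y _ => ?_
  have : x ≠ y := fun h => hx (h ▸ y.2)
  simp [MonoidAlgebra.coeff_single, this]

theorem single_mul_single_one (x y : G) : ⟪x⟫ * ⟪y⟫ = ⟪x * y⟫ := by
  rw [MonoidAlgebra.single_mul_single, one_mul]

theorem single_mul_inv (x : G) : ⟪x⟫ * ⟪x⁻¹⟫ = (1 : ℂ[G]) := by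
  rw [single_mul_single_one, mul_inv_cancel, MonoidAlgebra.one_def]

theorem single_inv_mul (x : G) : ⟪x⁻¹⟫ * ⟪x⟫ = (1 : ℂ[G]) := by
  rw [single_mul_single_one, inv_mul_cancel, MonoidAlgebra.one_def]

section

variable {k : Type*} [Field k] [Algebra k ℂ]

theorem single_mem_groupAlg {x : G} (hx : x ∈ U) : ⟪x⟫ ∈ groupAlg k U :=
  Algebra.subset_adjoin ⟨⟨x, hx⟩, rfl⟩

theorem groupAlg_toSubmodule : Subalgebra.toSubmodule (groupAlg k U) =
    Submodule.span k (Set.range fun x : U => ⟪(x : G)⟫) := by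
  rw [groupAlg, Algebra.adjoin_eq_span]
  congr 1
  refine le_antisymm (Submonoid.closure_le (S := { carrier := _, one_mem' := ?_, mul_mem' := ?_ }).2
    subset_rfl) Submonoid.subset_closure
  · rintro _ _ ⟨x, rfl⟩ ⟨y, rfl⟩
    exact ⟨x * y, (single_mul_single_one _ _).symm⟩
  · exact ⟨1, by simp [MonoidAlgebra.one_def]⟩

/-- Products of elements of U lie in U, so the generated algebra is the linear span of U and no
product case is needed. -/
theorem groupAlg_induction {motive : ∀ a, a ∈ groupAlg k U → Prop}
    (single : ∀ x (hx : x ∈ U), motive ⟪x⟫ (single_mem_groupAlg hx))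
    (zero : motive 0 (zero_mem _))
    (add : ∀ a b ha hb, motive a ha → motive b hb → motive (a + b) (add_mem ha hb))
    (smul : ∀ (c : k) a ha, motive a ha → motive (c • a) (Subalgebra.smul_mem _ ha c))
    {a : ℂ[G]} (ha : a ∈ groupAlg k U) : motive a ha := by
  have key : ∀ b, b ∈ Submodule.span k (Set.range fun x : U => ⟪(x : G)⟫) ↔ b ∈ groupAlg k U :=
    fun b => by rw [← groupAlg_toSubmodule, Subalgebra.mem_toSubmodule]
  have h := (key a).2 ha
  suffices ∃ h', motive a h' from this.2
  clear ha
  induction h using Submodule.span_induction with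
  | mem a h => obtain ⟨x, rfl⟩ := h; exact ⟨_, single x x.2⟩
  | zero => exact ⟨_, zero⟩
  | add a b h1 h2 ha hb =>
    obtain ⟨_, ha⟩ := ha
    obtain ⟨_, hb⟩ := hb
    exact ⟨_, add a b _ _ ha hb⟩
  | smul c a h1 ha =>
    obtain ⟨_, ha⟩ := ha
    exact ⟨_, smul c a _ ha⟩

theorem mem_groupAlg_of_sum (c : U → k) :
    ∑ x : U, MonoidAlgebra.single (x : G) (algebraMap k ℂ (c x)) ∈ groupAlg k U := by
  refine Subalgebra.sum_mem _ fun x _ => ?_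
  have : MonoidAlgebra.single (x : G) (algebraMap k ℂ (c x)) = c x • ⟪(x : G)⟫ := by
    rw [MonoidAlgebra.smul_single, Algebra.smul_def, mul_one]
  rw [this]
  exact Subalgebra.smul_mem _ (single_mem_groupAlg x.2) _

theorem coeff_eq_zero_of_mem {a : ℂ[G]} (ha : a ∈ groupAlg k U) {x : G} (hx : x ∉ U) :
    a.coeff x = 0 := by
  classical
  induction ha using groupAlg_induction with
  | single y hy =>
    have : y ≠ x := fun h => hx (h ▸ hy)
    simp [MonoidAlgebra.coeff_single, this]
  | zero => simp
  | add a b _ _ ha hb => simp [ha, hb]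
  | smul c a _ ha => simp [ha]

theorem coeff_mem_of_mem {a : ℂ[G]} (ha : a ∈ groupAlg k U) (x : G) :
    ∃ c : k, algebraMap k ℂ c = a.coeff x := by
  classical
  induction ha using groupAlg_induction with
  | single y hy =>
    rcases eq_or_ne y x with rfl | h
    · exact ⟨1, by simp⟩
    · exact ⟨0, by simp [MonoidAlgebra.coeff_single, h]⟩
  | zero => exact ⟨0, by simp⟩
  | add a b _ _ ha hb =>
    obtain ⟨c, hc⟩ := ha
    obtain ⟨d, hd⟩ := hb
    exact ⟨c + d, by simp [hc, hd]⟩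
  | smul r a _ ha =>
    obtain ⟨c, hc⟩ := ha
    exact ⟨r * c, by simp [hc, Algebra.smul_def]⟩

theorem eq_sum_of_support {a : ℂ[G]} (h : ∀ x ∉ U, a.coeff x = 0) :
    a = ∑ x : U, MonoidAlgebra.single (x : G) (a.coeff x) := by
  classical
  ext y
  rw [MonoidAlgebra.coeff_sum, Finsupp.finsetSum_apply]
  by_cases hy : y ∈ U
  · rw [Finset.sum_eq_single (⟨y, hy⟩ : U)]
    · simp
    · intro z _ hz
      have : (z : G) ≠ y := fun h => hz (Subtype.ext h)
      simp [MonoidAlgebra.coeff_single, this]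
    · simp
  · rw [h y hy]
    refine (Finset.sum_eq_zero fun z _ => ?_).symm
    have : (z : G) ≠ y := fun h => hy (h ▸ z.2)
    simp [MonoidAlgebra.coeff_single, this]

/-- Group elements are a basis of ℂG, so rationality over k can be tested coefficient by
coefficient. -/
theorem mem_groupAlg_iff {a : ℂ[G]} : a ∈ groupAlg k U ↔
    (∀ x ∉ U, a.coeff x = 0) ∧ ∀ x ∈ U, ∃ c : k, algebraMap k ℂ c = a.coeff x := by
  refine ⟨fun h => ⟨fun x => coeff_eq_zero_of_mem h, fun x _ => coeff_mem_of_mem h x⟩, ?_⟩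
  rintro ⟨h0, h1⟩
  choose c hc using fun x : U => h1 x x.2
  rw [eq_sum_of_support h0]
  simp only [← hc]
  exact mem_groupAlg_of_sum c

theorem mem_groupAlg_complex {a : ℂ[G]} (ha : a ∈ groupAlg k U) : a ∈ groupAlg ℂ U :=
  mem_groupAlg_iff.2 ⟨fun _ => coeff_eq_zero_of_mem ha, fun x _ => ⟨a.coeff x, rfl⟩⟩

theorem groupAlg_mono (h : U ≤ V) : groupAlg k U ≤ groupAlg k V := by
  refine Algebra.adjoin_mono ?_
  rintro _ ⟨x, rfl⟩
  exact ⟨⟨x, h x.2⟩, rfl⟩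

theorem linExt_mem_of_mem {χ : U → ℂ} (hχ : ∀ x, ∃ c : k, algebraMap k ℂ c = χ x) {a : ℂ[G]}
    (ha : ∃ V : Subgroup G, a ∈ groupAlg k V) : ∃ c : k, algebraMap k ℂ c = linExt χ a := by
  choose f hf using hχ
  obtain ⟨V, ha⟩ := ha
  choose c hc using fun x => coeff_mem_of_mem ha x
  exact ⟨∑ x : U, c x * f x, by simp [linExt, hf, hc]⟩

end

theorem finiteDimensional_groupAlg (k : Type*) [Field k] [Algebra k ℂ] (U : Subgroup G) :
    FiniteDimensional k (groupAlg k U) := by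
  change FiniteDimensional k (Subalgebra.toSubmodule (groupAlg k U))
  rw [groupAlg_toSubmodule]
  exact FiniteDimensional.span_of_finite k (Set.finite_range _)

/-- Only one factor needs support in U: for u in U, the elements ux and xu lie in U exactly when x
does. -/
theorem linExt_mul_comm {f : U → ℂ} (hf : ∀ x y, f (x * y) = f (y * x)) {a : ℂ[G]}
    (ha : a ∈ groupAlg ℂ U) (b : ℂ[G]) : linExt f (a * b) = linExt f (b * a) := by
  induction ha using groupAlg_induction with
  | single u hu =>
    simp only [linExt, MonoidAlgebra.coeff_single_mul_apply, MonoidAlgebra.coeff_mul_single_apply,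
      one_mul, mul_one]
    have h1 := Fintype.sum_equiv (Equiv.mulLeft (⟨u, hu⟩ : U))
      (fun x : U => b.coeff x * f (⟨u, hu⟩ * x)) (fun x : U => b.coeff (u⁻¹ * x) * f x)
      (fun x => by simp)
    have h2 := Fintype.sum_equiv (Equiv.mulRight (⟨u, hu⟩ : U))
      (fun x : U => b.coeff x * f (x * ⟨u, hu⟩)) (fun x : U => b.coeff (x * u⁻¹) * f x)
      (fun x => by simp)
    rw [← h1, ← h2]
    exact Finset.sum_congr rfl fun x _ => by rw [hf]
  | zero => simp
  | add a b _ _ ha hb => simp [add_mul, mul_add, linExt_add, ha, hb]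
  | smul c a _ ha => simp [linExt_smul, ha]

theorem linExt_conj {f : U → ℂ} (hf : ∀ x y, f (x * y) = f (y * x)) {u : G} (hu : u ∈ U)
    (b : ℂ[G]) : linExt f (⟪u⟫ * b * ⟪u⁻¹⟫) = linExt f b := by
  rw [mul_assoc, linExt_mul_comm hf (single_mem_groupAlg hu), mul_assoc, single_inv_mul, mul_one]

theorem charIdem_mem_groupAlg (χ : U → ℂ) : charIdem χ ∈ groupAlg ℂ U :=
  mem_groupAlg_of_sum (k := ℂ) _

/-- The coefficient at 1 is the symmetrizing form of ℂG, and its χ-component is a multiple of χ.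
This is the bridge between values of χ and coefficients of elements of the block. -/
theorem coeff_one_mul_charIdem (χ : U → ℂ) (a : ℂ[G]) :
    (a * charIdem χ).coeff 1 = χ 1 / Nat.card U * linExt χ a := by
  simp only [charIdem, Finset.mul_sum, MonoidAlgebra.coeff_sum, Finsupp.finsetSum_apply,
    MonoidAlgebra.coeff_mul_single_apply, one_mul, linExt]
  refine Fintype.sum_equiv (Equiv.inv U) _ _ fun x => ?_
  simp
  ring

theorem charIdem_coeff (χ : U → ℂ) (x : U) :
    (charIdem χ).coeff (x : G) = χ 1 / Nat.card U * χ x⁻¹ := by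
  have h := coeff_one_mul_charIdem χ ⟪(x : G)⁻¹⟫
  rw [MonoidAlgebra.coeff_single_mul_apply, one_mul, inv_inv, mul_one] at h
  rw [h, ← Subgroup.coe_inv, linExt_single]

theorem charIdem_mul_comm {χ : U → ℂ} (hχ : ∀ x y, χ (x * y) = χ (y * x)) {a : ℂ[G]}
    (ha : a ∈ groupAlg ℂ U) : a * charIdem χ = charIdem χ * a := by
  induction ha using groupAlg_induction with
  | single u hu =>
    simp only [charIdem, Finset.sum_mul, Finset.mul_sum, MonoidAlgebra.single_mul_single,
      one_mul, mul_one]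
    refine Fintype.sum_equiv (MulAut.conj (⟨u, hu⟩ : U)).toEquiv _ _ fun x => ?_
    simp only [MulEquiv.toEquiv_eq_coe, MulEquiv.coe_toEquiv, MulAut.conj_apply,
      Subgroup.coe_mul, Subgroup.coe_inv, inv_mul_cancel_right]
    have h2 : ((⟨u, hu⟩ : U) * x * (⟨u, hu⟩ : U)⁻¹)⁻¹ = ⟨u, hu⟩ * (x⁻¹ * (⟨u, hu⟩ : U)⁻¹) := by
      group
    rw [h2, hχ, inv_mul_cancel_right]
  | zero => simp
  | add a b _ _ ha hb => simp [add_mul, mul_add, ha, hb]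
  | smul c a _ ha => simp [ha]

/-- The sum of the conjugates `u a u⁻¹` of `a` under the elements `u` of `U`. -/
def conjSum (U : Subgroup G) : ℂ[G] →ₗ[ℂ] ℂ[G] :=
  ∑ u : U, (LinearMap.mulLeft ℂ ⟪(u : G)⟫).comp (LinearMap.mulRight ℂ ⟪(u : G)⁻¹⟫)

theorem conjSum_apply (a : ℂ[G]) : conjSum U a = ∑ u : U, ⟪(u : G)⟫ * a * ⟪(u : G)⁻¹⟫ := by
  simp [conjSum, mul_assoc]

theorem conjSum_of_comm {a : ℂ[G]} (h : ∀ u ∈ U, a * ⟪u⟫ = ⟪u⟫ * a) :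
    conjSum U a = (Nat.card U : ℂ) • a := by
  rw [conjSum_apply, Finset.sum_congr rfl fun u _ => by
    rw [← h u u.2, mul_assoc, single_mul_inv, mul_one]]
  simp [Nat.cast_smul_eq_nsmul]

theorem single_mul_conjSum {u : G} (hu : u ∈ U) (a : ℂ[G]) :
    ⟪u⟫ * conjSum U a = conjSum U a * ⟪u⟫ := by
  simp only [conjSum_apply, Finset.mul_sum, Finset.sum_mul]
  refine Fintype.sum_equiv (Equiv.mulLeft (⟨u, hu⟩ : U)) _ _ fun x => ?_
  simp only [Equiv.coe_mulLeft, Subgroup.coe_mul, mul_inv_rev, ← single_mul_single_one, mul_assoc,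
    single_inv_mul, mul_one]

theorem linExt_conjSum {f : U → ℂ} (hf : ∀ x y, f (x * y) = f (y * x)) (hVU : V ≤ U) (b : ℂ[G]) :
    linExt f (conjSum V b) = Nat.card V * linExt f b := by
  rw [conjSum_apply, linExt_sum, Finset.sum_congr rfl fun u _ => linExt_conj hf (hVU u.2) b]
  simp

end GroupAlgebra

/-! ### Functions that satisfy the functional equation of irreducible characters -/

/-- The identities between the values of an irreducible character that determine the arithmetic of
its central idempotent. They are preserved by field automorphisms. -/
structure IsCharLike {Γ : Type*} [Group Γ] [Finite Γ] (χ : Γ → ℂ) : Prop where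
  deg : ∃ m : ℕ, 0 < m ∧ χ 1 = m
  comm : ∀ x y, χ (x * y) = χ (y * x)
  sum_conj : ∀ x u, χ 1 * ∑ y : Γ, χ (x * (y * u * y⁻¹)) = Nat.card Γ * (χ x * χ u)
  norm : ∑ x : Γ, χ x * χ x⁻¹ = Nat.card Γ

namespace IsCharLike

theorem one_ne_zero {Γ : Type*} [Group Γ] [Finite Γ] {χ : Γ → ℂ} (hχ : IsCharLike χ) :
    χ 1 ≠ 0 := by
  obtain ⟨m, hm, h⟩ := hχ.deg
  rw [h]
  exact_mod_cast hm.ne'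

variable {G : Type u} [Group G] [Finite G] {U : Subgroup G} {χ ψ : U → ℂ}

theorem card_ne_zero (U : Subgroup G) : (Nat.card U : ℂ) ≠ 0 := by
  exact_mod_cast Nat.card_pos.ne'

/-- This is Schur's lemma without modules: a conjugation sum is central in ℂU, and the functional
equation `sum_conj` identifies the scalar by which it acts on e_χ. -/
theorem conjSum_mul_charIdem (hχ : IsCharLike χ) {a : ℂ[G]} (ha : a ∈ groupAlg ℂ U) :
    conjSum U a * charIdem χ = (Nat.card U * linExt χ a / χ 1) • charIdem χ := by
  induction ha using groupAlg_induction with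
  | single u hu =>
    lift u to U using hu
    have key : ∀ y : U, ⟪(y : G)⟫ * ⟪(u : G)⟫ * ⟪(y : G)⁻¹⟫ * charIdem χ =
        ∑ z : U, MonoidAlgebra.single (z : G) (χ 1 / (Nat.card U : ℂ) *
          χ (z⁻¹ * (y * u * y⁻¹))) := by
      intro y
      simp only [charIdem, Finset.mul_sum, MonoidAlgebra.single_mul_single,
        one_mul]
      refine Fintype.sum_equiv (Equiv.mulLeft (y * u * y⁻¹)) _ _ fun z => ?_
      simp only [Equiv.coe_mulLeft, Subgroup.coe_mul, Subgroup.coe_inv, mul_inv_rev, inv_inv]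
      congr 3
      group
    rw [conjSum_apply, Finset.sum_mul, Finset.sum_congr rfl fun y _ => key y, Finset.sum_comm,
      linExt_single, charIdem, Finset.smul_sum]
    refine Finset.sum_congr rfl fun z _ => ?_
    rw [MonoidAlgebra.smul_single, smul_eq_mul]
    have hadd : ∀ f : U → ℂ, ∑ x : U, MonoidAlgebra.single (z : G) (f x) =
        MonoidAlgebra.single (z : G) (∑ x : U, f x) := fun f =>
      (map_sum (MonoidAlgebra.singleAddHom (z : G)) f Finset.univ).symm
    rw [hadd, ← Finset.mul_sum]
    congr 1
    have h := hχ.sum_conj z⁻¹ u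
    have h0 := hχ.one_ne_zero
    have h1 := card_ne_zero U
    rw [div_mul_eq_mul_div, h]
    field_simp
  | zero => simp
  | add a b _ _ ha hb => simp only [map_add, add_mul, ha, hb, linExt_add, mul_add, add_div, add_smul]
  | smul c a _ ha =>
    simp only [map_smul, smul_mul_assoc, ha, linExt_smul, smul_smul]
    congr 1
    ring

theorem linExt_charIdem (hχ : IsCharLike χ) : linExt χ (charIdem χ) = χ 1 := by
  rw [linExt]
  simp only [charIdem_coeff]
  have h1 := card_ne_zero U
  rw [Finset.sum_congr rfl fun x _ => (by ring : χ 1 / (Nat.card U : ℂ) * χ x⁻¹ * χ x =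
    χ 1 / (Nat.card U : ℂ) * (χ x * χ x⁻¹)), ← Finset.mul_sum, hχ.norm]
  field_simp

theorem mul_charIdem_of_central (hχ : IsCharLike χ) {a : ℂ[G]} (ha : a ∈ groupAlg ℂ U)
    (h : ∀ u ∈ U, a * ⟪u⟫ = ⟪u⟫ * a) : a * charIdem χ = (linExt χ a / χ 1) • charIdem χ := by
  have h1 := hχ.conjSum_mul_charIdem ha
  rw [conjSum_of_comm h, smul_mul_assoc, mul_div_assoc, mul_smul] at h1
  exact smul_right_injective _ (card_ne_zero U) h1

theorem charIdem_central (hχ : IsCharLike χ) : ∀ u ∈ U, charIdem χ * ⟪u⟫ = ⟪u⟫ * charIdem χ :=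
  fun _ hu => (charIdem_mul_comm hχ.comm (single_mem_groupAlg hu)).symm

theorem charIdem_idem (hχ : IsCharLike χ) : charIdem χ * charIdem χ = charIdem χ := by
  rw [hχ.mul_charIdem_of_central (charIdem_mem_groupAlg χ) hχ.charIdem_central,
    hχ.linExt_charIdem, div_self hχ.one_ne_zero, one_smul]

theorem linExt_mul_charIdem (hχ : IsCharLike χ) (a : ℂ[G]) :
    linExt χ (a * charIdem χ) = linExt χ a := by
  have h := coeff_one_mul_charIdem χ (a * charIdem χ)
  rw [mul_assoc, hχ.charIdem_idem, coeff_one_mul_charIdem] at h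
  exact (mul_left_cancel₀ (div_ne_zero hχ.one_ne_zero (card_ne_zero U)) h).symm

/-- Up to a constant, the coefficient of a e_χ at x is χ(a x⁻¹); so the trace form of χ is
nondegenerate on the block. -/
theorem mul_charIdem_eq_zero (hχ : IsCharLike χ) {a : ℂ[G]} (ha : a ∈ groupAlg ℂ U)
    (h : ∀ x ∈ U, linExt χ (a * ⟪x⟫) = 0) : a * charIdem χ = 0 := by
  ext x
  by_cases hx : x ∈ U
  · have h1 := coeff_one_mul_charIdem χ (a * ⟪x⁻¹⟫)
    rw [h _ (inv_mem hx), mul_zero, mul_assoc, ← hχ.charIdem_central _ (inv_mem hx), ← mul_assoc,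
      MonoidAlgebra.coeff_mul_single_apply] at h1
    simpa using h1
  · simpa using coeff_eq_zero_of_mem (mul_mem ha (charIdem_mem_groupAlg χ)) hx

/-- Comparing coefficients gives χ(1)χ = ψ(1)ψ. At 1 this is an equality of squares of natural
numbers, so the degrees agree. -/
theorem eq_of_charIdem_eq (hχ : IsCharLike χ) (hψ : IsCharLike ψ)
    (h : charIdem χ = charIdem ψ) : χ = ψ := by
  have h1 : ∀ x : U, χ 1 * χ x = ψ 1 * ψ x := by
    intro x
    have := congrArg (fun a : ℂ[G] => a.coeff ((x⁻¹ : U) : G)) h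
    simp only [charIdem_coeff, inv_inv] at this
    have hc := card_ne_zero U
    field_simp at this
    exact this
  have h2 : χ 1 = ψ 1 := by
    obtain ⟨m, hm, h3⟩ := hχ.deg
    obtain ⟨m', hm', h4⟩ := hψ.deg
    have h5 := h1 1
    rw [h3, h4] at h5 ⊢
    norm_cast at h5 ⊢
    exact Nat.mul_self_inj.1 h5
  funext x
  have := h1 x
  rw [h2] at this
  exact mul_left_cancel₀ hψ.one_ne_zero this

/-- Each central idempotent acts on the other as a scalar. If the product were nonzero, idempotency
would force both scalars to be 1, and the idempotents would coincide. -/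
theorem charIdem_mul_eq_zero (hχ : IsCharLike χ) (hψ : IsCharLike ψ) (hne : χ ≠ ψ) :
    charIdem χ * charIdem ψ = 0 := by
  have h1 := hψ.mul_charIdem_of_central (charIdem_mem_groupAlg χ) hχ.charIdem_central
  have h2 := hχ.mul_charIdem_of_central (charIdem_mem_groupAlg ψ) hψ.charIdem_central
  rw [charIdem_mul_comm hχ.comm (charIdem_mem_groupAlg ψ)] at h2
  by_contra h0
  generalize linExt ψ (charIdem χ) / ψ 1 = c at h1
  generalize linExt χ (charIdem ψ) / χ 1 = c' at h2
  have h3 : c • (charIdem χ * charIdem ψ) = charIdem χ * charIdem ψ := by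
    conv_rhs => rw [← hχ.charIdem_idem, mul_assoc, h1, mul_smul_comm]
  have h4 : c' • (charIdem χ * charIdem ψ) = charIdem χ * charIdem ψ := by
    conv_rhs => rw [← hψ.charIdem_idem, ← mul_assoc, h2, smul_mul_assoc]
  have h5 : ∀ r : ℂ, r • (charIdem χ * charIdem ψ) = charIdem χ * charIdem ψ → r = 1 := by
    intro r hr
    by_contra h
    have : (r - 1) • (charIdem χ * charIdem ψ) = 0 := by rw [sub_smul, hr, one_smul, sub_self]
    exact (smul_ne_zero (sub_ne_zero.2 h) h0) this
  rw [h5 c h3, one_smul] at h1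
  rw [h5 c' h4, one_smul] at h2
  exact hne (hχ.eq_of_charIdem_eq hψ (h2.symm.trans h1))

end IsCharLike

/-! ### Irreducible characters -/

section Irr

variable {Γ : Type*} [Group Γ] [Finite Γ]

theorem IsIrrChar.isCharLike {χ : Γ → ℂ} (h : IsIrrChar χ) : IsCharLike χ := by
  have hcomm := h.map_conj
  obtain ⟨d, ρ, hρ, rfl⟩ := h
  have hcard : (Nat.card Γ : ℂ) ≠ 0 := by exact_mod_cast Nat.card_pos.ne'
  have : Invertible (Nat.card Γ : ℂ) := invertibleOfNonzero hcard
  have hone : ρ.character 1 = d := by simp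
  refine ⟨⟨d, ?_, hone⟩, hcomm, ?_, ?_⟩
  · rcases Nat.eq_zero_or_pos d with rfl | h
    · have : Nontrivial (Subrepresentation ρ) := inferInstance
      obtain ⟨a, b, hab⟩ := this
      refine absurd (Subrepresentation.ext ?_) hab
      exact Subsingleton.elim _ _
    · exact h
  · intro x u
    -- The sum over the conjugates of u is an intertwiner, hence a scalar c; its trace gives c χ(1)
    -- = |Γ| χ(u).
    let T : Module.End ℂ (Fin d → ℂ) := ∑ y : Γ, ρ (y * u * y⁻¹)
    have hT : ∀ y : Γ, T ∘ₗ ρ y = ρ y ∘ₗ T := by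
      intro y
      change T * ρ y = ρ y * T
      simp only [T, Finset.sum_mul, Finset.mul_sum, ← map_mul]
      refine Fintype.sum_equiv (Equiv.mulLeft y⁻¹) _ _ fun g => ?_
      simp only [Equiv.coe_mulLeft]
      congr 1
      group
    let f : Representation.IntertwiningMap ρ ρ := ⟨T, hT⟩
    obtain ⟨c, hc⟩ :=
      (Representation.IsIrreducible.algebraMap_intertwiningMap_bijective_of_isAlgClosed
        (ρ := ρ)).2 f
    have hTc : T = c • LinearMap.id := by
      have := congrArg Representation.IntertwiningMap.toLinearMap hc
      rw [← show f.toLinearMap = T from rfl, ← this]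
      rfl
    have htr : ∀ x : Γ, ∑ y : Γ, ρ.character (x * (y * u * y⁻¹)) = c * ρ.character x := by
      intro x
      have h1 : LinearMap.trace ℂ (Fin d → ℂ) (ρ x * T) = c * ρ.character x := by
        rw [hTc]
        simp [Representation.character, ← Module.End.one_eq_id]
      rw [← h1]
      simp [T, Finset.mul_sum, Representation.character, ← map_mul]
    have h2 := htr 1
    simp only [one_mul, ρ.char_conj] at h2
    simp only [Finset.sum_const, Finset.card_univ, nsmul_eq_mul, ← Nat.card_eq_fintype_card] at h2
    rw [htr, ← mul_assoc, mul_comm _ c, ← h2]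
    ring
  · have horth := Representation.char_orthonormal ρ ρ
    rw [if_pos ⟨Representation.Equiv.refl ρ⟩, inv_mul_eq_iff_eq_mul₀ hcard, mul_one] at horth
    exact horth

open scoped ComplexOrder in
-- Averaging the standard Hermitian form gives an invariant positive definite matrix P, and P
-- conjugates M(x⁻¹) into the conjugate transpose of M(x).
theorem IsIrrChar.conj {χ : Γ → ℂ} (h : IsIrrChar χ) (x : Γ) :
    (starRingEnd ℂ) (χ x) = χ x⁻¹ := by
  classical
  obtain ⟨d, ρ, -, rfl⟩ := h
  let M : Γ →* Matrix (Fin d) (Fin d) ℂ :=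
    (LinearMap.toMatrixAlgEquiv' (R := ℂ) (n := Fin d)).toMonoidHom.comp ρ
  have hM : ∀ g, ρ.character g = (M g).trace := fun g =>
    LinearMap.trace_eq_matrix_trace ℂ (Pi.basisFun ℂ (Fin d)) (ρ g)
  let P : Matrix (Fin d) (Fin d) ℂ := ∑ g, (M g).conjTranspose * M g
  have hPx : P * M x⁻¹ = (M x).conjTranspose * P := by
    simp only [P, Finset.sum_mul, Finset.mul_sum]
    refine Fintype.sum_equiv (Equiv.mulRight x⁻¹) _ _ fun g => ?_
    simp only [Equiv.coe_mulRight, map_mul, Matrix.conjTranspose_mul, ← mul_assoc]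
    rw [← Matrix.conjTranspose_mul, ← Matrix.conjTranspose_mul, ← map_mul, ← map_mul]
    simp [mul_assoc]
  have hP : P.PosDef := by
    have : P = 1 + ∑ g ∈ Finset.univ.erase 1, (M g).conjTranspose * M g := by
      simp only [P]
      rw [← Finset.add_sum_erase Finset.univ _ (Finset.mem_univ (1 : Γ))]
      simp
    rw [this]
    refine Matrix.PosDef.one.add_posSemidef (Matrix.posSemidef_sum _ fun g _ => ?_)
    exact Matrix.posSemidef_conjTranspose_mul_self _
  have hu : IsUnit P.det := (Matrix.isUnit_iff_isUnit_det _).1 hP.isUnit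
  rw [hM, hM]
  change star _ = _
  rw [← Matrix.trace_conjTranspose]
  have : (M x).conjTranspose = P * M x⁻¹ * P⁻¹ := by
    rw [hPx, Matrix.mul_assoc, Matrix.mul_nonsing_inv _ hu, Matrix.mul_one]
  rw [this, Matrix.trace_mul_comm, ← Matrix.mul_assoc, Matrix.nonsing_inv_mul _ hu, Matrix.one_mul]

theorem IsIrrChar.sum_mul_inv_eq_zero {χ ψ : Γ → ℂ} (hχ : IsIrrChar χ) (hψ : IsIrrChar ψ)
    (hne : χ ≠ ψ) : ∑ x, χ x * ψ x⁻¹ = 0 := by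
  obtain ⟨d, ρ, hρ, rfl⟩ := hχ
  obtain ⟨d', ρ', hρ', rfl⟩ := hψ
  have hcard : (Nat.card Γ : ℂ) ≠ 0 := by exact_mod_cast Nat.card_pos.ne'
  have : Invertible (Nat.card Γ : ℂ) := invertibleOfNonzero hcard
  have horth := Representation.char_orthonormal ρ ρ'
  rw [if_neg fun ⟨e⟩ => hne (Representation.char_iso e).symm, inv_mul_eq_iff_eq_mul₀ hcard,
    mul_zero] at horth
  exact horth

theorem charInner_irr {χ ψ : Γ → ℂ} [Decidable (χ = ψ)] (hχ : IsIrrChar χ) (hψ : IsIrrChar ψ) :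
    charInner χ ψ = if χ = ψ then 1 else 0 := by
  have hcard : (Nat.card Γ : ℂ) ≠ 0 := by exact_mod_cast Nat.card_pos.ne'
  rw [charInner]
  simp only [hψ.conj]
  split_ifs with h
  · subst h
    rw [hχ.isCharLike.norm, inv_mul_cancel₀ hcard]
  · rw [hχ.sum_mul_inv_eq_zero hψ h, mul_zero]

/-- Orthogonality makes the irreducible characters linearly independent in a finite-dimensional
space. -/
theorem finite_irr : Set.Finite {χ : Γ → ℂ | IsIrrChar χ} := by
  have hcard : (Nat.card Γ : ℂ) ≠ 0 := by exact_mod_cast Nat.card_pos.ne'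
  have hli : LinearIndependent ℂ (fun χ : {χ : Γ → ℂ | IsIrrChar χ} => (χ : Γ → ℂ)) := by
    rw [linearIndependent_iff']
    intro s g hg j hj
    have h1 : ∑ x, (∑ i ∈ s, g i • (i : Γ → ℂ)) x * (j : Γ → ℂ) x⁻¹ = 0 := by
      rw [hg]
      simp
    simp only [Finset.sum_apply, Finset.sum_mul, Pi.smul_apply, smul_eq_mul, mul_assoc] at h1
    rw [Finset.sum_comm, Finset.sum_eq_single_of_mem j hj] at h1
    · rw [← Finset.mul_sum, j.2.isCharLike.norm] at h1
      exact (mul_eq_zero.1 h1).resolve_right hcard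
    · intro i _ hij
      rw [← Finset.mul_sum, i.2.sum_mul_inv_eq_zero j.2 fun h => hij (Subtype.ext h), mul_zero]
  exact hli.setFinite

theorem isIrrChar_of_irreducible {V : Type*} [AddCommGroup V] [Module ℂ V] [FiniteDimensional ℂ V]
    (ρ : Representation ℂ Γ V) (hρ : ρ.IsIrreducible) : IsIrrChar ρ.character := by
  let b := (Module.finBasis ℂ V).equivFun
  let ρ' : Representation ℂ Γ (Fin (Module.finrank ℂ V) → ℂ) :=
    (b.conjAlgEquiv ℂ).toMonoidHom.comp ρ
  let e : Representation.Equiv ρ ρ' := Representation.Equiv.mk b fun g => by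
    ext v
    simp [ρ']
  refine ⟨_, ρ', ?_, (Representation.char_iso e).symm⟩
  rw [Representation.irreducible_iff_isSimpleModule_asModule] at hρ ⊢
  have hbij : Function.Bijective (Representation.IntertwiningMap.equivLinearMapAsModule ρ ρ'
    e.toIntertwiningMap) := b.bijective
  exact IsSimpleModule.congr (LinearEquiv.ofBijective _ hbij).symm

/-- The element is central, so it acts on a simple module as a scalar; the trace of that scalar is
the sum assumed to vanish. -/
theorem smul_eq_zero_of_sum_mul_irr_eq_zero {f : Γ → ℂ} (hf : ∀ x y, f (x * y) = f (y * x))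
    (h : ∀ χ : Γ → ℂ, IsIrrChar χ → ∑ x, f x * χ x⁻¹ = 0) {M : Type*} [AddCommGroup M]
    [Module ℂ M] [Module ℂ[Γ] M] [IsScalarTower ℂ ℂ[Γ] M] [hM : IsSimpleModule ℂ[Γ] M] (v : M) :
    (∑ x, MonoidAlgebra.single x⁻¹ (f x) : ℂ[Γ]) • v = 0 := by
  let ρ : Representation ℂ Γ M := Representation.ofModule' M
  have hρa : ∀ a : ℂ[Γ], ∀ v : M, ρ.asAlgebraHom a v = a • v := by
    intro a v
    have : ρ.asAlgebraHom = Algebra.lsmul ℂ ℂ M := by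
      rw [Representation.asAlgebraHom_def]
      exact (MonoidAlgebra.lift ℂ (M →ₗ[ℂ] M) Γ).apply_symm_apply _
    rw [this, Algebra.lsmul_coe]
  have hρ : ρ.IsIrreducible := by
    rw [Representation.irreducible_iff_isSimpleModule_asModule]
    let e : ρ.asModule ≃ₗ[ℂ[Γ]] M :=
      { ρ.asModuleEquiv.toAddEquiv with
        map_smul' := fun a v => by
          change ρ.asModuleEquiv (a • v) = _
          rw [Representation.asModuleEquiv_map_smul, hρa]
          rfl }
    exact IsSimpleModule.congr e
  have : Module.Finite ℂ ℂ[Γ] := Module.Finite.of_basis (MonoidAlgebra.basis Γ ℂ)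
  have : Module.Finite ℂ M := Module.Finite.trans ℂ[Γ] M
  have hirr := h _ (isIrrChar_of_irreducible ρ hρ)
  let T : Module.End ℂ M := ∑ x, f x • ρ x⁻¹
  have hT : ∀ y : Γ, T ∘ₗ ρ y = ρ y ∘ₗ T := by
    intro y
    change T * ρ y = ρ y * T
    simp only [T, Finset.sum_mul, Finset.mul_sum, smul_mul_assoc, mul_smul_comm, ← map_mul]
    refine Fintype.sum_equiv (MulAut.conj y⁻¹).toEquiv _ _ fun g => ?_
    simp only [MulEquiv.toEquiv_eq_coe, MulEquiv.coe_toEquiv, MulAut.conj_apply, inv_inv]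
    congr 1
    · rw [mul_assoc, hf, mul_assoc, mul_inv_cancel, mul_one]
    · congr 1
      group
  let F : Representation.IntertwiningMap ρ ρ := ⟨T, hT⟩
  obtain ⟨c, hc⟩ :=
    (Representation.IsIrreducible.algebraMap_intertwiningMap_bijective_of_isAlgClosed
      (ρ := ρ)).2 F
  have hTc : T = c • LinearMap.id := by
    have := congrArg Representation.IntertwiningMap.toLinearMap hc
    rw [← show F.toLinearMap = T from rfl, ← this]
    rfl
  have htr : LinearMap.trace ℂ _ T = 0 := by
    rw [← hirr]
    simp [T, Representation.character]
  have hdim : (Module.finrank ℂ M : ℂ) ≠ 0 := by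
    have := (isIrrChar_of_irreducible ρ hρ).isCharLike.one_ne_zero
    rwa [Representation.char_one] at this
  have hc0 : c = 0 := by
    rw [hTc] at htr
    simp only [map_smul, LinearMap.trace_id, smul_eq_mul] at htr
    exact (mul_eq_zero.1 htr).resolve_right hdim
  have hT0 : ρ.asAlgebraHom (∑ x, MonoidAlgebra.single x⁻¹ (f x)) = 0 := by
    rw [← (by rw [hTc, hc0, zero_smul] : T = 0)]
    simp [T]
  rw [← hρa, hT0, LinearMap.zero_apply]

/-- An element annihilating every simple module lies in the Jacobson radical, which is zero by
Maschke's theorem. This is the completeness of the irreducible characters. -/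
theorem eq_zero_of_sum_mul_irr_eq_zero {f : Γ → ℂ} (hf : ∀ x y, f (x * y) = f (y * x))
    (h : ∀ χ : Γ → ℂ, IsIrrChar χ → ∑ x, f x * χ x⁻¹ = 0) : f = 0 := by
  classical
  have hcard : (Nat.card Γ : ℂ) ≠ 0 := by exact_mod_cast Nat.card_pos.ne'
  have : NeZero (Nat.card Γ : ℂ) := ⟨hcard⟩
  set b : ℂ[Γ] := ∑ x, MonoidAlgebra.single x⁻¹ (f x) with hbdef
  have hb : b ∈ Ring.jacobson ℂ[Γ] := by
    rw [Ring.jacobson_eq_sInf_isMaximal, Submodule.mem_sInf]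
    intro m hm
    have hM : IsSimpleModule ℂ[Γ] (ℂ[Γ] ⧸ m) :=
      isSimpleModule_iff_isCoatom.2 (Ideal.isMaximal_def.1 hm)
    have h2 := smul_eq_zero_of_sum_mul_irr_eq_zero hf h (Submodule.Quotient.mk 1 : ℂ[Γ] ⧸ m)
    rw [← hbdef, ← Submodule.Quotient.mk_smul, smul_eq_mul, mul_one,
      Submodule.Quotient.mk_eq_zero] at h2
    exact h2
  have h0 : b = 0 := by
    rw [IsSemisimpleRing.jacobson_eq_bot] at hb
    simpa using hb
  funext x
  have := congrArg (fun a : ℂ[Γ] => a.coeff x⁻¹) h0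
  simpa [hbdef, MonoidAlgebra.coeff_sum, Finsupp.finsetSum_apply, MonoidAlgebra.coeff_single,
    Finsupp.single_apply] using this

/-- The finite set of irreducible characters. -/
def irrFinset (Γ : Type*) [Group Γ] [Finite Γ] : Finset (Γ → ℂ) :=
  (finite_irr (Γ := Γ)).toFinset

@[simp] theorem mem_irrFinset {χ : Γ → ℂ} : χ ∈ irrFinset Γ ↔ IsIrrChar χ := by
  simp [irrFinset]

theorem classFun_eq_sum {f : Γ → ℂ} (hf : ∀ x y, f (x * y) = f (y * x)) :
    f = ∑ χ ∈ irrFinset Γ, ((Nat.card Γ : ℂ)⁻¹ * ∑ x, f x * χ x⁻¹) • χ := by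
  have hcard : (Nat.card Γ : ℂ) ≠ 0 := by exact_mod_cast Nat.card_pos.ne'
  obtain ⟨a, ha⟩ : ∃ a : (Γ → ℂ) → ℂ, ∀ χ, a χ = (Nat.card Γ : ℂ)⁻¹ * ∑ x, f x * χ x⁻¹ :=
    ⟨_, fun _ => rfl⟩
  simp only [← ha]
  rw [← sub_eq_zero]
  refine eq_zero_of_sum_mul_irr_eq_zero (fun x y => ?_) fun χ hχ => ?_
  · simp only [Pi.sub_apply, Finset.sum_apply, Pi.smul_apply, hf x y]
    congr 1
    exact Finset.sum_congr rfl fun χ hχ => by rw [(mem_irrFinset.1 hχ).map_conj]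
  · simp only [Pi.sub_apply, Finset.sum_apply, Pi.smul_apply, sub_mul, Finset.sum_sub_distrib,
      Finset.sum_mul, smul_eq_mul, mul_assoc]
    rw [Finset.sum_comm, Finset.sum_eq_single_of_mem χ (mem_irrFinset.2 hχ)]
    · rw [← Finset.mul_sum, hχ.isCharLike.norm, ha]
      field_simp
      simp
    · intro ψ hψ hne
      rw [← Finset.mul_sum, (mem_irrFinset.1 hψ).sum_mul_inv_eq_zero hχ hne, mul_zero]

end Irr

/-! ### Spans of irreducible characters as spaces of functions absorbing a central idempotent. -/

section Span

variable {G : Type u} [Group G] [Finite G] {U : Subgroup G}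

theorem linExt_charIdem_eq (f χ : U → ℂ) :
    linExt f (charIdem χ) = χ 1 * ((Nat.card U : ℂ)⁻¹ * ∑ x, f x * χ x⁻¹) := by
  rw [linExt]
  simp only [charIdem_coeff, Finset.mul_sum]
  refine Finset.sum_congr rfl fun x _ => ?_
  ring

theorem classFun_eq_sum_charIdem {f : U → ℂ} (hf : ∀ x y, f (x * y) = f (y * x)) :
    f = ∑ χ ∈ irrFinset U, (linExt f (charIdem χ) / χ 1) • χ := by
  conv_lhs => rw [classFun_eq_sum hf]
  refine Finset.sum_congr rfl fun χ hχ => ?_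
  rw [linExt_charIdem_eq, mul_div_cancel_left₀ _ (mem_irrFinset.1 hχ).isCharLike.one_ne_zero]

/-- Class functions `f` on `U` with `f(xe) = f(x)`. -/
structure IsBlockFun (e : ℂ[G]) (f : U → ℂ) : Prop where
  comm : ∀ x y, f (x * y) = f (y * x)
  absorb : ∀ x : U, linExt f (⟪(x : G)⟫ * e) = f x

theorem IsBlockFun.linExt_mul {e : ℂ[G]} {f : U → ℂ} (hf : IsBlockFun e f) {a : ℂ[G]}
    (ha : a ∈ groupAlg ℂ U) : linExt f (a * e) = linExt f a := by
  induction ha using groupAlg_induction with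
  | single x hx => rw [hf.absorb ⟨x, hx⟩, linExt_single f ⟨x, hx⟩]
  | zero => simp
  | add a b _ _ ha hb => simp [add_mul, linExt_add, ha, hb]
  | smul c a _ ha => simp [linExt_smul, ha]

/-- A central idempotent acts on e_χ by a scalar equal to its own square. -/
theorem IsCharLike.absorb_or {χ : U → ℂ} (hχ : IsCharLike χ) {e : ℂ[G]} (he : e ∈ groupAlg ℂ U)
    (hcen : ∀ u ∈ U, e * ⟪u⟫ = ⟪u⟫ * e) (hid : e * e = e) :
    linExt χ e = 0 ∧ e * charIdem χ = 0 ∨ linExt χ e = χ 1 ∧ e * charIdem χ = charIdem χ := by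
  have h1 := hχ.mul_charIdem_of_central he hcen
  have h0 := hχ.one_ne_zero
  have h2 : linExt χ e = (linExt χ e / χ 1) * linExt χ e := by
    conv_lhs => rw [← hid, ← hχ.linExt_mul_charIdem, mul_assoc, h1, mul_smul_comm, linExt_smul,
      hχ.linExt_mul_charIdem]
  rcases eq_or_ne (linExt χ e) 0 with h3 | h3
  · exact Or.inl ⟨h3, by rw [h1, h3, zero_div, zero_smul]⟩
  · have h4 : linExt χ e / χ 1 = 1 := mul_right_cancel₀ h3 (by rw [← h2, one_mul])
    refine Or.inr ⟨by rwa [div_eq_one_iff_eq h0] at h4, by rw [h1, h4, one_smul]⟩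

/-- A central idempotent e splits the irreducible characters into those it kills and those it fixes.
The right-hand side makes closure under restriction, induction and conjugation checkable without
decomposing into irreducibles. -/
theorem mem_irrSpan_iff {e : ℂ[G]} (he : e ∈ groupAlg ℂ U)
    (hcen : ∀ u ∈ U, e * ⟪u⟫ = ⟪u⟫ * e) (hid : e * e = e) {f : U → ℂ} :
    f ∈ irrSpan U e ↔ IsBlockFun e f := by
  constructor
  · intro h
    induction h using Submodule.span_induction with
    | mem χ h =>
      obtain ⟨hχ, h0⟩ := h
      refine ⟨hχ.map_conj, fun x => ?_⟩
      rcases hχ.isCharLike.absorb_or he hcen hid with h | h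
      · exact absurd h.1 h0
      · rw [← hχ.isCharLike.linExt_mul_charIdem, mul_assoc, h.2,
          hχ.isCharLike.linExt_mul_charIdem, linExt_single]
    | zero => exact ⟨fun _ _ => rfl, fun x => by simp [linExt]⟩
    | add f g _ _ hf hg =>
      refine ⟨fun x y => by simp [hf.comm x y, hg.comm x y], fun x => ?_⟩
      rw [Pi.add_apply, ← hf.absorb, ← hg.absorb]
      simp [linExt, mul_add, Finset.sum_add_distrib]
    | smul c f _ hf =>
      refine ⟨fun x y => by simp [hf.comm x y], fun x => ?_⟩
      rw [Pi.smul_apply, ← hf.absorb]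
      simp [linExt, Finset.mul_sum, mul_left_comm]
  · intro hf
    rw [classFun_eq_sum_charIdem hf.comm]
    refine Submodule.sum_mem _ fun χ hχ => ?_
    rw [mem_irrFinset] at hχ
    rcases hχ.isCharLike.absorb_or he hcen hid with h | h
    · rw [← hf.linExt_mul (charIdem_mem_groupAlg χ), ← charIdem_mul_comm hχ.map_conj he, h.2]
      simp
    · exact Submodule.smul_mem _ _ (Submodule.subset_span ⟨hχ, h.1 ▸ hχ.isCharLike.one_ne_zero⟩)

end Span

/-! ### Fields of character values. -/

section ValueField

/-- A character value is a sum of eigenvalues of ρ(g), and these are roots of unity of order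
dividing |Γ|. -/
theorem IsIrrChar.mem_of_rootsOfUnity {Γ : Type*} [Group Γ] [Finite Γ] {χ : Γ → ℂ}
    (h : IsIrrChar χ) (A : Subring ℂ) (hA : ∀ z : ℂ, z ^ Nat.card Γ = 1 → z ∈ A) (g : Γ) :
    χ g ∈ A := by
  obtain ⟨d, ρ, -, rfl⟩ := h
  rw [Representation.character,
    Module.End.trace_eq_sum_roots_charpoly_of_splits (IsAlgClosed.splits _)]
  refine Subring.multiset_sum_mem A _ fun z hz => hA z ?_
  have h1 : Module.End.HasEigenvalue (ρ g : Module.End ℂ (Fin d → ℂ)) z :=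
    (Module.End.hasEigenvalue_iff_isRoot_charpoly _ _).2 (Polynomial.isRoot_of_mem_roots hz)
  obtain ⟨v, hv⟩ := h1.exists_hasEigenvector
  have h2 : ∀ m : ℕ, (ρ g ^ m) v = z ^ m • v := fun m => hv.pow_apply m
  have h3 := h2 (Nat.card Γ)
  rw [← map_pow, pow_card_eq_one', map_one, Module.End.one_apply] at h3
  have h4 : (z ^ Nat.card Γ - 1) • v = 0 := by rw [sub_smul, one_smul, ← h3, sub_self]
  exact sub_eq_zero.1 ((smul_eq_zero.1 h4).resolve_right hv.2)

/-- The values lie in F(ζ) for a root of unity ζ. This is a finite abelian extension of F, so every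
intermediate field is finite and Galois over F. -/
theorem IsIrrChar.isGalois_valueField {Γ : Type*} [Group Γ] [Finite Γ] {χ : Γ → ℂ}
    (h : IsIrrChar χ) (F : Subfield ℂ) :
    FiniteDimensional F (valueField F χ) ∧ IsGalois F (valueField F χ) := by
  set N := Nat.card Γ
  have : NeZero N := ⟨Nat.card_pos.ne'⟩
  have hζ := Complex.isPrimitiveRoot_exp N (NeZero.ne N)
  set ζ : ℂ := Complex.exp (2 * Real.pi * Complex.I / N)
  have hint : IsIntegral F ζ := hζ.isIntegral (NeZero.pos N) |>.tower_top
  have hcyc : IsCyclotomicExtension {N} F (IntermediateField.adjoin F {ζ}) := by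
    change IsCyclotomicExtension {N} F (IntermediateField.adjoin F {ζ}).toSubalgebra
    rw [IntermediateField.adjoin_simple_toSubalgebra_of_isAlgebraic hint.isAlgebraic]
    exact hζ.adjoin_isCyclotomicExtension F
  have hle : valueField F χ ≤ IntermediateField.adjoin F {ζ} := by
    refine IntermediateField.adjoin_le_iff.2 ?_
    rintro _ ⟨g, rfl⟩
    refine h.mem_of_rootsOfUnity (IntermediateField.adjoin F {ζ}).toSubfield.toSubring
      (fun z hz => ?_) g
    obtain ⟨j, -, rfl⟩ := hζ.eq_pow_of_pow_eq_one hz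
    exact pow_mem (IntermediateField.mem_adjoin_simple_self F ζ) j
  have := IsCyclotomicExtension.isAbelianGalois {N} F (IntermediateField.adjoin F {ζ})
  have := IsCyclotomicExtension.finiteDimensional {N} F (IntermediateField.adjoin F {ζ})
  have hgal := IsAbelianGalois.of_algHom (IntermediateField.inclusion hle)
  exact ⟨FiniteDimensional.of_injective (IntermediateField.inclusion hle).toLinearMap
    (IntermediateField.inclusion_injective hle), hgal.toIsGalois⟩

end ValueField

/-- The defining identities are polynomial with integral coefficients, and complex conjugation does
not occur in them. They therefore pull back along an injective homomorphism and push forward along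
any other. -/
theorem IsCharLike.map {Γ : Type*} [Group Γ] [Finite Γ] {R : Type*} [CommRing R]
    {ψ : Γ → R} (i : R →+* ℂ) (hi : Function.Injective i) (h : IsCharLike fun x => i (ψ x))
    (f : R →+* ℂ) : IsCharLike fun x => f (ψ x) where
  deg := by
    obtain ⟨m, hm, h1⟩ := h.deg
    refine ⟨m, hm, ?_⟩
    rw [show ψ 1 = (m : R) from hi (by rw [h1, map_natCast]), map_natCast]
  comm x y := congrArg f (hi (h.comm x y))
  sum_conj x u := by
    have h1 := h.sum_conj x u
    rw [← map_sum, ← map_mul, ← map_mul, ← map_natCast i, ← map_mul] at h1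
    rw [← map_sum, ← map_mul, ← map_mul, ← map_natCast f, ← map_mul, hi h1]
  norm := by
    have h1 := h.norm
    simp only [← map_mul] at h1
    rw [← map_sum, ← map_natCast i] at h1
    simp only [← map_mul]
    rw [← map_sum, ← map_natCast f, hi h1]

/-! ### Galois conjugates of characters and the family of simultaneous conjugates. -/

section GalChar

variable {F : Subfield ℂ} {E : IntermediateField F ℂ} {X : Type*} {χ : X → ℂ}

theorem galChar_apply (hχ : ∀ x, χ x ∈ E) (γ : E ≃ₐ[F] E) (x : X) :
    galChar γ χ x = γ ⟨χ x, hχ x⟩ := by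
  simp [galChar, hχ x]

theorem galChar_mul (hχ : ∀ x, χ x ∈ E) (γ δ : E ≃ₐ[F] E) (x y : X)
    (h : galChar δ χ x = χ y) : galChar (γ * δ) χ x = galChar γ χ y := by
  rw [galChar_apply hχ, galChar_apply hχ, AlgEquiv.mul_apply]
  rw [galChar_apply hχ] at h
  exact congrArg (fun z => ((γ z : E) : ℂ)) (Subtype.ext h)

theorem galChar_injective (hχ : valueField F χ = E) :
    Function.Injective fun γ : E ≃ₐ[F] E => galChar γ χ := by
  intro γ δ h
  subst hχ
  have hmem : ∀ x, χ x ∈ valueField F χ := fun x => IntermediateField.subset_adjoin _ _ ⟨x, rfl⟩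
  have : (γ : valueField F χ →ₐ[F] valueField F χ) = δ := by
    refine IntermediateField.algHom_ext_of_eq_adjoin F (rfl : valueField F χ =
      IntermediateField.adjoin F (Set.range χ)) ?_
    rintro _ ⟨x, rfl⟩
    have h1 := congrFun h x
    simp only [galChar_apply hmem] at h1
    exact Subtype.ext h1
  exact AlgEquiv.coe_toAlgHom_injective this

theorem sum_gal_mem [FiniteDimensional F E] [IsGalois F E] (z : E) :
    ∃ c : F, (c : ℂ) = ∑ γ : E ≃ₐ[F] E, ((γ z : E) : ℂ) := by
  refine ⟨Algebra.trace F E z, ?_⟩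
  have h := congrArg (algebraMap E ℂ) (trace_eq_sum_automorphisms (K := F) z)
  rw [map_sum] at h
  rw [show ((Algebra.trace F E z : F) : ℂ) = algebraMap F ℂ (Algebra.trace F E z) from rfl,
    IsScalarTower.algebraMap_apply F E ℂ, h]
  refine Finset.sum_congr ?_ fun _ _ => rfl
  ext; simp

end GalChar

variable {G : Type u} [Group G] [Finite G]

/-- The simultaneous Galois conjugates `(Θ γ, Φ γ)` of a pair of characters `(θ, φ)` as in
`SemiInvariantConfig`, with the properties that the later arguments use. -/
structure ConjFamily (F : Subfield ℂ) (H K : Subgroup G) [K.Normal] (θ : K → ℂ)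
    (φ : ↥(H ⊓ K) → ℂ) (Γ : Type) [Fintype Γ] where
  /-- the conjugates of `θ` -/
  Θ : Γ → K → ℂ
  /-- the conjugates of `φ` -/
  Φ : Γ → ↥(H ⊓ K) → ℂ
  /-- the multiplicity of `φ` in `θ` -/
  n : ℕ
  n_ne : n ≠ 0
  nonempty : Nonempty Γ
  irrΘ : ∀ γ, IsCharLike (Θ γ)
  irrΦ : ∀ γ, IsCharLike (Φ γ)
  Θ_one : ∀ γ, Θ γ 1 = θ 1
  Φ_one : ∀ γ, Φ γ 1 = φ 1
  Θ_inj : Function.Injective Θ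
  Φ_inj : Function.Injective Φ
  mult : ∀ γ, ∑ l : ↥(H ⊓ K), Φ γ l⁻¹ * resFun inf_le_right (Θ γ) l = Nat.card ↥(H ⊓ K) * n
  perm : ∀ h ∈ H, ∃ π : Equiv.Perm Γ, ∀ γ,
    (∀ k k' : K, (k' : G) = h * k * h⁻¹ → Θ (π γ) k' = Θ γ k) ∧
    (∀ l l' : ↥(H ⊓ K), (l' : G) = h * l * h⁻¹ → Φ (π γ) l' = Φ γ l)
  rat : ∀ a ∈ groupAlg F K, ∀ l, ∃ c : F, (c : ℂ) = ∑ γ, linExt (Θ γ) a * Φ γ l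
  zero : ∀ a ∈ groupAlg F K, ∀ γ δ, linExt (Θ γ) a = 0 → linExt (Θ δ) a = 0
  idem_eq : idem F θ φ = ∑ γ, charIdem (Φ γ) * charIdem (Θ γ)
  galIdem_theta : galIdem F θ = ∑ γ, charIdem (Θ γ)
  galIdem_phi : galIdem F φ = ∑ γ, charIdem (Φ γ)

/-- The index set is Gal(F(φ)/F), acting on both characters because F(φ) = F(θ). All Galois theory
is spent here; afterwards only the listed properties matter. -/
theorem SemiInvariantConfig.exists_conjFamily {F : Subfield ℂ} {H K : Subgroup G} [K.Normal]
    {θ : K → ℂ} {φ : ↥(H ⊓ K) → ℂ} (hyp : SemiInvariantConfig F H K θ φ) :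
    ∃ (Γ : Type) (_ : Fintype Γ), Nonempty (ConjFamily F H K θ φ Γ) := by
  obtain ⟨hfin, hgal⟩ := hyp.phi_irr.isGalois_valueField F
  obtain ⟨n, hn, hmult⟩ := hyp.mult_pos
  have hsemi := hyp.semi
  have hE := hyp.valueField_eq
  have hφ1 := hyp.phi_irr
  have hidθ : galIdem F θ =
      ∑ᶠ γ : valueField F φ ≃ₐ[F] valueField F φ, charIdem (galChar γ θ) := by
    rw [hE, galIdem]
  have hidφ : galIdem F φ =
      ∑ γ : valueField F φ ≃ₐ[F] valueField F φ, charIdem (galChar γ φ) := by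
    rw [galIdem, finsum_eq_sum_of_fintype]
  have hidem : idem F θ φ = ∑ γ : valueField F φ ≃ₐ[F] valueField F φ,
      charIdem (galChar γ φ) * charIdem (galChar γ θ) := by
    rw [idem, finsum_eq_sum_of_fintype]
  have hmφ : ∀ x, φ x ∈ valueField F φ := fun x => IntermediateField.subset_adjoin _ _ ⟨x, rfl⟩
  have hmθ : ∀ x, θ x ∈ valueField F φ := fun x =>
    hE ▸ IntermediateField.subset_adjoin _ _ ⟨x, rfl⟩
  have hθinj := galChar_injective (F := F) (E := valueField F φ) (χ := θ) hE.symm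
  have hφinj := galChar_injective (F := F) (E := valueField F φ) (χ := φ) rfl
  generalize valueField F φ = E at *
  let v (γ : E ≃ₐ[F] E) : E →+* ℂ := (E.val.comp (γ : E →ₐ[F] E) : E →ₐ[F] ℂ)
  have hv : ∀ γ, Function.Injective (v γ) := fun γ => (v γ).injective
  have gθ : ∀ γ k, galChar γ θ k = v γ ⟨θ k, hmθ k⟩ := fun γ k => galChar_apply hmθ γ k
  have gφ : ∀ γ k, galChar γ φ k = v γ ⟨φ k, hmφ k⟩ := fun γ k => galChar_apply hmφ γ k
  have clθ : ∀ γ : E ≃ₐ[F] E, IsCharLike (galChar γ θ) := by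
    intro γ
    rw [show galChar γ θ = _ from funext (gθ γ)]
    exact IsCharLike.map (algebraMap E ℂ) (algebraMap E ℂ).injective hyp.theta_irr.isCharLike _
  have clφ : ∀ γ : E ≃ₐ[F] E, IsCharLike (galChar γ φ) := by
    intro γ
    rw [show galChar γ φ = _ from funext (gφ γ)]
    exact IsCharLike.map (algebraMap E ℂ) (algebraMap E ℂ).injective hφ1.isCharLike _
  have natE : ∀ (γ : E ≃ₐ[F] E) (z : E) (m : ℕ), (z : ℂ) = m → v γ z = m := by
    intro γ z m h
    rw [show z = m from Subtype.ext (by simpa using h), map_natCast]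
  have hlin : ∀ a ∈ groupAlg F K, ∃ z : E, ∀ γ, linExt (galChar γ θ) a = v γ z := by
    intro a ha
    choose c hc using fun x => coeff_mem_of_mem ha x
    refine ⟨∑ x : K, algebraMap F E (c x) * ⟨θ x, hmθ x⟩, fun γ => ?_⟩
    rw [map_sum]
    refine Finset.sum_congr rfl fun x _ => ?_
    rw [map_mul, gθ, ← hc]
    congr 1
    exact ((E.val.comp (γ : E →ₐ[F] E)).commutes (c x)).symm
  refine ⟨E ≃ₐ[F] E, inferInstance, ⟨{
    Θ := fun γ => galChar γ θ
    Φ := fun γ => galChar γ φ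
    n := n
    n_ne := hn.ne'
    nonempty := ⟨1⟩
    irrΘ := clθ
    irrΦ := clφ
    Θ_one := fun γ => ?_
    Φ_one := fun γ => ?_
    Θ_inj := hθinj
    Φ_inj := hφinj
    mult := fun γ => ?_
    perm := fun h hh => ?_
    rat := fun a ha l => ?_
    zero := fun a ha γ δ h0 => ?_
    idem_eq := hidem
    galIdem_theta := hidθ.trans (finsum_eq_sum_of_fintype _)
    galIdem_phi := hidφ }⟩⟩
  · obtain ⟨m, -, hm⟩ := hyp.theta_irr.isCharLike.deg
    rw [gθ, natE γ _ m hm, hm]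
  · obtain ⟨m, -, hm⟩ := hφ1.isCharLike.deg
    rw [gφ, natE γ _ m hm, hm]
  · have h1 : ∑ l : ↥(H ⊓ K), (⟨φ l⁻¹, hmφ l⁻¹⟩ : E) *
        ⟨resFun inf_le_right θ l, hmθ _⟩ = ((Nat.card ↥(H ⊓ K) * n : ℕ) : E) := by
      apply (algebraMap E ℂ).injective
      rw [map_sum, map_natCast, Nat.cast_mul, ← hmult, charInner,
        mul_inv_cancel_left₀ (IsCharLike.card_ne_zero _)]
      refine Finset.sum_congr rfl fun l _ => ?_
      rw [hφ1.conj, mul_comm]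
      rfl
    have h2 := congrArg (v γ) h1
    rw [map_sum, map_natCast, Nat.cast_mul] at h2
    rw [← h2]
    refine Finset.sum_congr rfl fun l _ => ?_
    rw [map_mul, gφ, resFun, gθ]
    rfl
  -- Semi-invariance supplies one δ for both characters, so conjugation by h is right multiplication
  -- by δ on the indices of both families at once.
  · obtain ⟨δ, h1, h2⟩ := hsemi h hh
    exact ⟨Equiv.mulRight δ, fun γ => ⟨fun k k' hk => galChar_mul hmθ γ δ k' k (h1 k k' hk),
      fun l l' hl => galChar_mul hmφ γ δ l' l (h2 l l' hl)⟩⟩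
  -- The sum is the trace from F(φ) to F of a single element.
  · obtain ⟨z, hz⟩ := hlin a ha
    obtain ⟨c, hc⟩ := sum_gal_mem (z * ⟨φ l, hmφ l⟩)
    refine ⟨c, hc.trans (Finset.sum_congr ?_ fun γ _ => ?_)⟩
    · ext; simp
    · rw [hz, gφ]
      exact map_mul (v γ) _ _
  · obtain ⟨z, hz⟩ := hlin a ha
    rw [hz] at h0 ⊢
    rw [(map_eq_zero_iff _ (hv γ)).1 h0, map_zero]

/-! ### Conjugation of idempotents, and Schur's lemma for corners. -/

section

variable {G : Type u} [Group G] [Finite G]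

theorem single_conj_charIdem {U : Subgroup G} {χ ψ : U → ℂ} (g : G)
    (hU : ∀ x, g * x * g⁻¹ ∈ U ↔ x ∈ U) (h : ∀ x x' : U, (x' : G) = g * x * g⁻¹ → ψ x' = χ x) :
    ⟪g⟫ * charIdem χ * ⟪g⁻¹⟫ = charIdem ψ := by
  ext y
  rw [MonoidAlgebra.coeff_mul_single_apply, MonoidAlgebra.coeff_single_mul_apply, inv_inv, one_mul,
    mul_one]
  have hy : y = g * (g⁻¹ * (y * g)) * g⁻¹ := by group
  by_cases hm : g⁻¹ * (y * g) ∈ U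
  · have hm' : y ∈ U := by
      rw [hy]
      exact (hU _).2 hm
    have h1 : ψ 1 = χ 1 := h 1 1 (by simp)
    have h2 := h (⟨_, hm⟩⁻¹) (⟨y, hm'⟩⁻¹) (by simp [mul_assoc])
    have h3 := charIdem_coeff χ ⟨_, hm⟩
    have h4 := charIdem_coeff ψ ⟨y, hm'⟩
    rw [h3, h4, h1, h2]
  · rw [coeff_eq_zero_of_mem (charIdem_mem_groupAlg χ) hm,
      coeff_eq_zero_of_mem (charIdem_mem_groupAlg ψ)]
    intro hy'
    refine hm ((hU _).1 ?_)
    rwa [← hy]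

theorem conjSum_mem {k : Type*} [Field k] [Algebra k ℂ] {V U : Subgroup G} (h : V ≤ U) {a : ℂ[G]}
    (ha : a ∈ groupAlg k U) : conjSum V a ∈ groupAlg k U := by
  rw [conjSum_apply]
  exact sum_mem fun x _ => mul_mem (mul_mem (single_mem_groupAlg (h x.2)) ha)
    (single_mem_groupAlg (inv_mem (h x.2)))

theorem conjSum_mul_right {V : Subgroup G} (a : ℂ[G]) {b : ℂ[G]}
    (hb : ∀ v ∈ V, ⟪v⟫ * b = b * ⟪v⟫) : conjSum V (a * b) = conjSum V a * b := by
  simp only [conjSum_apply, Finset.sum_mul]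
  refine Finset.sum_congr rfl fun v _ => ?_
  rw [mul_assoc _ _ b, hb _ (inv_mem v.2)]
  simp only [mul_assoc]

theorem conjSum_mul_left {V : Subgroup G} (a : ℂ[G]) {b : ℂ[G]}
    (hb : ∀ v ∈ V, ⟪v⟫ * b = b * ⟪v⟫) : conjSum V (b * a) = b * conjSum V a := by
  simp only [conjSum_apply, Finset.mul_sum]
  refine Finset.sum_congr rfl fun v _ => ?_
  simp only [← mul_assoc]
  rw [hb _ v.2]

/-- An element of a corner `jℂUj` that commutes with all `jyj` acts as a scalar on the part of
`χ` cut out by `j`. -/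
theorem IsCharLike.smul_mul_charIdem_of_comm_corner {U : Subgroup G} {χ : U → ℂ}
    (hχ : IsCharLike χ) {j w : ℂ[G]} (hj : j ∈ groupAlg ℂ U) (hw : w ∈ groupAlg ℂ U)
    (hjw : j * w = w) (hwj : w * j = w)
    (h : ∀ y ∈ U, w * (j * ⟪y⟫ * j) = j * ⟪y⟫ * j * w) :
    linExt χ j • (w * charIdem χ) = linExt χ w • (j * charIdem χ) := by
  -- Multiplying the commutation relation by y⁻¹ gives w y j y⁻¹ = j y w y⁻¹. After summation over y
  -- both conjugation sums act on e_χ as known scalars.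
  have h1 : w * conjSum U j = j * conjSum U w := by
    simp only [conjSum_apply, Finset.mul_sum]
    refine Finset.sum_congr rfl fun y _ => ?_
    have h2 := congrArg (· * ⟪(y : G)⁻¹⟫) (h y y.2)
    simp only [← mul_assoc, hwj] at h2 ⊢
    rw [h2, mul_assoc (j * _) j w, hjw]
  have h2 := congrArg (· * charIdem χ) h1
  simp only [mul_assoc, hχ.conjSum_mul_charIdem hj, hχ.conjSum_mul_charIdem hw,
    mul_smul_comm] at h2
  have hc := IsCharLike.card_ne_zero U
  have h3 := congrArg (fun x => (χ 1 / (Nat.card U : ℂ)) • x) h2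
  have h1' := hχ.one_ne_zero
  simp only [smul_smul] at h3
  have e1 : ∀ z : ℂ, χ 1 / (Nat.card U : ℂ) * (Nat.card U * z / χ 1) = z := fun z => by field_simp
  rwa [e1, e1] at h3

end

/-! ### The components of i and their rationality. -/

namespace ConjFamily

variable {G : Type u} [Group G] [Finite G] {F : Subfield ℂ} {H K : Subgroup G} [K.Normal]
  {θ : K → ℂ} {φ : ↥(H ⊓ K) → ℂ} {Γ : Type} [Fintype Γ] (D : ConjFamily F H K θ φ Γ)

local notation "𝐢" => idem F θ φ

include D in
theorem theta_ne : θ 1 ≠ 0 := by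
  obtain ⟨γ⟩ := D.nonempty
  rw [← D.Θ_one γ]
  exact (D.irrΘ γ).one_ne_zero

include D in
theorem phi_ne : φ 1 ≠ 0 := by
  obtain ⟨γ⟩ := D.nonempty
  rw [← D.Φ_one γ]
  exact (D.irrΦ γ).one_ne_zero

theorem n_cast_ne : (D.n : ℂ) ≠ 0 := by exact_mod_cast D.n_ne

/-- the idempotent of `Θ γ` -/
def eΘ (γ : Γ) : ℂ[G] := charIdem (D.Θ γ)

/-- the idempotent of `Φ γ` -/
def eΦ (γ : Γ) : ℂ[G] := charIdem (D.Φ γ)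

/-- the component of `i` belonging to `γ` -/
def f (γ : Γ) : ℂ[G] := D.eΦ γ * D.eΘ γ

theorem idem_eq_sum : 𝐢 = ∑ γ, D.f γ := D.idem_eq

theorem eΘ_mem (γ : Γ) : D.eΘ γ ∈ groupAlg ℂ K := charIdem_mem_groupAlg _

theorem eΦ_mem_inf (γ : Γ) : D.eΦ γ ∈ groupAlg ℂ (H ⊓ K) := charIdem_mem_groupAlg _

theorem eΦ_mem (γ : Γ) : D.eΦ γ ∈ groupAlg ℂ K := groupAlg_mono inf_le_right (D.eΦ_mem_inf γ)

theorem f_mem (γ : Γ) : D.f γ ∈ groupAlg ℂ K := mul_mem (D.eΦ_mem γ) (D.eΘ_mem γ)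

theorem eΘ_comm (γ : Γ) {a : ℂ[G]} (ha : a ∈ groupAlg ℂ K) : a * D.eΘ γ = D.eΘ γ * a :=
  charIdem_mul_comm (D.irrΘ γ).comm ha

theorem eΦ_comm (γ : Γ) {a : ℂ[G]} (ha : a ∈ groupAlg ℂ (H ⊓ K)) : a * D.eΦ γ = D.eΦ γ * a :=
  charIdem_mul_comm (D.irrΦ γ).comm ha

theorem eΘ_mul_self (γ : Γ) : D.eΘ γ * D.eΘ γ = D.eΘ γ := (D.irrΘ γ).charIdem_idem

theorem eΦ_mul_self (γ : Γ) : D.eΦ γ * D.eΦ γ = D.eΦ γ := (D.irrΦ γ).charIdem_idem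

theorem eΘ_mul_ne {γ δ : Γ} (h : γ ≠ δ) : D.eΘ γ * D.eΘ δ = 0 :=
  (D.irrΘ γ).charIdem_mul_eq_zero (D.irrΘ δ) (D.Θ_inj.ne h)

theorem eΦ_mul_ne {γ δ : Γ} (h : γ ≠ δ) : D.eΦ γ * D.eΦ δ = 0 :=
  (D.irrΦ γ).charIdem_mul_eq_zero (D.irrΦ δ) (D.Φ_inj.ne h)

theorem f_mul_eΘ (γ : Γ) : D.f γ * D.eΘ γ = D.f γ := by rw [f, mul_assoc, D.eΘ_mul_self]

theorem f_mul_eΘ_ne {γ δ : Γ} (h : γ ≠ δ) : D.f γ * D.eΘ δ = 0 := by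
  rw [f, mul_assoc, D.eΘ_mul_ne h, mul_zero]

theorem eΦ_mul_f (γ : Γ) : D.eΦ γ * D.f γ = D.f γ := by rw [f, ← mul_assoc, D.eΦ_mul_self]

theorem eΦ_mul_f_ne {γ δ : Γ} (h : γ ≠ δ) : D.eΦ γ * D.f δ = 0 := by
  rw [f, ← mul_assoc, D.eΦ_mul_ne h, zero_mul]

theorem f_comm_inf (γ : Γ) {a : ℂ[G]} (ha : a ∈ groupAlg ℂ (H ⊓ K)) : a * D.f γ = D.f γ * a := by
  rw [f, ← mul_assoc, D.eΦ_comm γ ha, mul_assoc, D.eΘ_comm γ (groupAlg_mono inf_le_right ha),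
    mul_assoc]

include D in
theorem idem_mem_complex : 𝐢 ∈ groupAlg ℂ K := by
  rw [D.idem_eq_sum]
  exact sum_mem fun γ _ => D.f_mem γ

theorem idem_mul_eΘ (γ : Γ) : 𝐢 * D.eΘ γ = D.f γ := by
  rw [D.idem_eq_sum, Finset.sum_mul, Finset.sum_eq_single γ, D.f_mul_eΘ]
  · exact fun δ _ h => D.f_mul_eΘ_ne h
  · simp

theorem eΘ_mul_idem (γ : Γ) : D.eΘ γ * 𝐢 = D.f γ := by
  rw [← D.eΘ_comm γ D.idem_mem_complex, D.idem_mul_eΘ]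

theorem eΦ_mul_idem (γ : Γ) : D.eΦ γ * 𝐢 = D.f γ := by
  rw [D.idem_eq_sum, Finset.mul_sum, Finset.sum_eq_single γ, D.eΦ_mul_f]
  · exact fun δ _ h => D.eΦ_mul_f_ne h.symm
  · simp

include D in
theorem idem_comm_inf {a : ℂ[G]} (ha : a ∈ groupAlg ℂ (H ⊓ K)) : a * 𝐢 = 𝐢 * a := by
  rw [D.idem_eq_sum, Finset.sum_mul, Finset.mul_sum]
  exact Finset.sum_congr rfl fun γ _ => D.f_comm_inf γ ha

theorem f_mul_idem (γ : Γ) : D.f γ * 𝐢 = D.f γ := by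
  rw [f, mul_assoc, D.eΘ_mul_idem, D.eΦ_mul_f, f]

include D in
theorem idem_mul_self : 𝐢 * 𝐢 = 𝐢 := by
  have h : ∑ γ, D.f γ * 𝐢 = ∑ γ, D.f γ := Finset.sum_congr rfl fun γ _ => D.f_mul_idem γ
  rwa [← Finset.sum_mul, ← D.idem_eq_sum] at h

theorem galIdem_theta_eq : galIdem F θ = ∑ γ, D.eΘ γ := D.galIdem_theta

theorem galIdem_phi_eq : galIdem F φ = ∑ γ, D.eΦ γ := D.galIdem_phi

include D in
theorem idem_mul_galIdem_theta : 𝐢 * galIdem F θ = 𝐢 := by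
  rw [D.galIdem_theta_eq, Finset.mul_sum]
  simp only [D.idem_mul_eΘ, ← D.idem_eq_sum]

include D in
theorem galIdem_phi_mul_idem : galIdem F φ * 𝐢 = 𝐢 := by
  rw [D.galIdem_phi_eq, Finset.sum_mul]
  simp only [D.eΦ_mul_idem, ← D.idem_eq_sum]

section Perm

theorem conj_eΘ {h : G} {π : Equiv.Perm Γ} (γ : Γ)
    (hπ : ∀ k k' : K, (k' : G) = h * k * h⁻¹ → D.Θ (π γ) k' = D.Θ γ k) :
    ⟪h⟫ * D.eΘ γ * ⟪h⁻¹⟫ = D.eΘ (π γ) := by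
  refine single_conj_charIdem h (fun x => ⟨fun hx => ?_, fun hx => ?_⟩) hπ
  · have := ‹K.Normal›.conj_mem _ hx h⁻¹
    simpa [mul_assoc] using this
  · exact ‹K.Normal›.conj_mem _ hx h

theorem conj_mem_inf_iff {h : G} (hh : h ∈ H) (x : G) : h * x * h⁻¹ ∈ H ⊓ K ↔ x ∈ H ⊓ K := by
  refine and_congr ⟨fun hx => ?_, fun hx => H.mul_mem (H.mul_mem hh hx) (H.inv_mem hh)⟩
    ⟨fun hx => ?_, fun hx => ‹K.Normal›.conj_mem _ hx h⟩
  · have := H.mul_mem (H.mul_mem (H.inv_mem hh) hx) hh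
    simpa [mul_assoc] using this
  · have := ‹K.Normal›.conj_mem _ hx h⁻¹
    simpa [mul_assoc] using this

theorem conj_eΦ {h : G} (hh : h ∈ H) {π : Equiv.Perm Γ} (γ : Γ)
    (hπ : ∀ l l' : ↥(H ⊓ K), (l' : G) = h * l * h⁻¹ → D.Φ (π γ) l' = D.Φ γ l) :
    ⟪h⟫ * D.eΦ γ * ⟪h⁻¹⟫ = D.eΦ (π γ) :=
  single_conj_charIdem h (conj_mem_inf_iff hh) hπ

theorem conj_mul_conj (h : G) (a b : ℂ[G]) :
    ⟪h⟫ * a * ⟪h⁻¹⟫ * (⟪h⟫ * b * ⟪h⁻¹⟫) = ⟪h⟫ * (a * b) * ⟪h⁻¹⟫ := by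
  have : ⟪h⟫ * a * ⟪h⁻¹⟫ * (⟪h⟫ * b * ⟪h⁻¹⟫) = ⟪h⟫ * a * (⟪h⁻¹⟫ * ⟪h⟫) * b * ⟪h⁻¹⟫ := by
    simp only [mul_assoc]
  rw [this, single_inv_mul, mul_one]
  simp only [mul_assoc]

theorem single_mul_eq_mul_single {h : G} {a : ℂ[G]} (ha : ⟪h⟫ * a * ⟪h⁻¹⟫ = a) :
    ⟪h⟫ * a = a * ⟪h⟫ := by
  conv_rhs => rw [← ha, mul_assoc, single_inv_mul, mul_one]

include D in
theorem single_mul_idem {h : G} (hh : h ∈ H) : ⟪h⟫ * 𝐢 = 𝐢 * ⟪h⟫ := by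
  refine single_mul_eq_mul_single ?_
  obtain ⟨π, hπ⟩ := D.perm h hh
  conv_rhs => rw [D.idem_eq_sum]
  rw [D.idem_eq_sum, Finset.mul_sum, Finset.sum_mul]
  refine Fintype.sum_equiv π _ _ fun γ => ?_
  rw [f, ← conj_mul_conj, D.conj_eΘ γ (hπ γ).1, D.conj_eΦ hh γ (hπ γ).2, f]

include D in
theorem single_mul_galIdem_phi {h : G} (hh : h ∈ H) :
    ⟪h⟫ * galIdem F φ = galIdem F φ * ⟪h⟫ := by
  refine single_mul_eq_mul_single ?_
  obtain ⟨π, hπ⟩ := D.perm h hh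
  rw [D.galIdem_phi_eq, Finset.mul_sum, Finset.sum_mul]
  exact Fintype.sum_equiv π _ _ fun γ => D.conj_eΦ hh γ (hπ γ).2

include D in
theorem single_mul_galIdem_theta_of_mem_left {h : G} (hh : h ∈ H) :
    ⟪h⟫ * galIdem F θ = galIdem F θ * ⟪h⟫ := by
  refine single_mul_eq_mul_single ?_
  obtain ⟨π, hπ⟩ := D.perm h hh
  rw [D.galIdem_theta_eq, Finset.mul_sum, Finset.sum_mul]
  exact Fintype.sum_equiv π _ _ fun γ => D.conj_eΘ γ (hπ γ).1

include D in
theorem single_mul_galIdem_theta (hG : ∀ g : G, ∃ h ∈ H, ∃ k ∈ K, g = h * k) (g : G) :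
    ⟪g⟫ * galIdem F θ = galIdem F θ * ⟪g⟫ := by
  obtain ⟨h, hh, k, hk, rfl⟩ := hG g
  have h1 : ⟪k⟫ * galIdem F θ = galIdem F θ * ⟪k⟫ := by
    rw [D.galIdem_theta_eq, Finset.mul_sum, Finset.sum_mul]
    exact Finset.sum_congr rfl fun γ _ => D.eΘ_comm γ (single_mem_groupAlg hk)
  rw [← single_mul_single_one, mul_assoc, h1, ← mul_assoc,
    D.single_mul_galIdem_theta_of_mem_left hh, mul_assoc]

end Perm

section Values

theorem linExt_eΦ (γ : Γ) : linExt (D.Θ γ) (D.eΦ γ) = D.n * φ 1 := by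
  have h1 : linExt (D.Θ γ) (D.eΦ γ) = φ 1 / Nat.card ↥(H ⊓ K) *
      ∑ l : ↥(H ⊓ K), D.Φ γ l⁻¹ * resFun inf_le_right (D.Θ γ) l := by
    rw [eΦ, charIdem, linExt_sum, Finset.mul_sum]
    refine Finset.sum_congr rfl fun l _ => ?_
    rw [linExt_single_mem _ l.2.2, D.Φ_one, mul_assoc]
    rfl
  have hc := IsCharLike.card_ne_zero (H ⊓ K)
  rw [h1, D.mult]
  field_simp

theorem linExt_mul_eΘ (γ : Γ) (a : ℂ[G]) : linExt (D.Θ γ) (a * D.eΘ γ) = linExt (D.Θ γ) a :=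
  (D.irrΘ γ).linExt_mul_charIdem a

theorem linExt_mul_idem (γ : Γ) (a : ℂ[G]) :
    linExt (D.Θ γ) (a * 𝐢) = linExt (D.Θ γ) (a * D.eΦ γ) := by
  rw [← linExt_mul_eΘ, mul_assoc, D.idem_mul_eΘ, f, ← mul_assoc, linExt_mul_eΘ]

theorem linExt_idem (γ : Γ) : linExt (D.Θ γ) 𝐢 = D.n * φ 1 := by
  have h := D.linExt_mul_idem γ 1
  rwa [one_mul, one_mul, D.linExt_eΦ] at h

theorem linExt_mul_comm' (γ : Γ) {a : ℂ[G]} (ha : a ∈ groupAlg ℂ K) (b : ℂ[G]) :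
    linExt (D.Θ γ) (a * b) = linExt (D.Θ γ) (b * a) :=
  linExt_mul_comm (D.irrΘ γ).comm ha b

/-- An element of the centralizer of `L` meets the elements of `ℂL` through `Φ γ` only. -/
theorem linExt_mul_of_comm (γ : Γ) {a s : ℂ[G]} (ha : a ∈ groupAlg ℂ (H ⊓ K))
    (hs : ∀ l ∈ H ⊓ K, ⟪l⟫ * s = s * ⟪l⟫) (hsi : 𝐢 * s = s) :
    linExt (D.Θ γ) (a * s) = linExt (D.Φ γ) a * linExt (D.Θ γ) s / φ 1 := by
  have h1 : D.eΘ γ * s = D.eΘ γ * D.eΦ γ * s := by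
    rw [← hsi, ← mul_assoc, D.eΘ_mul_idem, f, ← mul_assoc, ← D.eΘ_comm γ (D.eΦ_mem γ),
      mul_assoc _ 𝐢, hsi]
  have h2 : ∀ b ∈ groupAlg ℂ K, linExt (D.Θ γ) (b * s) = linExt (D.Θ γ) (b * D.eΦ γ * s) := by
    intro b hb
    have e : ∀ c, linExt (D.Θ γ) (D.eΘ γ * c) = linExt (D.Θ γ) c := fun c => by
      rw [D.linExt_mul_comm' γ (D.eΘ_mem γ), linExt_mul_eΘ]
    rw [← e, ← mul_assoc, ← D.eΘ_comm γ hb, mul_assoc, h1, ← mul_assoc, ← mul_assoc, D.eΘ_comm γ hb,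
      mul_assoc, mul_assoc, e, mul_assoc]
  have hc := IsCharLike.card_ne_zero (H ⊓ K)
  have hd := D.phi_ne
  -- Averaging over L does not change the character value, commutes with s and e_Φ, and turns a into
  -- an element acting on e_Φ as a scalar.
  have h3 := linExt_conjSum (V := H ⊓ K) (D.irrΘ γ).comm inf_le_right (a * D.eΦ γ * s)
  rw [conjSum_mul_right _ hs, conjSum_mul_right _ fun l hl => D.eΦ_comm γ (single_mem_groupAlg hl),
    eΦ, (D.irrΦ γ).conjSum_mul_charIdem ha, smul_mul_assoc, linExt_smul, ← eΦ, D.Φ_one] at h3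
  have h4 := h2 1 (one_mem _)
  rw [one_mul, one_mul] at h4
  rw [h2 a (groupAlg_mono inf_le_right ha)]
  rw [← h4] at h3
  field_simp at h3 ⊢
  linear_combination -h3

theorem linExt_inf_mul_idem (γ : Γ) {a : ℂ[G]} (ha : a ∈ groupAlg ℂ (H ⊓ K)) :
    linExt (D.Θ γ) (a * 𝐢) = D.n * linExt (D.Φ γ) a := by
  rw [D.linExt_mul_of_comm γ ha (fun l hl => D.idem_comm_inf (single_mem_groupAlg hl))
    D.idem_mul_self, D.linExt_idem]
  have hd := D.phi_ne
  field_simp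

/-- Each coefficient is a rational multiple of a Galois trace. This is how elements of Z get
represented by elements of FL. -/
theorem rat_eΦ {a : ℂ[G]} (ha : a ∈ groupAlg F K) :
    ∑ γ, linExt (D.Θ γ) a • D.eΦ γ ∈ groupAlg F (H ⊓ K) := by
  rw [mem_groupAlg_iff]
  refine ⟨fun x hx => ?_, fun x hx => ?_⟩
  · exact coeff_eq_zero_of_mem (k := ℂ)
      (sum_mem fun γ _ => Subalgebra.smul_mem _ (D.eΦ_mem_inf γ) _) hx
  · obtain ⟨c, hc⟩ := D.rat a ha (⟨x, hx⟩⁻¹)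
    obtain ⟨γ₀⟩ := D.nonempty
    obtain ⟨m, -, hm⟩ := (D.irrΦ γ₀).deg
    rw [D.Φ_one] at hm
    refine ⟨(m : F) / (Nat.card ↥(H ⊓ K) : F) * c, ?_⟩
    rw [MonoidAlgebra.coeff_sum, Finsupp.finsetSum_apply, map_mul, map_div₀, map_natCast,
      map_natCast, show algebraMap F ℂ c = c from rfl, hc, Finset.mul_sum]
    refine Finset.sum_congr rfl fun γ _ => ?_
    have h1 := charIdem_coeff (D.Φ γ) ⟨x, hx⟩
    rw [MonoidAlgebra.coeff_smul, Finsupp.smul_apply, eΦ, h1, D.Φ_one, ← hm, smul_eq_mul]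
    ring

theorem f_coeff (γ : Γ) (x : G) : (D.f γ).coeff x = θ 1 / Nat.card K * (φ 1 / Nat.card ↥(H ⊓ K) *
    ∑ l : ↥(H ⊓ K), linExt (D.Θ γ) ⟪x⁻¹ * l⟫ * D.Φ γ l⁻¹) := by
  have h1 := coeff_one_mul_charIdem (D.Θ γ) (⟪x⁻¹⟫ * D.eΦ γ)
  rw [← eΘ, mul_assoc, ← f, MonoidAlgebra.coeff_single_mul_apply, inv_inv, one_mul, mul_one] at h1
  rw [h1, D.Θ_one, eΦ, charIdem, Finset.mul_sum, linExt_sum]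
  congr 1
  rw [Finset.mul_sum]
  refine Finset.sum_congr rfl fun l _ => ?_
  rw [MonoidAlgebra.single_mul_single, one_mul, D.Φ_one, ← mul_one (_ * D.Φ γ l⁻¹),
    ← smul_eq_mul _ (1 : ℂ), ← MonoidAlgebra.smul_single, linExt_smul]
  ring

include D in
-- The coefficients of i are rational multiples of sums of Galois traces, so they lie in F although
-- those of the components need not.
theorem idem_mem : 𝐢 ∈ groupAlg F K := by
  rw [mem_groupAlg_iff]
  refine ⟨fun x hx => coeff_eq_zero_of_mem D.idem_mem_complex hx, fun x hx => ?_⟩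
  choose c hc using fun l : ↥(H ⊓ K) => D.rat ⟪x⁻¹ * l⟫
    (single_mem_groupAlg (mul_mem (inv_mem hx) l.2.2)) l⁻¹
  obtain ⟨γ₀⟩ := D.nonempty
  obtain ⟨m, -, hm⟩ := (D.irrΦ γ₀).deg
  obtain ⟨r, -, hr⟩ := (D.irrΘ γ₀).deg
  rw [D.Φ_one] at hm
  rw [D.Θ_one] at hr
  refine ⟨(r : F) / Nat.card K * ((m : F) / (Nat.card ↥(H ⊓ K) : F) * ∑ l, c l), ?_⟩
  rw [D.idem_eq_sum, MonoidAlgebra.coeff_sum, Finsupp.finsetSum_apply]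
  simp only [D.f_coeff, ← Finset.mul_sum, map_mul, map_div₀, map_natCast, map_sum, hm, hr]
  rw [Finset.sum_comm]
  simp only [← hc]
  rfl

include D in
theorem idem_mem_cornerSet : 𝐢 ∈ cornerSet F θ φ :=
  ⟨1, one_mem _, by rw [mul_one, D.idem_mul_self]⟩

/-- The conjugation sum acts on every e_Θ by the same nonzero scalar. Hence i is a full idempotent
in the block of θ, and e_(θ,F) can be recovered from it. -/
theorem galIdem_theta_eq_conjSum : conjSum K 𝐢 =
    (Nat.card K * D.n * φ 1 / θ 1 : ℂ) • galIdem F θ := by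
  have h1 : conjSum K 𝐢 * galIdem F θ = conjSum K 𝐢 := by
    rw [← conjSum_mul_right, D.idem_mul_galIdem_theta]
    intro k hk
    rw [D.galIdem_theta_eq, Finset.mul_sum, Finset.sum_mul]
    exact Finset.sum_congr rfl fun γ _ => D.eΘ_comm γ (single_mem_groupAlg hk)
  rw [← h1, D.galIdem_theta_eq, Finset.mul_sum, Finset.smul_sum]
  refine Finset.sum_congr rfl fun γ _ => ?_
  rw [eΘ, (D.irrΘ γ).conjSum_mul_charIdem D.idem_mem_complex, D.linExt_idem, D.Θ_one, mul_assoc]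

end Values

end ConjFamily

/-! ### The action s ↦ s^h, and characters of nilpotent elements. -/

section

variable {G : Type u} [Group G] [Finite G]

theorem gconj_eq_iff (s t : ℂ[G]) (h : G) : gconj s h = t ↔ s * ⟪h⟫ = ⟪h⟫ * t := by
  rw [gconj, mul_assoc]
  constructor
  · rintro rfl
    rw [← mul_assoc, single_mul_inv, one_mul]
  · intro e
    rw [e, ← mul_assoc, single_inv_mul, one_mul]

theorem gconj_mul (s t : ℂ[G]) (h : G) : gconj (s * t) h = gconj s h * gconj t h := by
  have e : ⟪h⟫ * ⟪h⁻¹⟫ = (1 : ℂ[G]) := single_mul_inv h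
  have : gconj s h * gconj t h = ⟪h⁻¹⟫ * s * (⟪h⟫ * ⟪h⁻¹⟫) * t * ⟪h⟫ := by
    simp only [gconj, mul_assoc]
  rw [this, e, mul_one, gconj]
  simp only [mul_assoc]

theorem gconj_add (s t : ℂ[G]) (h : G) : gconj (s + t) h = gconj s h + gconj t h := by
  simp only [gconj, mul_add, add_mul]

theorem gconj_smul {k : Type*} [Field k] [Algebra k ℂ] (c : k) (t : ℂ[G]) (h : G) :
    gconj (c • t) h = c • gconj t h := by
  simp only [gconj, mul_smul_comm, smul_mul_assoc]

theorem gconj_gconj (s : ℂ[G]) (g h : G) : gconj (gconj s g) h = gconj s (g * h) := by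
  simp only [gconj, mul_inv_rev, ← single_mul_single_one, mul_assoc]

theorem gconj_one (s : ℂ[G]) : gconj s 1 = s := by
  simp [gconj, ← MonoidAlgebra.one_def]

theorem trace_mulLeft_groupAlgebra (a : ℂ[G]) :
    LinearMap.trace ℂ ℂ[G] (LinearMap.mulLeft ℂ a) = Nat.card G * a.coeff 1 := by
  classical
  rw [LinearMap.trace_eq_matrix_trace ℂ (MonoidAlgebra.basis G ℂ), Matrix.trace]
  have : ∀ g : G, (LinearMap.toMatrix (MonoidAlgebra.basis G ℂ) (MonoidAlgebra.basis G ℂ)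
      (LinearMap.mulLeft ℂ a)).diag g = a.coeff 1 := by
    intro g
    rw [Matrix.diag_apply, LinearMap.toMatrix_apply]
    simp only [MonoidAlgebra.basis, LinearMap.mulLeft_apply]
    change (a * ⟪g⟫).coeff g = _
    rw [MonoidAlgebra.coeff_mul_single_apply, mul_inv_cancel, mul_one]
  rw [Finset.sum_congr rfl fun g _ => this g]
  simp [Nat.card_eq_fintype_card]

/-- Up to a nonzero factor, χ(a) is the trace of left multiplication by a e_χ on ℂG, and this
operator is nilpotent. -/
theorem IsCharLike.linExt_eq_zero_of_isNilpotent {U : Subgroup G} {χ : U → ℂ} (hχ : IsCharLike χ)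
    {a : ℂ[G]} (ha : a ∈ groupAlg ℂ U) (hn : IsNilpotent a) : linExt χ a = 0 := by
  have h1 : IsNilpotent (a * charIdem χ) :=
    Commute.isNilpotent_mul_right (charIdem_mul_comm hχ.comm ha) hn
  have h2 : IsNilpotent (LinearMap.mulLeft ℂ (a * charIdem χ)) := by
    obtain ⟨m, hm⟩ := h1
    exact ⟨m, by rw [LinearMap.pow_mulLeft, hm, LinearMap.mulLeft_zero_eq_zero]⟩
  have h3 := (LinearMap.isNilpotent_trace_of_isNilpotent h2).eq_zero
  rw [trace_mulLeft_groupAlgebra, coeff_one_mul_charIdem] at h3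
  have hG : (Nat.card G : ℂ) ≠ 0 := by exact_mod_cast Nat.card_pos.ne'
  exact ((mul_eq_zero.1 ((mul_eq_zero.1 h3).resolve_left hG)).resolve_left
    (div_ne_zero hχ.one_ne_zero (card_ne_zero U)))

end

/-! ### The algebras S and Z, and the corner iFKi. -/

namespace ConjFamily

variable {G : Type u} [Group G] [Finite G] {F : Subfield ℂ} {H K : Subgroup G} [K.Normal]
  {θ : K → ℂ} {φ : ↥(H ⊓ K) → ℂ} {Γ : Type} [Fintype Γ] (D : ConjFamily F H K θ φ Γ)

local notation "𝐢" => idem F θ φ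

include D in
theorem mem_cornerSet_iff {c : ℂ[G]} :
    c ∈ cornerSet F θ φ ↔ c ∈ groupAlg F K ∧ 𝐢 * c = c ∧ c * 𝐢 = c := by
  constructor
  · rintro ⟨a, ha, rfl⟩
    refine ⟨mul_mem (mul_mem D.idem_mem ha) D.idem_mem, ?_, ?_⟩
    · rw [← mul_assoc, ← mul_assoc, D.idem_mul_self]
    · rw [mul_assoc, D.idem_mul_self]
  · rintro ⟨h1, h2, h3⟩
    exact ⟨c, h1, by rw [h2, h3]⟩

theorem gconj_eq_self_iff (s : ℂ[G]) (l : G) : gconj s l = s ↔ ⟪l⟫ * s = s * ⟪l⟫ := by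
  rw [gconj_eq_iff, eq_comm]

include D in
theorem mem_fixedSet_iff {s : ℂ[G]} : s ∈ fixedSet F θ φ ↔ s ∈ groupAlg F K ∧ 𝐢 * s = s ∧
    s * 𝐢 = s ∧ ∀ l ∈ H ⊓ K, ⟪l⟫ * s = s * ⟪l⟫ := by
  simp only [fixedSet, Set.mem_ofPred_eq, D.mem_cornerSet_iff, gconj_eq_self_iff, and_assoc]

/-- The algebra `S`. -/
def S : NonUnitalSubalgebra F ℂ[G] where
  carrier := fixedSet F θ φ
  add_mem' := by
    intro a b ha hb
    rw [D.mem_fixedSet_iff] at ha hb ⊢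
    refine ⟨add_mem ha.1 hb.1, by rw [mul_add, ha.2.1, hb.2.1],
      by rw [add_mul, ha.2.2.1, hb.2.2.1], fun l hl => ?_⟩
    rw [mul_add, add_mul, ha.2.2.2 l hl, hb.2.2.2 l hl]
  zero_mem' := by
    rw [D.mem_fixedSet_iff]
    simp
  mul_mem' := by
    intro a b ha hb
    rw [D.mem_fixedSet_iff] at ha hb ⊢
    refine ⟨mul_mem ha.1 hb.1, by rw [← mul_assoc, ha.2.1],
      by rw [mul_assoc, hb.2.2.1], fun l hl => ?_⟩
    rw [← mul_assoc, ha.2.2.2 l hl, mul_assoc, hb.2.2.2 l hl, mul_assoc]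
  smul_mem' := by
    intro c a ha
    rw [D.mem_fixedSet_iff] at ha ⊢
    refine ⟨Subalgebra.smul_mem _ ha.1 c, by rw [mul_smul_comm, ha.2.1],
      by rw [smul_mul_assoc, ha.2.2.1], fun l hl => ?_⟩
    rw [mul_smul_comm, smul_mul_assoc, ha.2.2.2 l hl]

/-- The centre `Z` of `iFKi`. -/
def Z : NonUnitalSubalgebra F ℂ[G] where
  carrier := centerSet F θ φ
  add_mem' := by
    rintro a b ⟨ha, ha'⟩ ⟨hb, hb'⟩
    refine ⟨?_, fun s hs => by rw [add_mul, mul_add, ha' s hs, hb' s hs]⟩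
    rw [D.mem_cornerSet_iff] at ha hb ⊢
    exact ⟨add_mem ha.1 hb.1, by rw [mul_add, ha.2.1, hb.2.1], by rw [add_mul, ha.2.2, hb.2.2]⟩
  zero_mem' := by
    refine ⟨?_, fun s hs => by simp⟩
    rw [D.mem_cornerSet_iff]
    simp
  mul_mem' := by
    rintro a b ⟨ha, ha'⟩ ⟨hb, hb'⟩
    refine ⟨?_, fun s hs => by rw [mul_assoc, hb' s hs, ← mul_assoc, ha' s hs, mul_assoc]⟩
    rw [D.mem_cornerSet_iff] at ha hb ⊢
    exact ⟨mul_mem ha.1 hb.1, by rw [← mul_assoc, ha.2.1], by rw [mul_assoc, hb.2.2]⟩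
  smul_mem' := by
    rintro c a ⟨ha, ha'⟩
    refine ⟨?_, fun s hs => by rw [smul_mul_assoc, mul_smul_comm, ha' s hs]⟩
    rw [D.mem_cornerSet_iff] at ha ⊢
    exact ⟨Subalgebra.smul_mem _ ha.1 c, by rw [mul_smul_comm, ha.2.1],
      by rw [smul_mul_assoc, ha.2.2]⟩

theorem mem_Z {s : ℂ[G]} : s ∈ D.Z ↔ s ∈ centerSet F θ φ := Iff.rfl

theorem mem_S_iff {s : ℂ[G]} : s ∈ D.S ↔ s ∈ groupAlg F K ∧ 𝐢 * s = s ∧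
    s * 𝐢 = s ∧ ∀ l ∈ H ⊓ K, ⟪l⟫ * s = s * ⟪l⟫ := D.mem_fixedSet_iff

variable {D}

theorem idem_mul_of_mem_S {s : ℂ[G]} (hs : s ∈ D.S) : 𝐢 * s = s := (D.mem_S_iff.1 hs).2.1

theorem mul_idem_of_mem_S {s : ℂ[G]} (hs : s ∈ D.S) : s * 𝐢 = s := (D.mem_S_iff.1 hs).2.2.1

theorem single_comm_of_mem_S {s : ℂ[G]} (hs : s ∈ D.S) {l : G} (hl : l ∈ H ⊓ K) :
    ⟪l⟫ * s = s * ⟪l⟫ := (D.mem_S_iff.1 hs).2.2.2 l hl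

theorem mem_groupAlg_of_mem_S {s : ℂ[G]} (hs : s ∈ D.S) : s ∈ groupAlg F K := (D.mem_S_iff.1 hs).1

theorem mem_complex_of_mem_S {s : ℂ[G]} (hs : s ∈ D.S) : s ∈ groupAlg ℂ K :=
  mem_groupAlg_complex (mem_groupAlg_of_mem_S hs)

variable (D)

theorem idem_mem_Z : 𝐢 ∈ D.Z := by
  refine ⟨D.idem_mem_cornerSet, fun s hs => ?_⟩
  rw [D.mem_cornerSet_iff] at hs
  rw [hs.2.1, hs.2.2]

include D in
theorem idem_ne_zero : 𝐢 ≠ 0 := by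
  intro h
  obtain ⟨γ⟩ := D.nonempty
  have h1 := D.linExt_idem γ
  rw [h, linExt_zero] at h1
  exact mul_ne_zero D.n_cast_ne D.phi_ne h1.symm

include D in
theorem idem_single_mul_mem {l : G} (hl : l ∈ H ⊓ K) : 𝐢 * ⟪l⟫ * 𝐢 = ⟪l⟫ * 𝐢 := by
  rw [← D.single_mul_idem hl.1, mul_assoc, D.idem_mul_self]

/-- For l in L the element l i lies in the corner, so commuting with the corner includes commuting
with L. -/
theorem Z_le_S {z : ℂ[G]} (hz : z ∈ D.Z) : z ∈ D.S := by
  have h := D.mem_cornerSet_iff.1 hz.1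
  refine D.mem_S_iff.2 ⟨h.1, h.2.1, h.2.2, fun l hl => ?_⟩
  have h1 := hz.2 (𝐢 * ⟪l⟫ * 𝐢) ⟨_, single_mem_groupAlg hl.2, rfl⟩
  rw [D.idem_single_mul_mem hl, mul_assoc, h.2.1, D.single_mul_idem hl.1, ← mul_assoc, h.2.2] at h1
  exact h1.symm

theorem corner_mem_S {a : ℂ[G]} (ha : a ∈ groupAlg F K) (h1 : 𝐢 * a = a) (h2 : a * 𝐢 = a) :
    conjSum (H ⊓ K) a ∈ D.S := by
  have hi : ∀ v ∈ H ⊓ K, ⟪v⟫ * 𝐢 = 𝐢 * ⟪v⟫ := fun v hv => D.single_mul_idem hv.1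
  refine D.mem_S_iff.2 ⟨conjSum_mem inf_le_right ha, ?_, ?_, fun l hl => single_mul_conjSum hl a⟩
  · rw [← conjSum_mul_left _ hi, h1]
  · rw [← conjSum_mul_right _ hi, h2]

variable {D} in
theorem Z_comm {z s : ℂ[G]} (hz : z ∈ D.Z) (hs : s ∈ D.S) : z * s = s * z := hz.2 s hs.1

section Omega

/-- The scalar by which an element of `Z` acts on the component belonging to `γ`. -/
def ω (γ : Γ) (z : ℂ[G]) : ℂ := linExt (D.Θ γ) z / (D.n * φ 1)

variable {D}

theorem mul_eΘ_of_mem_Z (γ : Γ) {z : ℂ[G]} (hz : z ∈ D.Z) : z * D.eΘ γ = D.ω γ z • D.f γ := by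
  have h := (D.irrΘ γ).smul_mul_charIdem_of_comm_corner D.idem_mem_complex
    (mem_complex_of_mem_S (D.Z_le_S hz)) (idem_mul_of_mem_S (D.Z_le_S hz))
    (mul_idem_of_mem_S (D.Z_le_S hz)) fun y hy => hz.2 _ ⟨_, single_mem_groupAlg hy, rfl⟩
  rw [← eΘ, D.linExt_idem, D.idem_mul_eΘ] at h
  rw [ω, div_eq_inv_mul, mul_smul, ← h, inv_smul_smul₀ (mul_ne_zero D.n_cast_ne D.phi_ne)]

theorem linExt_mul_of_mem_Z (γ : Γ) {z : ℂ[G]} (hz : z ∈ D.Z) {a : ℂ[G]} (ha : a * 𝐢 = a) :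
    linExt (D.Θ γ) (a * z) = D.ω γ z * linExt (D.Θ γ) a := by
  rw [← linExt_mul_eΘ, mul_assoc, mul_eΘ_of_mem_Z γ hz, mul_smul_comm, linExt_smul,
    ← D.idem_mul_eΘ, ← mul_assoc, ha, linExt_mul_eΘ]

theorem mul_galIdem_theta_of_mem_S {s : ℂ[G]} (hs : s ∈ D.S) : s * galIdem F θ = s := by
  rw [← mul_idem_of_mem_S hs, mul_assoc, D.idem_mul_galIdem_theta]

theorem eq_sum_of_mem_Z {z : ℂ[G]} (hz : z ∈ D.Z) : z = ∑ γ, D.ω γ z • D.f γ := by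
  rw [← Finset.sum_congr rfl fun γ _ => mul_eΘ_of_mem_Z γ hz, ← Finset.mul_sum,
    ← D.galIdem_theta_eq, mul_galIdem_theta_of_mem_S (D.Z_le_S hz)]

/-- The components of an F-rational element are Galois conjugate, so one vanishes only if all do.
This is why the centre has no zero divisors. -/
theorem eq_zero_of_ω_eq_zero (γ : Γ) {z : ℂ[G]} (hz : z ∈ D.Z) (h : D.ω γ z = 0) : z = 0 := by
  have h1 : linExt (D.Θ γ) z = 0 :=
    (div_eq_zero_iff.1 h).resolve_right (mul_ne_zero D.n_cast_ne D.phi_ne)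
  rw [eq_sum_of_mem_Z hz]
  refine Finset.sum_eq_zero fun δ _ => ?_
  rw [ω, D.zero z (mem_groupAlg_of_mem_S (D.Z_le_S hz)) γ δ h1, zero_div, zero_smul]

/-- Since f_γ = e_Φγ i, the scalars of z on the components can be carried by the e_Φγ instead, and
Galois descent puts that combination into FL. Later this lets κ(L) absorb central factors. -/
theorem exists_eq_mul_idem_of_mem_Z {z : ℂ[G]} (hz : z ∈ D.Z) :
    ∃ a ∈ groupAlg F (H ⊓ K), z = a * 𝐢 := by
  obtain ⟨γ₀⟩ := D.nonempty
  obtain ⟨m, -, hm⟩ := (D.irrΦ γ₀).deg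
  rw [D.Φ_one] at hm
  refine ⟨((D.n * m : F)⁻¹) • ∑ γ, linExt (D.Θ γ) z • D.eΦ γ, Subalgebra.smul_mem _
    (D.rat_eΦ (mem_groupAlg_of_mem_S (D.Z_le_S hz))) _, ?_⟩
  conv_lhs => rw [eq_sum_of_mem_Z hz]
  rw [smul_mul_assoc, Finset.sum_mul, Finset.smul_sum]
  refine Finset.sum_congr rfl fun γ _ => ?_
  rw [smul_mul_assoc, D.eΦ_mul_idem, ω, div_eq_inv_mul, mul_smul, hm,
    ← algebraMap_smul (A := ℂ) ((D.n * m : F)⁻¹)]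
  simp

theorem gconj_mem_S {s : ℂ[G]} (hs : s ∈ D.S) {h : G} (hh : h ∈ H) : gconj s h ∈ D.S := by
  obtain ⟨h1, h2, h3, h4⟩ := D.mem_S_iff.1 hs
  have hK : ∀ a ∈ groupAlg F K, gconj a h ∈ groupAlg F K := by
    intro a ha
    induction ha using groupAlg_induction with
    | single x hx =>
      rw [gconj, single_mul_single_one, single_mul_single_one]
      refine single_mem_groupAlg ?_
      simpa using ‹K.Normal›.conj_mem _ hx h⁻¹
    | zero => simp [gconj]
    | add a b _ _ h1 h2 => rw [gconj_add]; exact add_mem h1 h2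
    | smul c a _ h1 => rw [gconj_smul]; exact Subalgebra.smul_mem _ h1 c
  have hi : gconj 𝐢 h = 𝐢 := (gconj_eq_self_iff _ _).2 (D.single_mul_idem hh)
  refine D.mem_S_iff.2 ⟨hK s h1, ?_, ?_, fun l hl => ?_⟩
  · conv_rhs => rw [← h2, gconj_mul, hi]
  · conv_rhs => rw [← h3, gconj_mul, hi]
  · rw [← gconj_eq_self_iff, gconj_gconj]
    have hl' : h * l * h⁻¹ ∈ H ⊓ K := (conj_mem_inf_iff hh l).2 hl
    rw [show h * l = (h * l * h⁻¹) * h by group, ← gconj_gconj,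
      (gconj_eq_self_iff _ _).2 (h4 _ hl')]

theorem gconj_mem_cornerSet {s : ℂ[G]} (hs : s ∈ cornerSet F θ φ) {h : G} (hh : h ∈ H)
    (D : ConjFamily F H K θ φ Γ) : gconj s h ∈ cornerSet F θ φ := by
  obtain ⟨a, ha, rfl⟩ := hs
  have hi : gconj 𝐢 h = 𝐢 := (gconj_eq_self_iff _ _).2 (D.single_mul_idem hh)
  refine ⟨gconj a h, ?_, by rw [gconj_mul, gconj_mul, hi]⟩
  induction ha using groupAlg_induction with
  | single x hx =>
    rw [gconj, single_mul_single_one, single_mul_single_one]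
    refine single_mem_groupAlg ?_
    simpa using ‹K.Normal›.conj_mem _ hx h⁻¹
  | zero => simp [gconj]
  | add a b _ _ h1 h2 => rw [gconj_add]; exact add_mem h1 h2
  | smul c a _ h1 => rw [gconj_smul]; exact Subalgebra.smul_mem _ h1 c

theorem gconj_mem_Z {z : ℂ[G]} (hz : z ∈ D.Z) {h : G} (hh : h ∈ H) : gconj z h ∈ D.Z := by
  refine ⟨gconj_mem_cornerSet hz.1 hh D, fun s hs => ?_⟩
  have h1 := hz.2 _ (gconj_mem_cornerSet hs (inv_mem hh) D)
  have h2 := congrArg (fun a => gconj a h) h1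
  simpa [gconj_mul, gconj_gconj, gconj_one] using h2

end Omega

section Fix

variable {D}

theorem mem_S_of_corner_single {x : G} (hx : x ∈ K) : conjSum (H ⊓ K) (𝐢 * ⟪x⟫ * 𝐢) ∈ D.S :=
  D.corner_mem_S (mul_mem (mul_mem D.idem_mem (single_mem_groupAlg hx)) D.idem_mem)
    (by rw [← mul_assoc, ← mul_assoc, D.idem_mul_self]) (by rw [mul_assoc, D.idem_mul_self])

/-- The trace form on `S` is nondegenerate. -/
theorem eq_zero_of_linExt_mul_eq_zero {s : ℂ[G]} (hs : s ∈ D.S)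
    (h : ∀ γ, ∀ t ∈ D.S, linExt (D.Θ γ) (s * t) = 0) : s = 0 := by
  rw [← mul_galIdem_theta_of_mem_S hs, D.galIdem_theta_eq, Finset.mul_sum]
  refine Finset.sum_eq_zero fun γ _ => ?_
  refine (D.irrΘ γ).mul_charIdem_eq_zero (mem_complex_of_mem_S hs) fun x hx => ?_
  -- Averages of i x i over L are test elements in S. As s commutes with L, the average may be
  -- removed, leaving Θ(s x) = 0 for every x in K.
  have h1 := h γ _ (mem_S_of_corner_single hx)
  rw [← conjSum_mul_left _ fun l hl => single_comm_of_mem_S hs hl,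
    linExt_conjSum (D.irrΘ γ).comm inf_le_right] at h1
  have h2 := (mul_eq_zero.1 h1).resolve_left (IsCharLike.card_ne_zero _)
  rw [← mul_assoc, ← mul_assoc, mul_idem_of_mem_S hs, ← D.linExt_mul_comm' γ D.idem_mem_complex,
    ← mul_assoc, idem_mul_of_mem_S hs] at h2
  exact h2

/-- `iFKi` is spanned by `L S`. -/
theorem eq_sum_of_mem_cornerSet {c : ℂ[G]} (hc : c ∈ cornerSet F θ φ)
    (D : ConjFamily F H K θ φ Γ) :
    (Nat.card ↥(H ⊓ K) / φ 1 : ℂ) ^ 2 • c =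
      ∑ l : ↥(H ⊓ K), ⟪(l : G)⟫ * conjSum (H ⊓ K) (c * ⟪(l : G)⁻¹⟫) := by
  obtain ⟨hK, hic, hci⟩ := D.mem_cornerSet_iff.1 hc
  have hd := D.phi_ne
  have hL := IsCharLike.card_ne_zero (H ⊓ K)
  -- With y running through the conjugation sum, the substitution m = l y moves the averaging from c
  -- m⁻¹ to m⁻¹ alone.
  have h1 : ∑ l : ↥(H ⊓ K), ⟪(l : G)⟫ * conjSum (H ⊓ K) (c * ⟪(l : G)⁻¹⟫) =
      ∑ m : ↥(H ⊓ K), ⟪(m : G)⟫ * (c * conjSum (H ⊓ K) ⟪(m : G)⁻¹⟫) := by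
    simp only [conjSum_apply, Finset.mul_sum]
    rw [Finset.sum_comm, Finset.sum_comm (f := fun m y : ↥(H ⊓ K) =>
      ⟪(m : G)⟫ * (c * (⟪(y : G)⟫ * ⟪(m : G)⁻¹⟫ * ⟪(y : G)⁻¹⟫)))]
    refine Finset.sum_congr rfl fun y _ => ?_
    refine Fintype.sum_equiv (Equiv.mulRight y) _ _ fun l => ?_
    simp only [Equiv.coe_mulRight, Subgroup.coe_mul, ← mul_assoc, single_mul_single_one]
    rw [mul_assoc _ (⟪(l : G)⁻¹⟫), single_mul_single_one]
    congr 2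
    group
  have h2 : ∀ m : ↥(H ⊓ K), c * conjSum (H ⊓ K) ⟪(m : G)⁻¹⟫ =
      ∑ γ, (Nat.card ↥(H ⊓ K) * D.Φ γ m⁻¹ / φ 1 : ℂ) • (c * D.eΘ γ) := by
    intro m
    have hm : ⟪(m : G)⁻¹⟫ ∈ groupAlg ℂ (H ⊓ K) := single_mem_groupAlg (inv_mem m.2)
    have hT : conjSum (H ⊓ K) ⟪(m : G)⁻¹⟫ ∈ groupAlg ℂ (H ⊓ K) := conjSum_mem le_rfl hm
    have e0 : c * conjSum (H ⊓ K) ⟪(m : G)⁻¹⟫ =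
        ∑ γ, c * (conjSum (H ⊓ K) ⟪(m : G)⁻¹⟫ * D.f γ) := by
      rw [← Finset.mul_sum, ← Finset.mul_sum, ← D.idem_eq_sum, D.idem_comm_inf hT, ← mul_assoc, hci]
    rw [e0]
    refine Finset.sum_congr rfl fun γ _ => ?_
    have e1 : c * D.f γ = c * D.eΘ γ := by rw [← D.idem_mul_eΘ, ← mul_assoc, hci]
    have e2 : conjSum (H ⊓ K) ⟪(m : G)⁻¹⟫ * D.f γ =
        (Nat.card ↥(H ⊓ K) * D.Φ γ m⁻¹ / φ 1 : ℂ) • D.f γ := by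
      rw [f, ← mul_assoc, eΦ, (D.irrΦ γ).conjSum_mul_charIdem hm, smul_mul_assoc, D.Φ_one,
        ← Subgroup.coe_inv, linExt_single]
    rw [e2, mul_smul_comm, e1]
  rw [h1]
  simp only [h2, Finset.mul_sum, mul_smul_comm]
  rw [Finset.sum_comm]
  -- The sum of Φ(m⁻¹) m over L is e_Φ up to the factor |L|/φ(1), and a second such factor comes
  -- from the scalar of the conjugation sum.
  have h3 : ∀ γ, ∑ m : ↥(H ⊓ K), (Nat.card ↥(H ⊓ K) * D.Φ γ m⁻¹ / φ 1 : ℂ) •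
      (⟪(m : G)⟫ * (c * D.eΘ γ)) = (Nat.card ↥(H ⊓ K) / φ 1 : ℂ) ^ 2 • (D.f γ * c) := by
    intro γ
    have h4 : D.f γ * c = D.eΦ γ * (c * D.eΘ γ) := by
      rw [D.eΘ_comm γ (mem_groupAlg_complex hK), ← mul_assoc, f]
    rw [h4]
    conv_rhs => rw [eΦ, charIdem, Finset.sum_mul, Finset.smul_sum]
    refine Finset.sum_congr rfl fun m _ => ?_
    have e3 : ∀ a : ℂ, MonoidAlgebra.single (m : G) a = a • ⟪(m : G)⟫ := fun a => by
      rw [MonoidAlgebra.smul_single, smul_eq_mul, mul_one]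
    rw [e3 (_ * D.Φ γ m⁻¹), smul_mul_assoc, smul_smul, D.Φ_one]
    congr 1
    field_simp
  rw [Finset.sum_congr rfl fun γ _ => h3 γ, ← Finset.smul_sum, ← Finset.sum_mul, ← D.idem_eq_sum,
    hic]

/-- The factor (|L|/φ(1))² in the complex identity is a nonzero rational number, so it can be
divided out over F. -/
theorem cornerSet_le_span {c : ℂ[G]} (hc : c ∈ cornerSet F θ φ) (D : ConjFamily F H K θ φ Γ) :
    c ∈ Submodule.span F {x : ℂ[G] | ∃ l ∈ H ⊓ K, ∃ s ∈ D.S, x = ⟪l⟫ * s} := by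
  have h := eq_sum_of_mem_cornerSet hc D
  obtain ⟨hK, hic, hci⟩ := D.mem_cornerSet_iff.1 hc
  obtain ⟨γ₀⟩ := D.nonempty
  obtain ⟨m, -, hm⟩ := (D.irrΦ γ₀).deg
  rw [D.Φ_one] at hm
  have hd := D.phi_ne
  have hL := IsCharLike.card_ne_zero (H ⊓ K)
  have hne : ((Nat.card ↥(H ⊓ K) / m : F)) ^ 2 ≠ 0 := by
    rw [hm] at hd
    have h1 : (m : F) ≠ 0 := fun e => hd (by exact_mod_cast congrArg (algebraMap F ℂ) e)
    have h2 : (Nat.card ↥(H ⊓ K) : F) ≠ 0 := by exact_mod_cast Nat.card_pos.ne'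
    exact pow_ne_zero _ (div_ne_zero h2 h1)
  have h1 : ((Nat.card ↥(H ⊓ K) / m : F)) ^ 2 • c =
      ∑ l : ↥(H ⊓ K), ⟪(l : G)⟫ * conjSum (H ⊓ K) (c * ⟪(l : G)⁻¹⟫) := by
    rw [← h, hm, ← algebraMap_smul (A := ℂ) ((Nat.card ↥(H ⊓ K) / m : F) ^ 2)]
    simp
  rw [← inv_smul_smul₀ hne c, h1]
  refine Submodule.smul_mem _ _ (Submodule.sum_mem _ fun l _ => Submodule.subset_span
    ⟨l, l.2, _, D.corner_mem_S (mul_mem hK (single_mem_groupAlg (inv_mem l.2.2))) ?_ ?_, rfl⟩)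
  · rw [← mul_assoc, hic]
  · rw [mul_assoc, D.single_mul_idem (inv_mem l.2.1), ← mul_assoc, hci]

end Fix

end ConjFamily

/-! ### Central simple algebras: density and tensor products. -/

section Density

variable {k A : Type*} [Field k] [Ring A] [Algebra k A]

/-- Every `k`-linear endomorphism of a finite-dimensional central simple algebra is a sum of maps
`x ↦ a x b`. -/
theorem exists_eq_sum_mul_mul (hA : IsCSA k A) (f : A →ₗ[k] A) :
    ∃ s : Finset (A × Aᵐᵒᵖ), ∀ x, f x = ∑ p ∈ s, p.1 * x * p.2.unop := by
  have := hA.central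
  have := hA.simple
  have := hA.finite
  classical
  let R := (AlgHom.mulLeftRight k A).range
  let lr (a b : A) : R := ⟨AlgHom.mulLeftRight k A (a ⊗ₜ MulOpposite.op b), ⟨_, rfl⟩⟩
  have hlr : ∀ a b x : A, lr a b • x = a * x * b := fun a b x =>
    AlgHom.mulLeftRight_apply (R := k) (A := A) a (MulOpposite.op b) x
  -- Submodules for left and right multiplications are two-sided ideals.
  have hsimple : IsSimpleModule R A := by
    refine (isSimpleModule_iff _ _).2
      { exists_pair_ne := ⟨⊥, ⊤, bot_ne_top⟩, eq_bot_or_eq_top := fun N => ?_ }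
    let I : TwoSidedIdeal A := TwoSidedIdeal.mk' (N : Set A) N.zero_mem N.add_mem
      (fun h => by
        simpa [hlr] using N.smul_mem (lr (-1) 1) h)
      (fun {x y} h => by simpa [hlr] using N.smul_mem (lr x 1) h)
      (fun {x y} h => by simpa [hlr] using N.smul_mem (lr 1 y) h)
    have hI : ∀ x, x ∈ I ↔ x ∈ N := fun x => TwoSidedIdeal.mem_mk' _ _ _ _ _ _ _
    rcases eq_bot_or_eq_top I with h | h
    · left
      ext x
      rw [← hI, h, TwoSidedIdeal.mem_bot, Submodule.mem_bot]
    · right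
      ext x
      rw [← hI, h]
      simp
  -- An endomorphism is both left and right multiplication by its value at 1. That value is thus
  -- central, hence a scalar, and f commutes with it.
  have hcomm : ∀ (φ : Module.End R A) (x : A), φ (f x) = f (φ x) := by
    intro φ x
    have h1 : ∀ y, φ y = y * φ 1 := fun y => by
      have := φ.map_smul (lr y 1) 1
      simpa [hlr] using this
    have h2 : ∀ y, φ y = φ 1 * y := fun y => by
      have := φ.map_smul (lr 1 y) 1
      simpa [hlr] using this
    have h3 : φ 1 ∈ Subalgebra.center k A :=
      Subalgebra.mem_center_iff.2 fun y => by rw [← h1, ← h2]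
    obtain ⟨c, hc⟩ := Algebra.IsCentral.mem_center_iff k |>.1 h3
    rw [h2, h2 x, hc, ← Algebra.smul_def, ← Algebra.smul_def, map_smul]
  let g : Module.End (Module.End R A) A :=
    { toFun := f, map_add' := f.map_add, map_smul' := fun φ x => (hcomm φ x).symm }
  obtain ⟨r, hr⟩ := jacobson_density (R := R) (M := A) g
    (Finset.univ.image (Module.finBasis k A))
  obtain ⟨⟨_, t, rfl⟩, hr⟩ : ∃ r : R, ∀ m ∈ Finset.univ.image (Module.finBasis k A),
    f m = r • m := ⟨r, hr⟩
  have hf : f = AlgHom.mulLeftRight k A t := by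
    refine (Module.finBasis k A).ext fun j => ?_
    exact hr _ (Finset.mem_image_of_mem _ (Finset.mem_univ j))
  obtain ⟨s, hs⟩ := TensorProduct.exists_finset t
  refine ⟨s, fun x => ?_⟩
  rw [hf, hs, map_sum, LinearMap.sum_apply]
  exact Finset.sum_congr rfl fun p _ => AlgHom.mulLeftRight_apply ..

variable {B : Type*} [Ring B] [Algebra k B]

/-- Two-sided multiplications by elements of A can isolate one nonzero coordinate b of an element of
an ideal, so the ideal contains b ⊗ 1; simplicity of B then gives 1. -/
theorem isSimpleRing_tensorProduct (hA : IsCSA k A) [IsSimpleRing B] :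
    IsSimpleRing (B ⊗[k] A) := by
  have := hA.simple
  have := hA.finite
  have : Nontrivial (B ⊗[k] A) :=
    (Algebra.TensorProduct.includeLeft_injective (S := k)
      (algebraMap k A).injective : Function.Injective
        (Algebra.TensorProduct.includeLeft : B →ₐ[k] B ⊗[k] A)).nontrivial
  refine IsSimpleRing.of_eq_bot_or_eq_top fun I => ?_
  by_contra! h
  obtain ⟨hbot, htop⟩ := h
  obtain ⟨x, hxI, hx0⟩ : ∃ x ∈ I, x ≠ 0 := by
    by_contra! h
    refine hbot (le_antisymm (fun y hy => ?_) bot_le)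
    rw [TwoSidedIdeal.mem_bot]
    exact h y hy
  let b := Module.finBasis k A
  let b' := Algebra.TensorProduct.basis B b
  obtain ⟨j, hj⟩ : ∃ j, b'.repr x j ≠ 0 := by
    by_contra! h
    exact hx0 (b'.repr.map_eq_zero_iff.1 (Finsupp.ext h))
  obtain ⟨s, hs⟩ := exists_eq_sum_mul_mul hA ((b.coord j).smulRight (1 : A))
  have key : ∑ p ∈ s, (1 ⊗ₜ[k] p.1) * x * (1 ⊗ₜ[k] p.2.unop) = b'.repr x j ⊗ₜ[k] (1 : A) := by
    conv_lhs => rw [← b'.sum_repr x]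
    simp only [Finset.mul_sum, Finset.sum_mul]
    rw [Finset.sum_comm, Finset.sum_eq_single j]
    · have h1 := hs (b j)
      simp only [LinearMap.smulRight_apply, Module.Basis.coord_apply, Module.Basis.repr_self,
        Finsupp.single_eq_same, one_smul] at h1
      simp only [b', Algebra.TensorProduct.basis_apply, TensorProduct.smul_tmul', smul_eq_mul,
        mul_one, Algebra.TensorProduct.tmul_mul_tmul, one_mul, ← TensorProduct.tmul_sum, ← h1]
    · intro m _ hm
      have h1 := hs (b m)
      simp only [LinearMap.smulRight_apply, Module.Basis.coord_apply, Module.Basis.repr_self,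
        Finsupp.single_eq_of_ne hm.symm, zero_smul] at h1
      simp only [b', Algebra.TensorProduct.basis_apply, TensorProduct.smul_tmul', smul_eq_mul,
        mul_one, Algebra.TensorProduct.tmul_mul_tmul, one_mul, ← TensorProduct.tmul_sum, ← h1,
        TensorProduct.tmul_zero]
    · simp
  have hmem : b'.repr x j ⊗ₜ[k] (1 : A) ∈ I := by
    rw [← key]
    exact sum_mem fun p _ => I.mul_mem_right _ _ (I.mul_mem_left _ _ hxI)
  let J : TwoSidedIdeal B := I.comap (Algebra.TensorProduct.includeLeft : B →ₐ[k] B ⊗[k] A)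
  have hJ : ∀ y, y ∈ J ↔ y ⊗ₜ[k] (1 : A) ∈ I := fun y => TwoSidedIdeal.mem_comap _
  rcases eq_bot_or_eq_top J with h | h
  · have : b'.repr x j ∈ J := (hJ _).2 hmem
    rw [h, TwoSidedIdeal.mem_bot] at this
    exact hj this
  · have : (1 : B) ∈ J := by rw [h]; trivial
    rw [hJ] at this
    refine htop (eq_top_iff.2 fun y _ => ?_)
    simpa [← Algebra.TensorProduct.one_def] using I.mul_mem_left y _ this

/-- The centralizer of `1 ⊗ A` in `B ⊗ A`, for a central algebra `A`, is `B ⊗ 1`. -/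
theorem exists_eq_tmul_one_of_comm [Algebra.IsCentral k A] {z : B ⊗[k] A}
    (hz : ∀ a : A, (1 ⊗ₜ[k] a) * z = z * (1 ⊗ₜ[k] a)) : ∃ b : B, z = b ⊗ₜ[k] 1 := by
  have h1 : z ∈ Subalgebra.centralizer k
      ((Algebra.TensorProduct.includeRight : A →ₐ[k] B ⊗[k] A).range : Set (B ⊗[k] A)) := by
    rw [Subalgebra.mem_centralizer_iff]
    rintro _ ⟨a, rfl⟩
    exact hz a
  rw [Subalgebra.centralizer_range_includeRight_eq_center_tensorProduct] at h1
  obtain ⟨t, rfl⟩ := h1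
  clear hz
  induction t with
  | zero => exact ⟨0, by simp⟩
  | tmul b c =>
    obtain ⟨r, hr⟩ := Algebra.IsCentral.mem_center_iff k |>.1 c.2
    refine ⟨r • b, ?_⟩
    change b ⊗ₜ[k] (c : A) = _
    rw [hr, Algebra.algebraMap_eq_smul_one, TensorProduct.tmul_smul, TensorProduct.smul_tmul']
  | add s t hs ht =>
    obtain ⟨b, hb⟩ := hs
    obtain ⟨c, hc⟩ := ht
    exact ⟨b + c, by
      rw [TensorProduct.add_tmul, ← hb, ← hc]
      exact map_add _ s t⟩

/-- A tensor product of central simple algebras is central simple. -/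
theorem IsCSA.tensorProduct (hB : IsCSA k B) (hA : IsCSA k A) : IsCSA k (B ⊗[k] A) := by
  have := hA.central
  have := hB.central
  have := hA.simple
  have := hB.simple
  have := hA.finite
  have := hB.finite
  refine ⟨⟨fun z hz => ?_⟩, isSimpleRing_tensorProduct hA, inferInstance⟩
  rw [Subalgebra.mem_center_iff] at hz
  obtain ⟨b, rfl⟩ := exists_eq_tmul_one_of_comm fun a => hz (1 ⊗ₜ[k] a)
  have hb : b ∈ Subalgebra.center k B := Subalgebra.mem_center_iff.2 fun c => by
    have h := hz (c ⊗ₜ[k] 1)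
    rw [Algebra.TensorProduct.tmul_mul_tmul, Algebra.TensorProduct.tmul_mul_tmul, mul_one] at h
    exact Algebra.TensorProduct.includeLeft_injective (S := k) (algebraMap k A).injective h
  obtain ⟨c, rfl⟩ := Algebra.IsCentral.mem_center_iff k |>.1 hb
  exact ⟨c, rfl⟩

/-- Extension of scalars preserves central simple algebras. -/
theorem IsCSA.baseChange {E : Type*} [Field E] [Algebra k E] (hA : IsCSA k A) :
    IsCSA E (E ⊗[k] A) := by
  have := hA.central
  have := hA.finite
  have := DivisionRing.isSimpleRing E
  refine ⟨⟨fun z hz => ?_⟩, isSimpleRing_tensorProduct hA, inferInstance⟩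
  rw [Subalgebra.mem_center_iff] at hz
  obtain ⟨b, rfl⟩ := exists_eq_tmul_one_of_comm fun a => hz (1 ⊗ₜ[k] a)
  exact ⟨b, rfl⟩

end Density

/-! ### Traces of left multiplication and splitting fields. -/

section Trace

variable {E ι : Type*} [Field E] [Fintype ι] [DecidableEq ι]

theorem trace_mulLeft_matrix (M : Matrix ι ι E) :
    LinearMap.trace E (Matrix ι ι E) (LinearMap.mulLeft E M) = Fintype.card ι * M.trace := by
  rw [LinearMap.trace_eq_matrix_trace E (Matrix.stdBasis E ι ι), Matrix.trace,
    Fintype.sum_prod_type]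
  have : ∀ i j, (LinearMap.toMatrix (Matrix.stdBasis E ι ι) (Matrix.stdBasis E ι ι)
      (LinearMap.mulLeft E M)).diag (i, j) = M i i := by
    intro i j
    rw [Matrix.diag_apply, LinearMap.toMatrix_apply, Matrix.stdBasis_eq_single,
      LinearMap.mulLeft_apply]
    change (M * Matrix.single i j (1 : E) : Matrix ι ι E) i j = _
    simp
  simp only [this]
  simp [Matrix.trace, Finset.mul_sum]

/-- A trace function on a matrix algebra is a multiple of the trace. -/
theorem card_smul_eq_of_map_mul_comm {V : Type*} [AddCommGroup V] [Module E V]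
    (l : Matrix ι ι E →ₗ[E] V)
    (hl : ∀ X Y, l (X * Y) = l (Y * X)) (M : Matrix ι ι E) :
    (Fintype.card ι : E) • l M = M.trace • l 1 := by
  have h0 : ∀ i j, i ≠ j → ∀ c, l (Matrix.single i j c) = 0 := by
    intro i j hij c
    have := hl (Matrix.single i i 1) (Matrix.single i j c)
    rwa [Matrix.single_mul_single_same, Matrix.single_mul_single_of_ne _ _ _ _ hij.symm, map_zero,
      one_mul] at this
  have h1 : ∀ i j, l (Matrix.single i i 1) = l (Matrix.single j j 1) := by
    intro i j
    have := hl (Matrix.single i j 1) (Matrix.single j i 1)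
    rwa [Matrix.single_mul_single_same, Matrix.single_mul_single_same, one_mul] at this
  have h2 : ∀ X : Matrix ι ι E, ∀ j, l X = X.trace • l (Matrix.single j j 1) := by
    intro X j
    conv_lhs => rw [Matrix.matrix_eq_sum_single X]
    rw [map_sum, Matrix.trace, Finset.sum_smul]
    refine Finset.sum_congr rfl fun i _ => ?_
    rw [map_sum, Finset.sum_eq_single i, h1 j i]
    · rw [← map_smul, Matrix.smul_single, smul_eq_mul, mul_one, Matrix.diag_apply]
    · exact fun j _ hj => h0 i j hj.symm _
    · simp
  rcases isEmpty_or_nonempty ι with hι | ⟨⟨j⟩⟩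
  · rw [show M = 0 from Subsingleton.elim _ _]
    simp
  · rw [h2 M j, h2 1 j, Matrix.trace_one, smul_smul, smul_smul, mul_comm]

variable {k A : Type*} [Field k] [Ring A] [Algebra k A] [FiniteDimensional k A] [Algebra k E]

theorem finrank_eq_of_splitting (f : (E ⊗[k] A) ≃ₐ[E] Matrix ι ι E) :
    Module.finrank k A = Fintype.card ι ^ 2 := by
  rw [← Module.finrank_baseChange (R := E), f.toLinearEquiv.finrank_eq, Module.finrank_matrix]
  simp [sq]

/-- A matrix algebra of degree m is m copies of its column module. This relates the reduced trace to
the trace of the regular representation, which needs no splitting field. -/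
theorem trace_eq_of_splitting (f : (E ⊗[k] A) ≃ₐ[E] Matrix ι ι E) (a : A) :
    algebraMap k E (LinearMap.trace k A (LinearMap.mulLeft k a)) =
      Fintype.card ι * (f (1 ⊗ₜ[k] a)).trace := by
  rw [← trace_mulLeft_matrix, ← LinearMap.trace_baseChange,
    ← LinearMap.trace_conj' _ f.toLinearEquiv]
  congr 1
  refine LinearMap.ext fun M => ?_
  obtain ⟨x, rfl⟩ := f.surjective M
  rw [LinearEquiv.conj_apply]
  simp only [LinearMap.comp_apply, LinearEquiv.coe_coe, AlgEquiv.coe_toLinearEquiv,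
    LinearMap.mulLeft_apply, ← map_mul]
  have : f.toLinearEquiv.symm (f x) = x := f.symm_apply_apply x
  rw [this]
  congr 1
  clear this
  induction x with
  | zero => simp
  | tmul c b => simp
  | add x y hx hy => rw [map_add, hx, hy, mul_add]

end Trace

/-! ### Traces and commutators. -/

section Commutator

/-- A finite-dimensional central simple algebra is split by the algebraic closure of its centre. -/
theorem IsCSA.exists_splitting {k A : Type u} [Field k] [Ring A] [Algebra k A] (hA : IsCSA k A) :
    ∃ m : ℕ, ∀ (_ : Fintype (Fin m)) (_ : DecidableEq (Fin m)), Nonempty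
      ((AlgebraicClosure k ⊗[k] A) ≃ₐ[AlgebraicClosure k]
        Matrix (Fin m) (Fin m) (AlgebraicClosure k)) := by
  have := (hA.baseChange (E := AlgebraicClosure k)).simple
  have := (hA.baseChange (E := AlgebraicClosure k)).finite
  obtain ⟨m, -, h⟩ := IsSimpleRing.exists_algEquiv_matrix_of_isAlgClosed (AlgebraicClosure k)
    (AlgebraicClosure k ⊗[k] A)
  refine ⟨m, fun i1 i2 => ?_⟩
  obtain rfl : i1 = Fin.fintype m := Subsingleton.elim _ _
  obtain rfl : i2 = instDecidableEqFin m := Subsingleton.elim _ _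
  exact h

/-- In a central simple algebra of dimension `D`, the element `D a - Tr(a) 1` is a sum of
commutators. -/
theorem IsCSA.smul_sub_mem_closure {k A : Type u} [Field k] [Ring A] [Algebra k A]
    (hA : IsCSA k A) (a : A) :
    (Module.finrank k A : k) • a - LinearMap.trace k A (LinearMap.mulLeft k a) • (1 : A) ∈
      AddSubgroup.closure {c : A | ∃ x y, c = x * y - y * x} := by
  have := hA.finite
  -- Scalar multiples of commutators are commutators, so the additive span is already a subspace.
  -- The additive form allows test functions that are not k-linear.
  have hsub : ∀ v : A, v ∈ Submodule.span k {c : A | ∃ x y, c = x * y - y * x} →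
      v ∈ AddSubgroup.closure {c : A | ∃ x y, c = x * y - y * x} := by
    intro v hv
    induction hv using Submodule.span_induction with
    | mem x hx => exact AddSubgroup.subset_closure hx
    | zero => exact zero_mem _
    | add x y _ _ hx hy => exact add_mem hx hy
    | smul r x hmem hx =>
      clear hmem
      induction hx using AddSubgroup.closure_induction with
      | mem x hx =>
        obtain ⟨y, z, rfl⟩ := hx
        refine AddSubgroup.subset_closure ⟨r • y, z, ?_⟩
        rw [smul_sub, smul_mul_assoc, mul_smul_comm]
      | zero => simp
      | add x y _ _ hx hy => rw [smul_add]; exact add_mem hx hy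
      | neg x _ hx => rw [smul_neg]; exact neg_mem hx
  refine hsub _ ?_
  obtain ⟨m, hm⟩ := hA.exists_splitting
  obtain ⟨f⟩ := hm inferInstance inferInstance
  -- Otherwise some linear form kills all commutators but not this element. Over a splitting field
  -- such a form is a multiple of the matrix trace, which gives a contradiction.
  by_contra hnot
  obtain ⟨l, hl, hl0⟩ := Submodule.exists_le_ker_of_notMem hnot
  have hcomm : ∀ x y, l (x * y) = l (y * x) := fun x y => by
    have : l (x * y - y * x) = 0 := hl0 (Submodule.subset_span ⟨x, y, rfl⟩)
    rwa [map_sub, sub_eq_zero] at this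
  set E := AlgebraicClosure k
  let lE : E ⊗[k] A →ₗ[E] E ⊗[k] k := l.baseChange E
  have hlE : ∀ x y, lE (x * y) = lE (y * x) := by
    intro x y
    induction x with
    | zero => simp
    | add x x' h h' => rw [add_mul, mul_add, map_add, map_add, h, h']
    | tmul c x =>
      induction y with
      | zero => simp
      | add y y' h h' => rw [add_mul, mul_add, map_add, map_add, h, h']
      | tmul d y =>
        rw [Algebra.TensorProduct.tmul_mul_tmul, Algebra.TensorProduct.tmul_mul_tmul]
        simp only [lE, LinearMap.baseChange_tmul, hcomm x y, mul_comm c d]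
  have h1 := card_smul_eq_of_map_mul_comm (lE ∘ₗ f.symm.toLinearMap) (fun X Y => by
    simp only [LinearMap.comp_apply, AlgEquiv.toLinearMap_apply, map_mul]
    exact hlE _ _) (f (1 ⊗ₜ[k] a))
  simp only [LinearMap.comp_apply, AlgEquiv.toLinearMap_apply, AlgEquiv.symm_apply_apply,
    map_one] at h1
  have h2 := congrArg (fun v => (Fintype.card (Fin m) : E) • v) h1
  simp only [smul_smul] at h2
  rw [← trace_eq_of_splitting f a, ← sq, ← Nat.cast_pow, ← finrank_eq_of_splitting f] at h2
  apply hl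
  rw [map_sub, map_smul, map_smul, sub_eq_zero]
  have h3 : Function.Injective (fun c : k => (1 : E) ⊗ₜ[k] c) :=
    Algebra.TensorProduct.includeRight_injective (algebraMap k E).injective
  apply h3
  have h4 : lE 1 = (1 : E) ⊗ₜ[k] l 1 := by
    rw [Algebra.TensorProduct.one_def, LinearMap.baseChange_tmul]
  rw [h4, LinearMap.baseChange_tmul] at h2
  simp only [TensorProduct.tmul_smul]
  rw [algebraMap_smul, ← map_natCast (algebraMap k E), algebraMap_smul] at h2
  exact h2

end Commutator

/-! ### Algebras over a commutative ring that is a field. -/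

section OverCenter

/-- The centre of S₀ is given as a commutative ring. Results over fields apply to it once that ring
structure is replaced by one that comes from a field. -/
theorem exists_field_of_isField {Z : Type*} [i : CommRing Z] (h : IsField Z) :
    ∃ k : Field Z, k.toCommRing = i := ⟨h.toField, rfl⟩

variable {Z A : Type u} [i : CommRing Z] [Ring A] [Algebra Z A]

theorem smul_sub_mem_closure_of_isField (hZ : IsField Z) (hc : Algebra.IsCentral Z A)
    (hs : IsSimpleRing A) (hf : Module.Finite Z A) (a : A) :
    (Module.finrank Z A : Z) • a - LinearMap.trace Z A (LinearMap.mulLeft Z a) • (1 : A) ∈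
      AddSubgroup.closure {c : A | ∃ x y, c = x * y - y * x} := by
  obtain ⟨k, rfl⟩ := exists_field_of_isField hZ
  exact IsCSA.smul_sub_mem_closure ⟨hc, hs, hf⟩ a

theorem IsReducedTrace.exists_degree (hZ : IsField Z) (hf : Module.Finite Z A) {a : A} {t : Z}
    (h : IsReducedTrace Z A a t) : ∃ m : ℕ, Module.finrank Z A = m ^ 2 ∧
      LinearMap.trace Z A (LinearMap.mulLeft Z a) = m * t := by
  obtain ⟨k, rfl⟩ := exists_field_of_isField hZ
  obtain ⟨E, _, _, m, f, hft⟩ := h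
  refine ⟨m, ?_, (algebraMap Z E).injective ?_⟩
  · rw [finrank_eq_of_splitting f]
    simp
  · rw [trace_eq_of_splitting f, hft, map_mul, map_natCast]
    simp

theorem exists_isReducedTrace_one [CharZero Z] (hZ : IsField Z) (hc : Algebra.IsCentral Z A)
    (hs : IsSimpleRing A) (hf : Module.Finite Z A) : ∃ a : A, IsReducedTrace Z A a 1 := by
  obtain ⟨k, rfl⟩ := exists_field_of_isField hZ
  obtain ⟨m, hm⟩ := IsCSA.exists_splitting (k := Z) (A := A) ⟨hc, hs, hf⟩
  obtain ⟨f⟩ := hm (Fin.fintype m) inferInstance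
  have hm0 : (m : Z) ≠ 0 := by
    have h1 := finrank_eq_of_splitting f
    have h2 : 0 < Module.finrank Z A := Module.finrank_pos
    rw [h1, Fintype.card_fin] at h2
    exact_mod_cast (pow_pos_iff two_ne_zero).1 h2 |>.ne'
  -- The scalar 1/m has reduced trace one, m being the degree.
  refine ⟨algebraMap Z A (m : Z)⁻¹, AlgebraicClosure Z, inferInstance, inferInstance, m, f, ?_⟩
  have h1 : (1 : AlgebraicClosure Z) ⊗ₜ[Z] algebraMap Z A (m : Z)⁻¹ =
      algebraMap Z (AlgebraicClosure Z) (m : Z)⁻¹ • 1 := by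
    rw [Algebra.algebraMap_eq_smul_one, TensorProduct.tmul_smul, algebraMap_smul,
      Algebra.TensorProduct.one_def]
  rw [h1, map_smul, map_one, Matrix.trace_smul, Matrix.trace_one, Fintype.card_fin, map_one, smul_eq_mul,
    ← map_natCast (algebraMap Z (AlgebraicClosure Z)), ← map_mul, inv_mul_cancel₀ hm0, map_one]

theorem isCSA_baseChange_of_isField {k : Type*} [Field k] [Algebra Z k] (hZ : IsField Z)
    (hc : Algebra.IsCentral Z A) (hs : IsSimpleRing A) (hf : Module.Finite Z A) :
    IsCSA k (k ⊗[Z] A) := by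
  obtain ⟨_, rfl⟩ := exists_field_of_isField hZ
  exact IsCSA.baseChange ⟨hc, hs, hf⟩

/-- Coordinates written as two-sided multiplications still make sense after passing to a component
of ℂK, where Z₀-linearity is no longer available. -/
theorem exists_basis_coord_eq_sum (hZ : IsField Z) (hc : Algebra.IsCentral Z A)
    (hs : IsSimpleRing A) (hf : Module.Finite Z A) :
    ∃ b : Module.Basis (Fin (Module.finrank Z A)) Z A, ∀ j, ∃ s : Finset (A × Aᵐᵒᵖ),
      ∀ x, b.coord j x • (1 : A) = ∑ p ∈ s, p.1 * x * p.2.unop := by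
  obtain ⟨_, rfl⟩ := exists_field_of_isField hZ
  exact ⟨Module.finBasis Z A, fun j => exists_eq_sum_mul_mul ⟨hc, hs, hf⟩
    (((Module.finBasis Z A).coord j).smulRight (1 : A))⟩

end OverCenter

/-! ### A criterion for simplicity. -/

section Semisimple

/-- A semisimple ring without nontrivial central idempotents is simple. -/
theorem isSimpleRing_of_isSemisimpleRing {R : Type u} [Ring R] [Nontrivial R] [IsSemisimpleRing R]
    (h : ∀ e : R, (∀ x, e * x = x * e) → e * e = e → e = 0 ∨ e = 1) : IsSimpleRing R := by
  classical
  obtain ⟨n, D, d, _, hd, ⟨f⟩⟩ := IsSemisimpleRing.exists_ringEquiv_pi_matrix_divisionRing R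
  have hn : ∀ a b : Fin n, a = b := by
    intro a b
    by_contra hab
    -- The unit of one Wedderburn factor is a central idempotent; with two factors it would be
    -- neither 0 nor 1.
    let e : Π i, Matrix (Fin (d i)) (Fin (d i)) (D i) := Pi.single a 1
    have he : ∀ x, e * x = x * e := fun x => by
      funext i
      by_cases hi : i = a
      · subst hi; simp [e]
      · simp [e, Pi.single_eq_of_ne hi]
    have he2 : e * e = e := by
      funext i
      by_cases hi : i = a
      · subst hi; simp [e]
      · simp [e, Pi.single_eq_of_ne hi]
    have := hd a
    have := hd b
    rcases h (f.symm e) (fun x => f.injective (by simp [he])) (f.injective (by simp [he2]))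
      with h0 | h1
    · have : e = 0 := by rw [← f.apply_symm_apply e, h0, map_zero]
      have := congrFun this a
      simp [e] at this
    · have : e = 1 := by rw [← f.apply_symm_apply e, h1, map_one]
      have := congrFun this b
      simp [e, Pi.single_eq_of_ne (Ne.symm hab)] at this
  have hn0 : Nonempty (Fin n) := by
    by_contra hne
    rw [not_nonempty_iff] at hne
    exact not_subsingleton R (f.injective.subsingleton)
  obtain ⟨a⟩ := hn0
  have : Unique (Fin n) := ⟨⟨a⟩, fun b => hn b a⟩
  have := hd default
  exact IsSimpleRing.of_ringEquiv
    (f.trans (RingEquiv.piUnique fun i => Matrix (Fin (d i)) (Fin (d i)) (D i))).symm inferInstance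

end Semisimple

/-! ### Corners of simple algebras and Brauer equivalence. -/

section Corner

/-- A simple artinian ring has one simple module T up to isomorphism. If M is T^r and N is T^s, both
sides are T^(rs). -/
theorem exists_linearEquiv_fun_pair {R M N : Type*} [Ring R] [IsSimpleRing R] [IsArtinianRing R]
    [AddCommGroup M] [Module R M] [AddCommGroup N] [Module R N] [Module.Finite R M]
    [Module.Finite R N] [Nontrivial M] [Nontrivial N] :
    ∃ r s : ℕ, r ≠ 0 ∧ s ≠ 0 ∧ Nonempty ((Fin s → M) ≃ₗ[R] (Fin r → N)) := by
  have : IsSemisimpleRing R := IsSimpleRing.isSemisimpleRing_iff_isArtinianRing.2 inferInstance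
  have hiso := (isSimpleRing_isArtinianRing_iff.1 ⟨‹IsSimpleRing R›, ‹_›⟩).2.1
  obtain ⟨r, hr, S, hS, ⟨e⟩⟩ := (hiso.of_self M).linearEquiv_fun
  obtain ⟨s, hs, T, hT, ⟨f⟩⟩ := (hiso.of_self N).linearEquiv_fun
  obtain ⟨I, ⟨eI⟩⟩ := IsSemisimpleRing.exists_linearEquiv_ideal_of_isSimpleModule R S
  obtain ⟨J, ⟨eJ⟩⟩ := IsSemisimpleRing.exists_linearEquiv_ideal_of_isSimpleModule R T
  have := IsSimpleModule.congr eI.symm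
  have := IsSimpleModule.congr eJ.symm
  obtain ⟨g⟩ := hiso I J
  let ST : S ≃ₗ[R] T := eI.trans (g.symm.trans eJ.symm)
  refine ⟨r, s, hr.1, hs.1, ⟨?_⟩⟩
  let e1 : (Fin s → M) ≃ₗ[R] (Fin s → Fin r → S) := LinearEquiv.piCongrRight fun _ => e
  let e2 : (Fin s → Fin r → S) ≃ₗ[R] (Fin s → Fin r → T) :=
    LinearEquiv.piCongrRight fun _ => LinearEquiv.piCongrRight fun _ => ST
  let e3 : (Fin s → Fin r → T) ≃ₗ[R] (Fin r → Fin s → T) :=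
    { toFun := fun v a b => v b a
      invFun := fun v a b => v b a
      map_add' := fun _ _ => rfl
      map_smul' := fun _ _ => rfl
      left_inv := fun _ => rfl
      right_inv := fun _ => rfl }
  let e4 : (Fin r → N) ≃ₗ[R] (Fin r → Fin s → T) := LinearEquiv.piCongrRight fun _ => f
  exact e1.trans (e2.trans (e3.trans e4.symm))

variable {k A C : Type*} [Field k] [Ring A] [Algebra k A] [Ring C] [Algebra k C]

/-- A nonzero corner `jAj` of a finite-dimensional simple algebra `A` is Brauer equivalent
to `A`. -/
theorem exists_matrix_algEquiv_of_corner [IsSimpleRing A] [FiniteDimensional k A]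
    (ψ : C →ₗ[k] A) (hmul : ∀ x y, ψ (x * y) = ψ x * ψ y) (hinj : Function.Injective ψ)
    (h0 : ψ 1 ≠ 0) (hsurj : ∀ a, ∃ c, ψ c = ψ 1 * a * ψ 1) :
    ∃ s r : ℕ, s ≠ 0 ∧ r ≠ 0 ∧ ∀ (_ : Fintype (Fin s)) (_ : Fintype (Fin r))
      (_ : DecidableEq (Fin s)) (_ : DecidableEq (Fin r)),
      Nonempty (Matrix (Fin s) (Fin s) A ≃ₐ[k] Matrix (Fin r) (Fin r) C) := by
  set j := ψ 1
  have hj : j * j = j := by rw [← hmul, one_mul]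
  have hψ : ∀ c, j * ψ c = ψ c := fun c => by rw [← hmul, one_mul]
  have hψ' : ∀ c, ψ c * j = ψ c := fun c => by rw [← hmul, mul_one]
  -- This is the right ideal jA. Its endomorphism ring is jAj, which is C.
  let N : Submodule Aᵐᵒᵖ A :=
    { carrier := {x | j * x = x}
      add_mem' := fun {a b} (ha : j * a = a) (hb : j * b = b) => by
        change j * (a + b) = a + b
        rw [mul_add, ha, hb]
      zero_mem' := mul_zero _
      smul_mem' := fun c x (hx : j * x = x) => by
        change j * (x * c.unop) = x * c.unop
        rw [← mul_assoc, hx] }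
  have hN : ∀ x, x ∈ N ↔ j * x = x := fun _ => Iff.rfl
  have hjN : j ∈ N := hj
  have : Nontrivial N := ⟨⟨⟨j, hjN⟩, 0, fun h => h0 (congrArg Subtype.val h)⟩⟩
  have : IsArtinianRing Aᵐᵒᵖ := IsArtinianRing.of_finite k Aᵐᵒᵖ
  have : Module.Finite Aᵐᵒᵖ A := Module.Finite.of_surjective
    (LinearMap.toSpanSingleton Aᵐᵒᵖ A (1 : A)) fun x => ⟨MulOpposite.op x, by simp⟩
  have : IsSemisimpleRing Aᵐᵒᵖ := IsSimpleRing.isSemisimpleRing_iff_isArtinianRing.2 inferInstance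
  obtain ⟨r, s, hr, hs, ⟨e⟩⟩ := exists_linearEquiv_fun_pair (R := Aᵐᵒᵖ) (M := A) (N := N)
  refine ⟨s, r, hs, hr, fun _ _ _ _ => ⟨?_⟩⟩
  let act : C →ₐ[k] Module.End Aᵐᵒᵖ N :=
    { toFun := fun c =>
        { toFun := fun x => ⟨ψ c * x, by rw [hN, ← mul_assoc, hψ]⟩
          map_add' := fun x y => Subtype.ext (mul_add _ _ _)
          map_smul' := fun a x => Subtype.ext (mul_assoc (ψ c) (x : A) a.unop).symm }
      map_one' := LinearMap.ext fun x => Subtype.ext x.2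
      map_mul' := fun c d => LinearMap.ext fun x => Subtype.ext (by
        change ψ (c * d) * (x : A) = ψ c * (ψ d * x)
        rw [hmul, mul_assoc])
      map_zero' := LinearMap.ext fun x => Subtype.ext (by
        change ψ 0 * (x : A) = 0
        rw [map_zero, zero_mul])
      map_add' := fun c d => LinearMap.ext fun x => Subtype.ext (by
        change ψ (c + d) * (x : A) = ψ c * x + ψ d * x
        rw [map_add, add_mul])
      commutes' := fun t => LinearMap.ext fun x => Subtype.ext (by
        change ψ (algebraMap k C t) * (x : A) = t • (x : A)
        rw [Algebra.algebraMap_eq_smul_one, map_smul, smul_mul_assoc, (hN _).1 x.2]) }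
  have hact : ∀ c (x : N), (act c x : A) = ψ c * x := fun _ _ => rfl
  have hbij : Function.Bijective act := by
    constructor
    · intro c d h
      have := congrArg Subtype.val (LinearMap.congr_fun h ⟨j, hjN⟩)
      rw [hact, hact, hψ', hψ'] at this
      exact hinj this
    · intro T
      obtain ⟨c, hc⟩ := hsurj (T ⟨j, hjN⟩ : N)
      have h1 : ∀ x : N, (T x : A) = (T ⟨j, hjN⟩ : N) * (x : A) := by
        intro x
        have := T.map_smul (MulOpposite.op (x : A)) ⟨j, hjN⟩
        have hx : MulOpposite.op (x : A) • (⟨j, hjN⟩ : N) = x := Subtype.ext ((hN _).1 x.2)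
        rw [hx] at this
        rw [this]
        rfl
      refine ⟨c, LinearMap.ext fun x => Subtype.ext ?_⟩
      rw [hact, h1, hc, (hN _).1 (T ⟨j, hjN⟩).2, mul_assoc, (hN _).1 x.2]
  -- M_s(A) is End(A^s), which is End(N^r), which is M_r(End N) = M_r(C).
  let e1 : A ≃ₐ[k] Module.End Aᵐᵒᵖ A := AlgEquiv.moduleEndSelfOp k
  let e2 : C ≃ₐ[k] Module.End Aᵐᵒᵖ N := AlgEquiv.ofBijective act hbij
  exact (e1.mapMatrix (m := Fin s)).trans
    ((endVecAlgEquivMatrixEnd (Fin s) k Aᵐᵒᵖ A).symm.trans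
      ((e.conjAlgEquiv k).trans
        ((endVecAlgEquivMatrixEnd (Fin r) k Aᵐᵒᵖ N).trans (e2.mapMatrix (m := Fin r)).symm)))

theorem brauerClass_eq_of_corner {A C : Type u} [Ring A] [Algebra k A] [Ring C] [Algebra k C]
    (hA : IsCSA k A) (hC : IsCSA k C)
    (ψ : C →ₗ[k] A) (hmul : ∀ x y, ψ (x * y) = ψ x * ψ y) (hinj : Function.Injective ψ)
    (h0 : ψ 1 ≠ 0) (hsurj : ∀ a, ∃ c, ψ c = ψ 1 * a * ψ 1) :
    brauerClass hA = brauerClass hC := by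
  have := hA.simple
  have := hA.finite
  obtain ⟨s, r, hs, hr, h⟩ := exists_matrix_algEquiv_of_corner ψ hmul hinj h0 hsurj
  exact Quotient.sound ⟨s, r, hs, hr, h _ _ _ _⟩

end Corner

/-- A ring as an algebra over its centre. -/
abbrev centerAlgebra (A : Type*) [Ring A] : Algebra (Subring.center A) A := inferInstance

/-- A ring as a module over its centre. -/
abbrev centerModule (A : Type*) [Ring A] : Module (Subring.center A) A := Algebra.toModule

attribute [local instance] centerAlgebra centerModule

/-! ### Coercions for subalgebras with their own identity. -/

section CornerSubalgebra

variable {k R : Type*} [Field k] [Ring R] [Algebra k R] (S : CornerSubalgebra k R)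

@[simp] theorem CornerSubalgebra.coe_mul (a b : S) : ((a * b : S) : R) = a * b := rfl

@[simp] theorem CornerSubalgebra.coe_add (a b : S) : ((a + b : S) : R) = a + b := rfl

@[simp] theorem CornerSubalgebra.coe_sub (a b : S) : ((a - b : S) : R) = a - b := rfl

@[simp] theorem CornerSubalgebra.coe_neg (a : S) : ((-a : S) : R) = -a := rfl

@[simp] theorem CornerSubalgebra.coe_zero : ((0 : S) : R) = 0 := rfl

@[simp] theorem CornerSubalgebra.coe_smul (c : k) (a : S) : ((c • a : S) : R) = c • (a : R) := rfl

@[simp] theorem CornerSubalgebra.coe_nsmul (m : ℕ) (a : S) : ((m • a : S) : R) = m • (a : R) := rfl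

theorem CornerSubalgebra.coe_pow (a : S) (m : ℕ) : ((a ^ (m + 1) : S) : R) = (a : R) ^ (m + 1) := by
  induction m with
  | zero => simp
  | succ m ih => rw [pow_succ, coe_mul, ih, ← pow_succ]

/-- The inclusion of a corner subalgebra. -/
def CornerSubalgebra.incl : S →ₗ[k] R where
  toFun a := a
  map_add' _ _ := rfl
  map_smul' _ _ := rfl

theorem CornerSubalgebra.coe_sum {ι : Type*} (s : Finset ι) (f : ι → S) :
    ((∑ j ∈ s, f j : S) : R) = ∑ j ∈ s, (f j : R) :=
  map_sum S.incl f s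

end CornerSubalgebra

/-! ### The algebra S₀ is simple with centre the field Z₀. -/

namespace ConjFamily

variable {G : Type u} [Group G] [Finite G] {F : Subfield ℂ} {H K : Subgroup G} [K.Normal]
  {θ : K → ℂ} {φ : ↥(H ⊓ K) → ℂ} {Γ : Type} [Fintype Γ] (D : ConjFamily F H K θ φ Γ)
  {S₀ : CornerSubalgebra F ℂ[G]} (hS₀ : IsBaseSubalgebra F θ φ S₀)

local notation "𝐢" => idem F θ φ

include D hS₀

theorem base_mem (s : S₀) : (s : ℂ[G]) ∈ D.S := hS₀.subset s s.2

omit D in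
theorem base_coe_one : ((1 : S₀) : ℂ[G]) = 𝐢 := hS₀.unit_eq

theorem mem_center_iff (s : S₀) : s ∈ Subring.center S₀ ↔
    (s : ℂ[G]) ∈ D.Z ∧ ∀ h ∈ H, gconj (s : ℂ[G]) h = s := by
  rw [D.mem_Z, ← hS₀.center_eq s, Subring.mem_center_iff]
  constructor
  · exact fun h => ⟨s.2, fun t ht => (congrArg Subtype.val (h ⟨t, ht⟩)).symm⟩
  · exact fun h t => Subtype.ext (h.2 t t.2).symm

theorem base_mul_idem (s : S₀) : (s : ℂ[G]) * 𝐢 = s := mul_idem_of_mem_S (D.base_mem hS₀ s)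

theorem idem_mul_base (s : S₀) : 𝐢 * (s : ℂ[G]) = s := idem_mul_of_mem_S (D.base_mem hS₀ s)

theorem mem_span_of_mem_S {s : ℂ[G]} (hs : s ∈ D.S) :
    s ∈ Submodule.span F {x : ℂ[G] | ∃ t : S₀, ∃ z ∈ D.Z, x = t * z} := by
  have h : s ∈ (Submodule.span F {x : ℂ[G] | ∃ s ∈ S₀.toNonUnitalSubalgebra,
    ∃ z ∈ centerSet F θ φ, x = s * z} : Set ℂ[G]) := hS₀.span_eq ▸ hs
  refine Submodule.span_mono ?_ h
  rintro _ ⟨t, ht, z, hz, rfl⟩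
  exact ⟨⟨t, ht⟩, z, hz, rfl⟩

/-- Nondegeneracy of the trace forms, tested on `S₀`. -/
theorem eq_zero_of_base {s : ℂ[G]} (hs : s ∈ D.S)
    (h : ∀ γ, ∀ t : S₀, linExt (D.Θ γ) (s * t) = 0) : s = 0 := by
  refine eq_zero_of_linExt_mul_eq_zero hs fun γ t ht => ?_
  have ht' := D.mem_span_of_mem_S hS₀ ht
  clear ht
  induction ht' using Submodule.span_induction with
  | mem x hx =>
    obtain ⟨t, z, hz, rfl⟩ := hx
    rw [← mul_assoc, linExt_mul_of_mem_Z γ hz, h, mul_zero]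
    rw [mul_assoc, D.base_mul_idem hS₀]
  | zero => simp
  | add x y _ _ hx hy => rw [mul_add, linExt_add, hx, hy, add_zero]
  | smul c x _ hx => rw [mul_smul_comm, linExt_smul_of_algebra, hx, mul_zero]

theorem base_nontrivial : Nontrivial S₀ :=
  ⟨⟨1, 0, fun h => D.idem_ne_zero (by
    rw [← base_coe_one hS₀, h, CornerSubalgebra.coe_zero])⟩⟩

theorem base_finiteDimensional : FiniteDimensional F S₀ := by
  have := finiteDimensional_groupAlg F K
  let j : S₀ →ₗ[F] groupAlg F K :=
    { toFun := fun s => ⟨s, mem_groupAlg_of_mem_S (D.base_mem hS₀ s)⟩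
      map_add' := fun _ _ => rfl
      map_smul' := fun _ _ => rfl }
  exact FiniteDimensional.of_injective j fun s t h =>
    Subtype.ext (congrArg (fun x : groupAlg F K => (x : ℂ[G])) h)

/-- On each component z acts as a nonzero scalar, so zs = 0 makes all trace forms vanish at s. -/
theorem eq_zero_of_center_mul {z : S₀} (hz : z ∈ Subring.center S₀) (h0 : z ≠ 0) {s : S₀}
    (h : z * s = 0) : s = 0 := by
  have hz' := ((D.mem_center_iff hS₀ z).1 hz).1
  apply Subtype.ext
  refine D.eq_zero_of_base hS₀ (D.base_mem hS₀ s) fun γ t => ?_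
  have h1 : (s : ℂ[G]) * t * z = 0 := by
    have : s * t * z = 0 := by rw [Subring.mem_center_iff.1 hz (s * t), ← mul_assoc, h, zero_mul]
    exact congrArg Subtype.val this
  have h2 := linExt_mul_of_mem_Z γ hz' (a := (s : ℂ[G]) * t)
    (by rw [mul_assoc, D.base_mul_idem hS₀])
  rw [h1, linExt_zero] at h2
  refine (mul_eq_zero.1 h2.symm).resolve_left fun h3 => h0 ?_
  exact Subtype.ext (eq_zero_of_ω_eq_zero γ hz' h3)

/-- Multiplication by a nonzero central element is injective on a finite-dimensional space, hence
surjective, and the inverse of a central element is central. -/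
theorem isField_center : IsField (Subring.center S₀) where
  exists_pair_ne := by
    have := D.base_nontrivial hS₀
    exact exists_pair_ne _
  mul_comm := mul_comm
  mul_inv_cancel := by
    intro z hz
    have := D.base_finiteDimensional hS₀
    have hz0 : (z : S₀) ≠ 0 := fun h => hz (Subtype.ext h)
    have hinj : Function.Injective (LinearMap.mulLeft F (z : S₀)) := by
      refine (injective_iff_map_eq_zero _).2 fun s hs => ?_
      exact D.eq_zero_of_center_mul hS₀ z.2 hz0 hs
    obtain ⟨w, hw⟩ := LinearMap.injective_iff_surjective.1 hinj 1
    rw [LinearMap.mulLeft_apply] at hw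
    refine ⟨⟨w, Subring.mem_center_iff.2 fun x => ?_⟩, Subtype.ext hw⟩
    apply hinj
    simp only [LinearMap.mulLeft_apply]
    rw [← mul_assoc, ← Subring.mem_center_iff.1 z.2 x, mul_assoc, hw, ← mul_assoc, hw, mul_one,
      one_mul]

/-- The radical is a nilpotent ideal, so the trace forms vanish on it; by nondegeneracy it is zero.
-/
theorem base_isSemisimpleRing : IsSemisimpleRing S₀ := by
  have := D.base_finiteDimensional hS₀
  have := IsArtinianRing.of_finite F S₀
  rw [IsArtinianRing.isSemisimpleRing_iff_jacobson]
  obtain ⟨m, hm⟩ := IsArtinianRing.isNilpotent_jacobson_bot (R := S₀)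
  rw [Ideal.jacobson_bot] at hm
  rw [eq_bot_iff]
  intro s hs
  rw [Submodule.mem_bot]
  apply Subtype.ext
  refine D.eq_zero_of_base hS₀ (D.base_mem hS₀ s) fun γ t => ?_
  have h1 : s * t ∈ Ring.jacobson S₀ := Ideal.mul_mem_right t _ hs
  have h2 : (s * t) ^ (m + 1) = 0 := by
    have := Ideal.pow_mem_pow h1 m
    rw [hm] at this
    rw [pow_succ, (Submodule.mem_bot S₀).1 this, zero_mul]
  refine (D.irrΘ γ).linExt_eq_zero_of_isNilpotent
    (mem_complex_of_mem_S (D := D) (D.S.mul_mem (D.base_mem hS₀ s) (D.base_mem hS₀ t))) ⟨m + 1, ?_⟩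
  have h3 := CornerSubalgebra.coe_pow S₀ (s * t) m
  rw [h2] at h3
  exact h3.symm

/-- A nonzero central idempotent e kills e − 1 and is not a zero divisor, so e = 1. -/
theorem base_isSimpleRing : IsSimpleRing S₀ := by
  have := D.base_nontrivial hS₀
  have := D.base_isSemisimpleRing hS₀
  refine isSimpleRing_of_isSemisimpleRing fun e he hee => ?_
  have hc : e ∈ Subring.center S₀ := Subring.mem_center_iff.2 fun x => (he x).symm
  by_contra! h
  refine h.2 (sub_eq_zero.1 (D.eq_zero_of_center_mul hS₀ hc h.1 ?_))
  rw [mul_sub, hee, mul_one, sub_self]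

omit D hS₀ in
theorem isCentral_center (A : Type*) [Ring A] : Algebra.IsCentral (Subring.center A) A :=
  ⟨fun z hz => ⟨⟨z, Subring.mem_center_iff.2 fun x => Subalgebra.mem_center_iff.1 hz x⟩, rfl⟩⟩

theorem base_finite_center : Module.Finite (Subring.center S₀) S₀ := by
  have := D.base_finiteDimensional hS₀
  let b := Module.finBasis F S₀
  refine ⟨Submodule.fg_def.2 ⟨Set.range b, Set.finite_range b, eq_top_iff.2 fun x _ => ?_⟩⟩
  rw [← b.sum_repr x]
  refine sum_mem fun j _ => ?_
  have hc : algebraMap F S₀ (b.repr x j) ∈ Subring.center S₀ :=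
    Subring.mem_center_iff.2 fun y => (Algebra.commutes _ y).symm
  rw [Algebra.smul_def]
  exact Submodule.smul_mem _ (⟨_, hc⟩ : Subring.center S₀) (Submodule.subset_span ⟨j, rfl⟩)

/-- Trace functions on `S₀` factor through the trace over the centre. -/
theorem finrank_mul_map (τ : ℂ[G] →+ ℂ) (hτ : ∀ x y : S₀, τ ((x : ℂ[G]) * y) = τ (y * x)) (s : S₀) :
    (Module.finrank (Subring.center S₀) S₀ : ℂ) * τ s =
      τ ((LinearMap.trace (Subring.center S₀) S₀ (LinearMap.mulLeft _ s) : S₀) : ℂ[G]) := by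
  have h := smul_sub_mem_closure_of_isField (D.isField_center hS₀) (isCentral_center S₀)
    (D.base_isSimpleRing hS₀) (D.base_finite_center hS₀) s
  have key : ∀ c ∈ AddSubgroup.closure {c : S₀ | ∃ x y, c = x * y - y * x}, τ c = 0 := by
    intro c hc
    induction hc using AddSubgroup.closure_induction with
    | mem c hc =>
      obtain ⟨x, y, rfl⟩ := hc
      rw [CornerSubalgebra.coe_sub, map_sub, CornerSubalgebra.coe_mul, CornerSubalgebra.coe_mul,
        hτ, sub_self]
    | zero => exact map_zero τ
    | add x y _ _ hx hy => rw [CornerSubalgebra.coe_add, map_add, hx, hy, add_zero]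
    | neg x _ hx => rw [CornerSubalgebra.coe_neg, map_neg, hx, neg_zero]
  have h1 := key _ h
  rw [CornerSubalgebra.coe_sub, map_sub, sub_eq_zero, Nat.cast_smul_eq_nsmul,
    CornerSubalgebra.coe_nsmul, map_nsmul, nsmul_eq_mul] at h1
  rw [h1]
  congr 2
  rw [Subring.smul_def, smul_eq_mul, mul_one]

end ConjFamily

theorem IsCharLike.sum_linExt_conj {G : Type u} [Group G] [Finite G] {U : Subgroup G} {χ : U → ℂ}
    (hχ : IsCharLike χ) {a : ℂ[G]} (ha : a ∈ groupAlg ℂ U) (b : ℂ[G]) :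
    ∑ x : U, linExt χ (⟪(x : G)⁻¹⟫ * a * ⟪(x : G)⟫ * b) =
      Nat.card U / χ 1 * linExt χ a * linExt χ b := by
  have h1 : ∑ x : U, linExt χ (⟪(x : G)⁻¹⟫ * a * ⟪(x : G)⟫ * b) = linExt χ (conjSum U a * b) := by
    rw [conjSum_apply, Finset.sum_mul, linExt_sum]
    refine Fintype.sum_equiv (Equiv.inv U) _ _ fun x => ?_
    simp
  have hc : conjSum U a ∈ groupAlg ℂ U := conjSum_mem le_rfl ha
  rw [h1, linExt_mul_comm hχ.comm hc, ← hχ.linExt_mul_charIdem, mul_assoc,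
    hχ.conjSum_mul_charIdem ha, mul_smul_comm, linExt_smul, hχ.linExt_mul_charIdem]
  ring

/-! ### The dimension of S₀ and elements of reduced trace one. -/

namespace ConjFamily

variable {G : Type u} [Group G] [Finite G] {F : Subfield ℂ} {H K : Subgroup G} [K.Normal]
  {θ : K → ℂ} {φ : ↥(H ⊓ K) → ℂ} {Γ : Type} [Fintype Γ] (D : ConjFamily F H K θ φ Γ)
  {S₀ : CornerSubalgebra F ℂ[G]} (hS₀ : IsBaseSubalgebra F θ φ S₀)

local notation "𝐢" => idem F θ φ

section Dimension

variable {D} in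
theorem mul_f_of_mem_S (γ : Γ) {s : ℂ[G]} (hs : s ∈ D.S) : s * D.f γ = s * D.eΘ γ := by
  rw [← D.idem_mul_eΘ, ← mul_assoc, mul_idem_of_mem_S hs]

theorem f_ne_zero (γ : Γ) : D.f γ ≠ 0 := by
  intro h
  have h1 := D.linExt_idem γ
  rw [← D.linExt_mul_eΘ, D.idem_mul_eΘ, h, linExt_zero] at h1
  exact mul_ne_zero D.n_cast_ne D.phi_ne h1.symm

/-- Expanding s e_Θ in the basis K and averaging over L writes |L| times the identity of S e_Θ as a
sum of operators of rank at most one, so that its trace can be evaluated. -/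
theorem smul_mul_eΘ_eq_sum (γ : Γ) {s : ℂ[G]} (hs : s ∈ D.S) :
    (Nat.card ↥(H ⊓ K) : ℂ) • (s * D.eΘ γ) = (θ 1 / Nat.card K : ℂ) • ∑ x : K,
      linExt (D.Θ γ) (⟪(x : G)⁻¹⟫ * (s * D.eΘ γ)) •
        (conjSum (H ⊓ K) (𝐢 * ⟪(x : G)⟫ * 𝐢) * D.eΘ γ) := by
  have hsK := mem_complex_of_mem_S hs
  have hmem : s * D.eΘ γ ∈ groupAlg ℂ K := mul_mem hsK (D.eΘ_mem γ)
  have h1 : s * D.eΘ γ = ∑ x : K, (θ 1 / Nat.card K *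
      linExt (D.Θ γ) (⟪(x : G)⁻¹⟫ * (s * D.eΘ γ)) : ℂ) • ⟪(x : G)⟫ := by
    conv_lhs => rw [eq_sum_of_support (fun x hx => coeff_eq_zero_of_mem hmem hx)]
    refine Finset.sum_congr rfl fun x _ => ?_
    have h2 := coeff_one_mul_charIdem (D.Θ γ) (⟪(x : G)⁻¹⟫ * s)
    rw [← eΘ, mul_assoc, MonoidAlgebra.coeff_single_mul_apply, inv_inv, mul_one, one_mul] at h2
    rw [h2, D.Θ_one, ← mul_assoc, linExt_mul_eΘ, MonoidAlgebra.smul_single, smul_eq_mul, mul_one]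
  have hcomm : ∀ l ∈ H ⊓ K, ⟪l⟫ * D.eΘ γ = D.eΘ γ * ⟪l⟫ := fun l hl =>
    D.eΘ_comm γ (single_mem_groupAlg hl.2)
  have hcs : conjSum (H ⊓ K) s = (Nat.card ↥(H ⊓ K) : ℂ) • s :=
    conjSum_of_comm fun l hl => (single_comm_of_mem_S hs hl).symm
  have h3 : 𝐢 * (s * D.eΘ γ) * 𝐢 = s * D.eΘ γ := by
    rw [mul_assoc, mul_assoc, ← D.eΘ_comm γ D.idem_mem_complex, ← mul_assoc s, mul_idem_of_mem_S hs,
      ← mul_assoc, idem_mul_of_mem_S hs]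
  have h4 : conjSum (H ⊓ K) (𝐢 * (s * D.eΘ γ) * 𝐢) * D.eΘ γ =
      (Nat.card ↥(H ⊓ K) : ℂ) • (s * D.eΘ γ) := by
    rw [h3, conjSum_mul_right _ hcomm, hcs, smul_mul_assoc, smul_mul_assoc, mul_assoc,
      D.eΘ_mul_self]
  rw [← h4]
  conv_lhs => rw [h1]
  simp only [Finset.mul_sum, Finset.sum_mul, map_sum, mul_smul_comm, smul_mul_assoc, map_smul,
    Finset.smul_sum, mul_smul]

include hS₀ in
-- The dimension over Z₀ equals the complex dimension of the span of S₀ e_Θ, and the latter is the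
-- trace of the identity. Orthogonality for Θ over K and for Φ over L evaluates this trace to n².
theorem finrank_center_base : Module.finrank (Subring.center S₀) S₀ = D.n ^ 2 := by
  obtain ⟨γ⟩ := D.nonempty
  obtain ⟨m, hm, b, hb⟩ : ∃ m, Module.finrank (Subring.center S₀) S₀ = m ∧
      ∃ b : Module.Basis (Fin m) (Subring.center S₀) S₀, ∀ j, ∃ s : Finset (S₀ × S₀ᵐᵒᵖ),
        ∀ x, b.coord j x • (1 : S₀) = ∑ p ∈ s, p.1 * x * p.2.unop :=
    ⟨_, rfl, exists_basis_coord_eq_sum (D.isField_center hS₀) (isCentral_center S₀)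
      (D.base_isSimpleRing hS₀) (D.base_finite_center hS₀)⟩
  rw [hm]
  let v : Fin m → ℂ[G] := fun j => (b j : ℂ[G]) * D.eΘ γ
  -- Applying the two-sided multiplications that represent a coordinate to a relation leaves c_j f_γ
  -- = 0.
  have hv : LinearIndependent ℂ v := by
    rw [Fintype.linearIndependent_iff]
    intro c hc j
    obtain ⟨s, hs⟩ := hb j
    have h1 : ∑ p ∈ s, (p.1 : ℂ[G]) * (∑ l, c l • v l) * (p.2.unop : ℂ[G]) = c j • D.f γ := by
      simp only [Finset.mul_sum, Finset.sum_mul]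
      rw [Finset.sum_comm, Finset.sum_eq_single j]
      · have h2 := congrArg (fun y : S₀ => (y : ℂ[G])) (hs (b j))
        simp only [Module.Basis.coord_apply, Module.Basis.repr_self, Finsupp.single_eq_same,
          one_smul] at h2
        rw [base_coe_one hS₀, CornerSubalgebra.coe_sum] at h2
        rw [← D.idem_mul_eΘ, h2, Finset.sum_mul, Finset.smul_sum]
        refine Finset.sum_congr rfl fun p _ => ?_
        rw [mul_smul_comm, smul_mul_assoc]
        simp only [v, CornerSubalgebra.coe_mul, mul_assoc]
        rw [D.eΘ_comm γ (mem_complex_of_mem_S (D.base_mem hS₀ p.2.unop))]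
      · intro l _ hl
        have h2 := congrArg (fun y : S₀ => (y : ℂ[G])) (hs (b l))
        simp only [Module.Basis.coord_apply, Module.Basis.repr_self,
          Finsupp.single_eq_of_ne hl.symm, zero_smul] at h2
        rw [CornerSubalgebra.coe_zero, CornerSubalgebra.coe_sum] at h2
        have h3 : ∑ p ∈ s, (p.1 : ℂ[G]) * (c l • v l) * (p.2.unop : ℂ[G]) =
            c l • ((∑ p ∈ s, ((p.1 * b l * p.2.unop : S₀) : ℂ[G])) * D.eΘ γ) := by
          rw [Finset.sum_mul, Finset.smul_sum]
          refine Finset.sum_congr rfl fun p _ => ?_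
          rw [mul_smul_comm, smul_mul_assoc]
          simp only [v, CornerSubalgebra.coe_mul, mul_assoc]
          rw [D.eΘ_comm γ (mem_complex_of_mem_S (D.base_mem hS₀ p.2.unop))]
        rw [h3, ← h2, zero_mul, smul_zero]
      · simp
    rw [hc] at h1
    simp only [mul_zero, zero_mul, Finset.sum_const_zero] at h1
    exact (smul_eq_zero.1 h1.symm).resolve_right (D.f_ne_zero γ)
  let A := Submodule.span ℂ (Set.range v)
  have hA : Module.finrank ℂ A = m := by
    rw [finrank_span_eq_card hv, Fintype.card_fin]
  have hbase : ∀ t : S₀, (t : ℂ[G]) * D.eΘ γ ∈ A := by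
    intro t
    rw [← b.sum_repr t, CornerSubalgebra.coe_sum, Finset.sum_mul]
    refine sum_mem fun j _ => ?_
    have hz := ((D.mem_center_iff hS₀ _).1 (b.repr t j).2).1
    have h1 : (((b.repr t j) • b j : S₀) : ℂ[G]) * D.eΘ γ =
        D.ω γ ((b.repr t j : S₀) : ℂ[G]) • v j := by
      rw [Subring.smul_def, smul_eq_mul, CornerSubalgebra.coe_mul, Z_comm hz (D.base_mem hS₀ _),
        mul_assoc, mul_eΘ_of_mem_Z γ hz, mul_smul_comm, mul_f_of_mem_S γ (D.base_mem hS₀ _)]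
    rw [h1]
    exact Submodule.smul_mem _ _ (Submodule.subset_span ⟨j, rfl⟩)
  have hS : ∀ s ∈ D.S, s * D.eΘ γ ∈ A := by
    intro s hs
    have hs' := D.mem_span_of_mem_S hS₀ hs
    clear hs
    induction hs' using Submodule.span_induction with
    | mem x hx =>
      obtain ⟨t, z, hz, rfl⟩ := hx
      rw [mul_assoc, mul_eΘ_of_mem_Z γ hz, mul_smul_comm, mul_f_of_mem_S γ (D.base_mem hS₀ _)]
      exact Submodule.smul_mem _ _ (hbase t)
    | zero => rw [zero_mul]; exact zero_mem _
    | add x y _ _ hx hy => rw [add_mul]; exact add_mem hx hy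
    | smul c x _ hx =>
      rw [smul_mul_assoc, ← algebraMap_smul (A := ℂ)]
      exact Submodule.smul_mem _ _ hx
  let w : K → A := fun x => ⟨conjSum (H ⊓ K) (𝐢 * ⟪(x : G)⟫ * 𝐢) * D.eΘ γ,
    hS _ (mem_S_of_corner_single x.2)⟩
  let l : K → (A →ₗ[ℂ] ℂ) := fun x =>
    (linForm (D.Θ γ) ∘ₗ LinearMap.mulLeft ℂ ⟪(x : G)⁻¹⟫) ∘ₗ A.subtype
  -- The expansion of elements of S e_Θ, read as an identity of operators on A. It only has to be
  -- checked on the spanning family.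
  have hid : (Nat.card ↥(H ⊓ K) : ℂ) • (LinearMap.id : A →ₗ[ℂ] A) =
      (θ 1 / Nat.card K : ℂ) • ∑ x : K, (l x).smulRight (w x) := by
    refine LinearMap.ext fun a => Subtype.ext ?_
    obtain ⟨a, ha⟩ := a
    induction ha using Submodule.span_induction with
    | mem x hx =>
      obtain ⟨j, rfl⟩ := hx
      have := D.smul_mul_eΘ_eq_sum γ (D.base_mem hS₀ (b j))
      simp only [LinearMap.smul_apply, LinearMap.sum_apply, LinearMap.smulRight_apply,
        LinearMap.id_apply, Submodule.coe_smul, Submodule.coe_sum]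
      exact this
    | zero =>
      exact congrArg Subtype.val ((LinearMap.map_zero _).trans (LinearMap.map_zero _).symm)
    | add x y hx hy h1 h2 =>
      have e : (⟨x + y, add_mem hx hy⟩ : A) = ⟨x, hx⟩ + ⟨y, hy⟩ := rfl
      rw [e, map_add, map_add, Submodule.coe_add, Submodule.coe_add, h1, h2]
    | smul c x hx h1 =>
      have e : (⟨c • x, Submodule.smul_mem _ c hx⟩ : A) = c • ⟨x, hx⟩ := rfl
      rw [e, map_smul, map_smul, Submodule.coe_smul, Submodule.coe_smul, h1]
  have htr := congrArg (LinearMap.trace ℂ A) hid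
  rw [map_smul, map_smul, map_sum, LinearMap.trace_id, hA] at htr
  have hK := IsCharLike.card_ne_zero K
  have hL := IsCharLike.card_ne_zero (H ⊓ K)
  have hN := D.theta_ne
  -- For fixed y in L the sum over K factors into Θ(y i) Θ(y⁻¹ i) = n² Φ(y) Φ(y⁻¹), and the norm of
  -- Φ finishes the sum over L.
  have hsum : ∑ x : K, LinearMap.trace ℂ A ((l x).smulRight (w x)) =
      Nat.card K / θ 1 * (D.n ^ 2 * Nat.card ↥(H ⊓ K)) := by
    have h1 : ∀ x : K, LinearMap.trace ℂ A ((l x).smulRight (w x)) =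
        ∑ y : ↥(H ⊓ K), linExt (D.Θ γ)
          (⟪(x : G)⁻¹⟫ * (⟪(y : G)⟫ * 𝐢) * ⟪(x : G)⟫ * (𝐢 * ⟪(y : G)⁻¹⟫)) := by
      intro x
      rw [LinearMap.trace_smulRight]
      change linExt (D.Θ γ) (⟪(x : G)⁻¹⟫ * (conjSum (H ⊓ K) (𝐢 * ⟪(x : G)⟫ * 𝐢) * D.eΘ γ)) = _
      rw [← mul_assoc, linExt_mul_eΘ, conjSum_apply, Finset.mul_sum, linExt_sum]
      refine Finset.sum_congr rfl fun y _ => ?_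
      simp only [mul_assoc]
    simp only [h1]
    rw [Finset.sum_comm]
    have h2 : ∀ y : ↥(H ⊓ K), ∑ x : K, linExt (D.Θ γ)
          (⟪(x : G)⁻¹⟫ * (⟪(y : G)⟫ * 𝐢) * ⟪(x : G)⟫ * (𝐢 * ⟪(y : G)⁻¹⟫)) =
          Nat.card K / θ 1 * (D.n ^ 2 * (D.Φ γ y * D.Φ γ y⁻¹)) := by
      intro y
      rw [(D.irrΘ γ).sum_linExt_conj (mul_mem (single_mem_groupAlg y.2.2) D.idem_mem_complex),
        ← D.single_mul_idem (inv_mem y.2.1), D.linExt_inf_mul_idem γ (single_mem_groupAlg y.2),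
        D.linExt_inf_mul_idem γ (single_mem_groupAlg (inv_mem y.2)), linExt_single,
        ← Subgroup.coe_inv, linExt_single, D.Θ_one]
      ring
    simp only [h2]
    rw [← Finset.mul_sum, ← Finset.mul_sum, (D.irrΦ γ).norm]
  rw [hsum, smul_eq_mul, smul_eq_mul] at htr
  have h3 : (m : ℂ) = (D.n : ℂ) ^ 2 := by
    field_simp at htr
    linear_combination htr
  exact_mod_cast h3

include hS₀ in
/-- Trace functions on `S₀` at elements of reduced trace one. -/
theorem n_mul_map_of_isReducedTrace_one {s₀ : S₀}
    (h : IsReducedTrace (Subring.center S₀) S₀ s₀ 1) (τ : ℂ[G] →+ ℂ)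
    (hτ : ∀ x y : S₀, τ ((x : ℂ[G]) * y) = τ (y * x)) : (D.n : ℂ) * τ s₀ = τ 𝐢 := by
  obtain ⟨m, hm, ht⟩ := h.exists_degree (D.isField_center hS₀) (D.base_finite_center hS₀)
  rw [D.finrank_center_base hS₀] at hm
  -- Both n² and the square of the splitting degree are the dimension, so the degree is n and the
  -- trace of s₀ over Z₀ is n.
  obtain rfl : D.n = m := Nat.pow_left_injective two_ne_zero hm
  have h1 := D.finrank_mul_map hS₀ τ hτ s₀
  rw [ht, D.finrank_center_base hS₀, mul_one] at h1
  have h2 : (((D.n : Subring.center S₀) : S₀) : ℂ[G]) = D.n • 𝐢 := by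
    rw [← base_coe_one hS₀, ← CornerSubalgebra.coe_nsmul]
    congr 1
    simp
  rw [h2, map_nsmul, nsmul_eq_mul, Nat.cast_pow, sq, mul_assoc] at h1
  exact mul_left_cancel₀ D.n_cast_ne h1

include D hS₀ in
theorem exists_isReducedTrace_one_base :
    ∃ s₀ : S₀, IsReducedTrace (Subring.center S₀) S₀ s₀ 1 := by
  have : CharZero (Subring.center S₀) := by
    refine charZero_of_inj_zero fun m hm => ?_
    have h2 : (((m : Subring.center S₀) : S₀) : ℂ[G]) = m • 𝐢 := by
      rw [← base_coe_one hS₀, ← CornerSubalgebra.coe_nsmul]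
      congr 1
      simp
    rw [hm] at h2
    have h3 : m • 𝐢 = 0 := h2.symm
    rw [← Nat.cast_smul_eq_nsmul ℂ] at h3
    exact_mod_cast (smul_eq_zero.1 h3).resolve_right D.idem_ne_zero
  exact exists_isReducedTrace_one (D.isField_center hS₀) (isCentral_center S₀)
    (D.base_isSimpleRing hS₀) (D.base_finite_center hS₀)

end Dimension

end ConjFamily

/-! ### The automorphism ε(h) is well defined. -/

namespace ConjFamily

variable {G : Type u} [Group G] [Finite G] {F : Subfield ℂ} {H K : Subgroup G} [K.Normal]
  {θ : K → ℂ} {φ : ↥(H ⊓ K) → ℂ} {Γ : Type} [Fintype Γ] (D : ConjFamily F H K θ φ Γ)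
  {S₀ : CornerSubalgebra F ℂ[G]} (hS₀ : IsBaseSubalgebra F θ φ S₀)

local notation "𝐢" => idem F θ φ

section Eps

include hS₀

theorem exists_trace (s : S₀) : ∃ c ∈ D.Z, (∀ h ∈ H, gconj c h = c) ∧ ∀ γ,
    (Module.finrank (Subring.center S₀) S₀ : ℂ) * linExt (D.Θ γ) (s : ℂ[G]) =
      linExt (D.Θ γ) c := by
  have hc := (D.mem_center_iff hS₀ _).1
    (LinearMap.trace (Subring.center S₀) S₀ (LinearMap.mulLeft _ s)).2
  refine ⟨_, hc.1, hc.2, fun γ => ?_⟩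
  refine D.finrank_mul_map hS₀ (linForm (D.Θ γ)).toAddMonoidHom (fun x y => ?_) s
  exact D.linExt_mul_comm' γ (mem_complex_of_mem_S (D.base_mem hS₀ x)) _

/-- For a generator (sz, sz^h) the trace c of st over Z₀ is fixed by H, so the two traces are cz and
cz^h = (cz)^h. This relation between trace data is additive and passes to the whole graph. -/
theorem mem_epsGraph {h : G} (hh : h ∈ H) {p : ℂ[G] × ℂ[G]} (hp : p ∈ epsGraph F θ φ S₀ h) :
    p.2 ∈ D.S ∧ ∀ t : S₀, ∃ r ∈ D.Z, ∀ γ,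
      (Module.finrank (Subring.center S₀) S₀ : ℂ) * linExt (D.Θ γ) (p.1 * t) =
        linExt (D.Θ γ) r ∧
      (Module.finrank (Subring.center S₀) S₀ : ℂ) * linExt (D.Θ γ) (p.2 * t) =
        linExt (D.Θ γ) (gconj r h) := by
  induction hp using AddSubgroup.closure_induction with
  | mem p hp =>
    obtain ⟨s, hs, z, hz, rfl⟩ := hp
    have hz' : z ∈ D.Z := hz
    have hzh := gconj_mem_Z hz' hh
    have hs' : s ∈ D.S := hS₀.subset s hs
    refine ⟨D.S.mul_mem hs' (D.Z_le_S hzh), fun t => ?_⟩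
    obtain ⟨c, hc, hch, key⟩ := D.exists_trace hS₀ (⟨s, hs⟩ * t)
    have hci : c * 𝐢 = c := mul_idem_of_mem_S (D := D) (D.Z_le_S hc)
    replace key : ∀ γ, (Module.finrank (Subring.center S₀) S₀ : ℂ) *
      linExt (D.Θ γ) (s * (t : ℂ[G])) = linExt (D.Θ γ) c := key
    have hst : s * (t : ℂ[G]) * 𝐢 = s * t := by rw [mul_assoc, D.base_mul_idem hS₀]
    refine ⟨c * z, D.Z.mul_mem hc hz', fun γ => ⟨?_, ?_⟩⟩
    · change _ * linExt _ (s * z * (t : ℂ[G])) = _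
      rw [mul_assoc s, Z_comm hz' (D.base_mem hS₀ t), ← mul_assoc, linExt_mul_of_mem_Z γ hz' hst,
        linExt_mul_of_mem_Z γ hz' hci, mul_left_comm, key]
    · change _ * linExt _ (s * gconj z h * (t : ℂ[G])) = _
      rw [gconj_mul, hch h hh, mul_assoc s, Z_comm hzh (D.base_mem hS₀ t), ← mul_assoc,
        linExt_mul_of_mem_Z γ hzh hst,
        linExt_mul_of_mem_Z γ hzh hci, mul_left_comm, key]
  | zero =>
    refine ⟨D.S.zero_mem, fun t => ⟨0, D.Z.zero_mem, fun γ => ?_⟩⟩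
    simp [gconj]
  | add p q _ _ hp hq =>
    refine ⟨D.S.add_mem hp.1 hq.1, fun t => ?_⟩
    obtain ⟨r, hr, h1⟩ := hp.2 t
    obtain ⟨r', hr', h2⟩ := hq.2 t
    refine ⟨r + r', D.Z.add_mem hr hr', fun γ => ⟨?_, ?_⟩⟩
    · rw [Prod.fst_add, add_mul, linExt_add, linExt_add, mul_add, (h1 γ).1, (h2 γ).1]
    · rw [Prod.snd_add, add_mul, linExt_add, gconj_add, linExt_add, mul_add, (h1 γ).2, (h2 γ).2]
  | neg p _ hp =>
    refine ⟨D.S.neg_mem hp.1, fun t => ?_⟩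
    obtain ⟨r, hr, h1⟩ := hp.2 t
    have hneg : gconj (-r) h = -gconj r h := by simp [gconj]
    have hl : ∀ γ (a : ℂ[G]), linExt (D.Θ γ) (-a) = -linExt (D.Θ γ) a := fun γ a =>
      (linForm (D.Θ γ)).map_neg a
    refine ⟨-r, D.Z.neg_mem hr, fun γ => ⟨?_, ?_⟩⟩
    · rw [Prod.fst_neg, neg_mul, hl, hl, mul_neg, (h1 γ).1]
    · rw [Prod.snd_neg, neg_mul, hneg, hl, hl, mul_neg, (h1 γ).2]

include D

/-- If the first entry is zero, all its trace data vanish, hence so do their conjugates, which are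
the trace data of the second entry. Thus the graph is single valued. -/
theorem eq_zero_of_mem_epsGraph {h : G} (hh : h ∈ H) {q : ℂ[G]}
    (hq : (0, q) ∈ epsGraph F θ φ S₀ h) : q = 0 := by
  obtain ⟨h1, h2⟩ := D.mem_epsGraph hS₀ hh hq
  refine D.eq_zero_of_base hS₀ h1 fun γ t => ?_
  obtain ⟨r, hr, h3⟩ := h2 t
  have h4 := (h3 γ).1
  rw [zero_mul, linExt_zero, mul_zero] at h4
  have hr0 : r = 0 := eq_zero_of_ω_eq_zero γ hr (by rw [ω, ← h4, zero_div])
  have h5 := (h3 γ).2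
  rw [hr0, show gconj (0 : ℂ[G]) h = 0 by simp [gconj], linExt_zero] at h5
  refine (mul_eq_zero.1 h5).resolve_left ?_
  rw [D.finrank_center_base hS₀]
  exact_mod_cast pow_ne_zero 2 (by exact_mod_cast D.n_cast_ne)

theorem eps_eq {h : G} (hh : h ∈ H) {s t : ℂ[G]} (hst : (s, t) ∈ epsGraph F θ φ S₀ h) :
    eps F θ φ S₀ h s = t := by
  have hs : ∃ t, (s, t) ∈ epsGraph F θ φ S₀ h := ⟨t, hst⟩
  rw [eps, dif_pos hs]
  refine sub_eq_zero.1 (D.eq_zero_of_mem_epsGraph hS₀ hh ?_)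
  have := sub_mem hs.choose_spec hst
  rwa [Prod.mk_sub_mk, sub_self] at this

theorem eps_base {h : G} (hh : h ∈ H) (s : S₀) : eps F θ φ S₀ h s = s := by
  refine D.eps_eq hS₀ hh (AddSubgroup.subset_closure ⟨s, s.2, 𝐢, D.idem_mem_Z, ?_⟩)
  rw [(gconj_eq_self_iff _ _).2 (D.single_mul_idem hh), D.base_mul_idem hS₀]

end Eps

end ConjFamily

/-! ### The homomorphism κ. -/

namespace MagicCrossedRep

variable {G : Type u} [Group G] [Finite G] {F : Subfield ℂ} {H K : Subgroup G} [K.Normal]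
  {θ : K → ℂ} {φ : ↥(H ⊓ K) → ℂ} {S₀ : CornerSubalgebra F ℂ[G]} (σ : MagicCrossedRep F θ φ S₀)
  {Γ : Type} [Fintype Γ] (D : ConjFamily F H K θ φ Γ) (hS₀ : IsBaseSubalgebra F θ φ S₀)

local notation "𝐢" => idem F θ φ

/-- `h ↦ h σ(Lh)⁻¹`, a homomorphism from `H` to the units of `i F G i` centralizing `S₀`. -/
def κ (x : H) : ℂ[G] := ⟪(x : G)⟫ * σ.inv x

include D

theorem idem_mul_inv (x : H ⧸ K.subgroupOf H) : 𝐢 * σ.inv x = σ.inv x :=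
  ConjFamily.idem_mul_of_mem_S (D := D) (σ.inv_mem x)

theorem inv_mul_idem (x : H ⧸ K.subgroupOf H) : σ.inv x * 𝐢 = σ.inv x :=
  ConjFamily.mul_idem_of_mem_S (D := D) (σ.inv_mem x)

theorem idem_mul_toFun (x : H ⧸ K.subgroupOf H) : 𝐢 * σ.toFun x = σ.toFun x :=
  ConjFamily.idem_mul_of_mem_S (D := D) (σ.mem x)

theorem idem_mul_κ (x : H) : 𝐢 * σ.κ x = σ.κ x := by
  rw [κ, ← mul_assoc, ← D.single_mul_idem x.2, mul_assoc, σ.idem_mul_inv D]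

theorem κ_mul_idem (x : H) : σ.κ x * 𝐢 = σ.κ x := by
  rw [κ, mul_assoc, σ.inv_mul_idem D]

/-- Inserting the formula for σ(x)^y cancels σ(y)⁻¹ and leaves the crossed identity, so ε
disappears. -/
theorem toFun_mul (x y : H) :
    σ.toFun y * gconj (σ.toFun x) y = σ.toFun (x * y : H) := by
  rw [σ.magic y _ (σ.mem x), mul_assoc (σ.inv y), σ.crossed, ← mul_assoc, σ.mul_inv,
    σ.idem_mul_toFun D]

theorem inv_eq {x : H ⧸ K.subgroupOf H} {t : ℂ[G]} (ht : t * 𝐢 = t) (h : t * σ.toFun x = 𝐢) :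
    σ.inv x = t := by
  rw [← ht, ← σ.mul_inv x, ← mul_assoc, h, σ.idem_mul_inv D]

theorem inv_coe_mul (x y : H) :
    σ.inv (x * y : H) = gconj (σ.inv x) y * σ.inv y := by
  refine σ.inv_eq D (by rw [mul_assoc, σ.inv_mul_idem D]) ?_
  rw [← σ.toFun_mul D, mul_assoc, ← mul_assoc (σ.inv y), σ.inv_mul, ← mul_assoc]
  have hi : gconj 𝐢 (y : G) = 𝐢 :=
    (ConjFamily.gconj_eq_self_iff _ _).2 (D.single_mul_idem y.2)
  conv_lhs => rw [← hi]
  rw [← gconj_mul, ← gconj_mul, σ.inv_mul_idem D, σ.inv_mul, hi]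

theorem κ_mul (x y : H) : σ.κ (x * y) = σ.κ x * σ.κ y := by
  have h : σ.inv x * ⟪(y : G)⟫ = ⟪(y : G)⟫ * gconj (σ.inv x) y :=
    (gconj_eq_iff _ _ _).1 rfl
  rw [κ, κ, κ, σ.inv_coe_mul D, mul_assoc ⟪(x : G)⟫, ← mul_assoc (σ.inv x), h, mul_assoc ⟪(y : G)⟫,
    ← mul_assoc ⟪(x : G)⟫ ⟪(y : G)⟫, single_mul_single_one, Subgroup.coe_mul]

theorem toFun_one : σ.toFun ((1 : H) : H ⧸ K.subgroupOf H) = 𝐢 := by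
  have h := σ.toFun_mul D 1 1
  have h1 : gconj (σ.toFun ((1 : H) : H ⧸ K.subgroupOf H)) ((1 : H) : G) =
      σ.toFun ((1 : H) : H ⧸ K.subgroupOf H) := by
    simp [gconj, ← MonoidAlgebra.one_def]
  rw [h1, mul_one] at h
  have h2 := congrArg (fun a => σ.inv ((1 : H) : H ⧸ K.subgroupOf H) * a) h
  simpa only [← mul_assoc, σ.inv_mul, σ.idem_mul_toFun D] using h2

theorem κ_of_mem {x : H} (hx : (x : G) ∈ K) : σ.κ x = ⟪(x : G)⟫ * 𝐢 := by
  have h : (x : H ⧸ K.subgroupOf H) = (1 : H) :=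
    (QuotientGroup.eq (s := K.subgroupOf H)).2 (by
      rw [mul_one]; exact InvMemClass.inv_mem (Subgroup.mem_subgroupOf.2 hx))
  rw [κ, h, σ.inv_eq D D.idem_mul_self]
  rw [σ.toFun_one D, D.idem_mul_self]

theorem κ_one : σ.κ 1 = 𝐢 := by
  rw [σ.κ_of_mem D (x := 1) (one_mem K), OneMemClass.coe_one, ← MonoidAlgebra.one_def, one_mul]

theorem κ_inv_mul (x : H) : σ.κ x⁻¹ * σ.κ x = 𝐢 := by
  rw [← σ.κ_mul D, inv_mul_cancel, σ.κ_one D]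

theorem κ_mul_toFun (x : H) : σ.κ x * σ.toFun x = ⟪(x : G)⟫ * 𝐢 := by
  rw [κ, mul_assoc, σ.inv_mul]

include hS₀ in
-- On S₀ the automorphism ε is trivial, so conjugation by h and by σ(h) agree there.
theorem base_mul_κ (s : S₀) (x : H) : (s : ℂ[G]) * σ.κ x = σ.κ x * s := by
  have h : (s : ℂ[G]) * ⟪(x : G)⟫ = ⟪(x : G)⟫ * (σ.inv x * s * σ.toFun x) := by
    refine (gconj_eq_iff _ _ _).1 ?_
    rw [σ.magic x _ (D.base_mem hS₀ s), D.eps_base hS₀ x.2]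
  rw [κ, ← mul_assoc, h, mul_assoc, mul_assoc, mul_assoc, σ.mul_inv, mul_assoc,
    D.base_mul_idem hS₀]

theorem inv_mem_groupAlg (x : H ⧸ K.subgroupOf H) : σ.inv x ∈ groupAlg F K :=
  ConjFamily.mem_groupAlg_of_mem_S (D := D) (σ.inv_mem x)

theorem κ_mem {U : Subgroup G} (hU : K ≤ U) {x : H} (hx : (x : G) ∈ U) : σ.κ x ∈ groupAlg F U :=
  mul_mem (single_mem_groupAlg hx) (groupAlg_mono hU (σ.inv_mem_groupAlg D _))

theorem κ_mem_complex {U : Subgroup G} (hU : K ≤ U) {x : H} (hx : (x : G) ∈ U) :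
    σ.κ x ∈ groupAlg ℂ U :=
  mem_groupAlg_complex (σ.κ_mem D hU hx)

end MagicCrossedRep

/-! ### The linear extension of κ, the span of iFUi, and the correspondence. -/

namespace MagicCrossedRep

variable {G : Type u} [Group G] [Finite G] {F : Subfield ℂ} {H K : Subgroup G} [K.Normal]
  {θ : K → ℂ} {φ : ↥(H ⊓ K) → ℂ} {S₀ : CornerSubalgebra F ℂ[G]} (σ : MagicCrossedRep F θ φ S₀)
  {Γ : Type} [Fintype Γ] (D : ConjFamily F H K θ φ Γ) (hS₀ : IsBaseSubalgebra F θ φ S₀)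

local notation "𝐢" => idem F θ φ

/-- The linear extension of `κ` to `ℂH`. -/
def κLin : ℂ[G] →ₗ[ℂ] ℂ[G] where
  toFun a := ∑ x : H, a.coeff (x : G) • σ.κ x
  map_add' a b := by
    rw [← Finset.sum_add_distrib]
    exact Finset.sum_congr rfl fun x _ => by rw [← add_smul]; rfl
  map_smul' c a := by
    rw [RingHom.id_apply, Finset.smul_sum]
    exact Finset.sum_congr rfl fun x _ => by rw [smul_smul]; rfl

theorem κLin_apply (a : ℂ[G]) : σ.κLin a = ∑ x : H, a.coeff (x : G) • σ.κ x := rfl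

theorem κLin_single (x : H) : σ.κLin ⟪(x : G)⟫ = σ.κ x := by
  rw [κLin_apply, Finset.sum_eq_single x]
  · simp
  · intro y _ hy
    have : ((y : G)) ≠ x := fun h => hy (Subtype.ext h)
    simp [this]
  · simp

include D

theorem κLin_mul {a b : ℂ[G]} (ha : a ∈ groupAlg ℂ H) (hb : b ∈ groupAlg ℂ H) :
    σ.κLin (a * b) = σ.κLin a * σ.κLin b := by
  induction ha using groupAlg_induction with
  | single x hx =>
    induction hb using groupAlg_induction with
    | single y hy =>
      rw [single_mul_single_one]
      have h := σ.κLin_single (⟨x, hx⟩ * ⟨y, hy⟩)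
      rw [σ.κ_mul D, ← σ.κLin_single, ← σ.κLin_single] at h
      exact h
    | zero => simp
    | add a b _ _ ha hb => rw [mul_add, map_add, map_add, mul_add, ha, hb]
    | smul c a _ ha => rw [mul_smul_comm, map_smul, map_smul, mul_smul_comm, ha]
  | zero => simp
  | add a b _ _ ha hb => rw [add_mul, map_add, map_add, add_mul, ha, hb]
  | smul c a _ ha => rw [smul_mul_assoc, map_smul, map_smul, smul_mul_assoc, ha]

theorem κLin_of_mem_inf {a : ℂ[G]} (ha : a ∈ groupAlg ℂ (H ⊓ K)) : σ.κLin a = a * 𝐢 := by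
  induction ha using groupAlg_induction with
  | single x hx => rw [σ.κLin_single ⟨x, hx.1⟩, σ.κ_of_mem D hx.2]
  | zero => simp
  | add a b _ _ ha hb => rw [add_mul, map_add, ha, hb]
  | smul c a _ ha => rw [smul_mul_assoc, map_smul, ha]

/-- On L the map κ is multiplication by i, and e_(φ,F) i = i; so κ is unital from the block of φ to
the corner. -/
theorem κLin_galIdem : σ.κLin (galIdem F φ) = 𝐢 := by
  rw [σ.κLin_of_mem_inf D, D.galIdem_phi_mul_idem]
  rw [D.galIdem_phi_eq]
  exact sum_mem fun γ _ => D.eΦ_mem_inf γ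

theorem κLin_mul_idem (a : ℂ[G]) : σ.κLin a * 𝐢 = σ.κLin a := by
  rw [κLin_apply, Finset.sum_mul]
  exact Finset.sum_congr rfl fun x _ => by rw [smul_mul_assoc, σ.κ_mul_idem D]

theorem idem_mul_κLin (a : ℂ[G]) : 𝐢 * σ.κLin a = σ.κLin a := by
  rw [κLin_apply, Finset.mul_sum]
  exact Finset.sum_congr rfl fun x _ => by rw [mul_smul_comm, σ.idem_mul_κ D]

include hS₀ in
theorem base_mul_κLin (s : S₀) (a : ℂ[G]) : (s : ℂ[G]) * σ.κLin a = σ.κLin a * s := by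
  rw [κLin_apply, Finset.sum_mul, Finset.mul_sum]
  exact Finset.sum_congr rfl fun x _ => by
    rw [mul_smul_comm, smul_mul_assoc, σ.base_mul_κ D hS₀]

section

variable {U : Subgroup G} (hU : K ≤ U) {k : Type*} [Field k] [Algebra k ℂ]

include hU

theorem κLin_mem {a : ℂ[G]} (ha : a ∈ groupAlg ℂ (U ⊓ H)) : σ.κLin a ∈ groupAlg ℂ U := by
  induction ha using groupAlg_induction with
  | single x hx => rw [σ.κLin_single ⟨x, hx.2⟩]; exact σ.κ_mem_complex D hU hx.1
  | zero => rw [map_zero]; exact zero_mem _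
  | add a b _ _ ha hb => rw [map_add]; exact add_mem ha hb
  | smul c a _ ha => rw [map_smul]; exact Subalgebra.smul_mem _ ha c

include hS₀

/-- S is S₀Z and Z lies in (FL)i, so a central factor of s can be absorbed by replacing κ(x) with
the elements κ(xl). -/
theorem κ_mul_mem_span {x : H} (hx : (x : G) ∈ U) {s : ℂ[G]} (hs : s ∈ D.S) :
    σ.κ x * s ∈ Submodule.span F
      {c : ℂ[G] | ∃ y : H, (y : G) ∈ U ∧ ∃ t : S₀, c = σ.κ y * t} := by
  have hs' := D.mem_span_of_mem_S hS₀ hs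
  clear hs
  induction hs' using Submodule.span_induction with
  | mem w hw =>
    obtain ⟨t, z, hz, rfl⟩ := hw
    obtain ⟨a, ha, hza⟩ := ConjFamily.exists_eq_mul_idem_of_mem_Z hz
    rw [← ConjFamily.Z_comm hz (D.base_mem hS₀ t), hza, mul_assoc, D.idem_mul_base hS₀, ← mul_assoc]
    clear hza hz
    induction ha using groupAlg_induction with
    | single l hl =>
      refine Submodule.subset_span ⟨x * ⟨l, hl.1⟩, mul_mem hx (hU hl.2), t, ?_⟩
      rw [σ.κ_mul D, σ.κ_of_mem D (x := ⟨l, hl.1⟩) hl.2, mul_assoc, mul_assoc, mul_assoc,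
        D.idem_mul_base hS₀]
    | zero => simp
    | add a b _ _ ha hb => rw [mul_add, add_mul]; exact add_mem ha hb
    | smul c a _ ha =>
      rw [mul_smul_comm, smul_mul_assoc]
      exact Submodule.smul_mem _ _ ha
  | zero => simp
  | add a b _ _ ha hb => rw [mul_add]; exact add_mem ha hb
  | smul c a _ ha => rw [mul_smul_comm]; exact Submodule.smul_mem _ _ ha

/-- `i F U i` is spanned by the products of the values of `κ` with elements of `S₀`. -/
theorem corner_mem_span (hG : ∀ g : G, ∃ h ∈ H, ∃ k ∈ K, g = h * k) {y : G} (hy : y ∈ U) :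
    𝐢 * ⟪y⟫ * 𝐢 ∈ Submodule.span F
      {c : ℂ[G] | ∃ y : H, (y : G) ∈ U ∧ ∃ t : S₀, c = σ.κ y * t} := by
  obtain ⟨h, hh, x, hx, rfl⟩ := hG y
  have hhU : h ∈ U := by simpa using mul_mem hy (InvMemClass.inv_mem (hU hx))
  have hc : 𝐢 * ⟪x⟫ * 𝐢 ∈ cornerSet F θ φ := ⟨_, single_mem_groupAlg hx, rfl⟩
  have h1 : 𝐢 * ⟪h * x⟫ * 𝐢 = ⟪h⟫ * (𝐢 * ⟪x⟫ * 𝐢) := by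
    rw [← single_mul_single_one, ← mul_assoc, ← D.single_mul_idem hh]
    simp only [mul_assoc]
  rw [h1]
  have h2 := ConjFamily.cornerSet_le_span hc D
  clear h1 hc
  generalize 𝐢 * ⟪x⟫ * 𝐢 = c at h2
  induction h2 using Submodule.span_induction with
  | mem w hw =>
    obtain ⟨l, hl, s, hs, rfl⟩ := hw
    -- Since κ(g)σ(g) = g i, an element g s equals κ(g) times σ(g)s, which is again in S.
    have h3 : ⟪h⟫ * (⟪l⟫ * s) = σ.κ (⟨h, hh⟩ * ⟨l, hl.1⟩) *
        (σ.toFun ((⟨h, hh⟩ * ⟨l, hl.1⟩ : H) : H ⧸ K.subgroupOf H) * s) := by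
      rw [← mul_assoc (σ.κ _), σ.κ_mul_toFun D, mul_assoc, ConjFamily.idem_mul_of_mem_S hs,
        ← mul_assoc, single_mul_single_one]
      rfl
    rw [h3]
    exact σ.κ_mul_mem_span D hS₀ hU (mul_mem hhU (hU hl.2)) (D.S.mul_mem (σ.mem _) hs)
  | zero => simp
  | add a b _ _ ha hb => rw [mul_add]; exact add_mem ha hb
  | smul c a _ ha => rw [mul_smul_comm]; exact Submodule.smul_mem _ _ ha

end

section Corr

variable {U : Subgroup G}

/-- The function `h ↦ n⁻¹ f(κ(h))` on `U ∩ H`. -/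
def corr (f : U → ℂ) : ↥(U ⊓ H) → ℂ := fun x => (D.n : ℂ)⁻¹ * linExt f (σ.κ ⟨x, x.2.2⟩)

theorem corr_add (f g : U → ℂ) : σ.corr D (f + g) = σ.corr D f + σ.corr D g := by
  funext x
  simp only [corr, linExt, Pi.add_apply, mul_add, Finset.sum_add_distrib]

theorem corr_smul (c : ℂ) (f : U → ℂ) : σ.corr D (c • f) = c • σ.corr D f := by
  funext x
  simp only [corr, linExt, Pi.smul_apply, smul_eq_mul, Finset.mul_sum]
  exact Finset.sum_congr rfl fun y _ => by ring

theorem linExt_corr (f : U → ℂ) {a : ℂ[G]} (ha : a ∈ groupAlg ℂ (U ⊓ H)) :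
    linExt (σ.corr D f) a = (D.n : ℂ)⁻¹ * linExt f (σ.κLin a) := by
  induction ha using groupAlg_induction with
  | single x hx =>
    rw [linExt_single_mem _ hx, one_mul, σ.κLin_single ⟨x, hx.2⟩, corr]
  | zero => simp
  | add a b _ _ ha hb => rw [map_add, linExt_add, linExt_add, ha, hb, mul_add]
  | smul c a _ ha => rw [map_smul, linExt_smul, linExt_smul, ha]; ring

variable (hU : K ≤ U) {f : U → ℂ}

include hU

theorem corr_comm (hf : ∀ x y, f (x * y) = f (y * x)) (x y : ↥(U ⊓ H)) :
    σ.corr D f (x * y) = σ.corr D f (y * x) := by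
  simp only [corr]
  congr 1
  have h1 := σ.κ_mul D ⟨x, x.2.2⟩ ⟨y, y.2.2⟩
  have h2 := σ.κ_mul D ⟨y, y.2.2⟩ ⟨x, x.2.2⟩
  exact (congrArg (linExt f) h1).trans ((linExt_mul_comm hf (σ.κ_mem_complex D hU x.2.1) _).trans
    (congrArg (linExt f) h2.symm))

theorem isBlockFun_corr (hf : ∀ x y, f (x * y) = f (y * x)) :
    IsBlockFun (galIdem F φ) (σ.corr D f) where
  comm := σ.corr_comm D hU hf
  absorb x := by
    have h1 : galIdem F φ ∈ groupAlg ℂ (H ⊓ K) := by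
      rw [D.galIdem_phi_eq]
      exact sum_mem fun γ _ => D.eΦ_mem_inf γ
    rw [σ.linExt_corr D f, σ.κLin_mul D (single_mem_groupAlg x.2.2) (groupAlg_mono inf_le_left h1),
      σ.κLin_galIdem D, σ.κLin_mul_idem D, σ.κLin_single ⟨x, x.2.2⟩, corr]
    exact mul_mem (single_mem_groupAlg x.2)
      (groupAlg_mono (le_inf (inf_le_right.trans hU) inf_le_left) h1)

include hS₀

/-- For s = s₀z the factor s₀ commutes with κ(x) and can be moved around cyclically, while z is
central in S. -/
theorem linExt_κ_mul_comm (hf : ∀ x y, f (x * y) = f (y * x)) (x : H) {s t : ℂ[G]} (hs : s ∈ D.S)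
    (ht : t ∈ D.S) : linExt f (σ.κ x * (s * t)) = linExt f (σ.κ x * (t * s)) := by
  have hs' := D.mem_span_of_mem_S hS₀ hs
  clear hs
  induction hs' using Submodule.span_induction with
  | mem w hw =>
    obtain ⟨s, z, hz, rfl⟩ := hw
    have hsU : (s : ℂ[G]) ∈ groupAlg ℂ U :=
      groupAlg_mono hU (ConjFamily.mem_complex_of_mem_S (D.base_mem hS₀ s))
    have h1 : σ.κ x * (s * z * t) = s * (σ.κ x * (z * t)) := by
      rw [← mul_assoc (s : ℂ[G]) (σ.κ x), σ.base_mul_κ D hS₀]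
      simp only [mul_assoc]
    have h2 : σ.κ x * (t * (s * z)) = σ.κ x * (z * t) * s := by
      rw [← mul_assoc t, ← ConjFamily.Z_comm hz (D.S.mul_mem ht (D.base_mem hS₀ s))]
      simp only [mul_assoc]
    rw [h1, h2, linExt_mul_comm hf hsU]
  | zero => simp
  | add a b _ _ ha hb => rw [add_mul, mul_add, linExt_add, ha, hb, mul_add, mul_add, linExt_add]
  | smul c a _ ha =>
    rw [smul_mul_assoc, mul_smul_comm, linExt_smul_of_algebra, ha, mul_smul_comm, mul_smul_comm,
      linExt_smul_of_algebra]

theorem linExt_κ_mul_of_isReducedTrace_one (hf : ∀ x y, f (x * y) = f (y * x)) (x : H) {s₀ : S₀}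
    (h : IsReducedTrace (Subring.center S₀) S₀ s₀ 1) :
    (D.n : ℂ) * linExt f (σ.κ x * s₀) = linExt f (σ.κ x) := by
  have := D.n_mul_map_of_isReducedTrace_one hS₀ h
    ((linForm f).toAddMonoidHom.comp (AddMonoidHom.mulLeft (σ.κ x))) fun s t =>
      σ.linExt_κ_mul_comm D hS₀ hU hf x (D.base_mem hS₀ s) (D.base_mem hS₀ t)
  exact this.trans (congrArg (linExt f) (σ.κ_mul_idem D x))

/-- Cyclically s₀ σ(h)⁻¹ h becomes h s₀ σ(h)⁻¹ = κ(h) σ(h) s₀ σ(h)⁻¹, and the trace function s ↦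
f(κ(h)s) does not see the conjugation by σ(h). -/
theorem corr_eq (hf : ∀ x y, f (x * y) = f (y * x)) {s₀ : S₀}
    (h : IsReducedTrace (Subring.center S₀) S₀ s₀ 1) (x : ↥(U ⊓ H)) :
    σ.corr D f x = linExt f ((s₀ : ℂ[G]) *
      σ.inv ((⟨(x : G), x.2.2⟩ : H) : H ⧸ K.subgroupOf H) * ⟪(x : G)⟫) := by
  set y : H := ⟨(x : G), x.2.2⟩
  have h1 : ⟪(x : G)⟫ * ((s₀ : ℂ[G]) * σ.inv y) = σ.κ y * (σ.toFun y * s₀ * σ.inv y) := by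
    have h2 := σ.κ_mul_toFun D y
    rw [← mul_assoc, ← mul_assoc, ← mul_assoc (σ.κ y), h2, mul_assoc _ 𝐢, D.idem_mul_base hS₀]
  rw [← linExt_mul_comm hf (single_mem_groupAlg x.2.1), h1, mul_assoc,
    σ.linExt_κ_mul_comm D hS₀ hU hf y (σ.mem _) (D.S.mul_mem (D.base_mem hS₀ s₀) (σ.inv_mem _)),
    mul_assoc, σ.inv_mul, D.base_mul_idem hS₀, corr,
    ← σ.linExt_κ_mul_of_isReducedTrace_one D hS₀ hU hf _ h,
    inv_mul_cancel_left₀ D.n_cast_ne]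

end Corr

end MagicCrossedRep

/-! ### The central idempotents e_(θ,F) and e_(φ,F). -/

namespace ConjFamily

variable {G : Type u} [Group G] [Finite G] {F : Subfield ℂ} {H K : Subgroup G} [K.Normal]
  {θ : K → ℂ} {φ : ↥(H ⊓ K) → ℂ} {Γ : Type} [Fintype Γ] (D : ConjFamily F H K θ φ Γ)

local notation "𝐢" => idem F θ φ

include D

theorem galIdem_phi_mem : galIdem F φ ∈ groupAlg ℂ (H ⊓ K) := by
  rw [D.galIdem_phi_eq]
  exact sum_mem fun γ _ => D.eΦ_mem_inf γ

theorem galIdem_phi_mul_self : galIdem F φ * galIdem F φ = galIdem F φ := by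
  rw [D.galIdem_phi_eq, Finset.sum_mul]
  refine Finset.sum_congr rfl fun γ _ => ?_
  rw [Finset.mul_sum, Finset.sum_eq_single γ, D.eΦ_mul_self]
  · exact fun δ _ h => D.eΦ_mul_ne h.symm
  · simp

theorem galIdem_theta_mul_self : galIdem F θ * galIdem F θ = galIdem F θ := by
  rw [D.galIdem_theta_eq, Finset.sum_mul]
  refine Finset.sum_congr rfl fun γ _ => ?_
  rw [Finset.mul_sum, Finset.sum_eq_single γ, D.eΘ_mul_self]
  · exact fun δ _ h => D.eΘ_mul_ne h.symm
  · simp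

theorem galIdem_theta_eq_smul : galIdem F θ =
    (θ 1 / (Nat.card K * D.n * φ 1) : ℂ) • conjSum K 𝐢 := by
  have h1 := D.theta_ne
  have h2 := D.phi_ne
  have h3 := D.n_cast_ne
  have h4 := IsCharLike.card_ne_zero K
  rw [D.galIdem_theta_eq_conjSum, smul_smul]
  have : (θ 1 / (Nat.card K * D.n * φ 1) : ℂ) * (Nat.card K * D.n * φ 1 / θ 1) = 1 := by
    field_simp
  rw [this, one_smul]

theorem exists_theta_one : ∃ m : ℕ, θ 1 = m := by
  obtain ⟨γ⟩ := D.nonempty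
  obtain ⟨m, -, hm⟩ := (D.irrΘ γ).deg
  exact ⟨m, by rw [← hm, D.Θ_one]⟩

theorem exists_phi_one : ∃ m : ℕ, φ 1 = m := by
  obtain ⟨γ⟩ := D.nonempty
  obtain ⟨m, -, hm⟩ := (D.irrΦ γ).deg
  exact ⟨m, by rw [← hm, D.Φ_one]⟩

theorem exists_galIdem_theta_eq_smul : ∃ c : F, galIdem F θ = c • conjSum K 𝐢 := by
  obtain ⟨a, ha⟩ := D.exists_theta_one
  obtain ⟨b, hb⟩ := D.exists_phi_one
  refine ⟨(a / (Nat.card K * D.n * b) : F), ?_⟩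
  rw [D.galIdem_theta_eq_smul, ha, hb, ← algebraMap_smul (A := ℂ) (_ : F)]
  congr 1

theorem galIdem_theta_mem : galIdem F θ ∈ groupAlg F K := by
  obtain ⟨c, hc⟩ := D.exists_galIdem_theta_eq_smul
  rw [hc]
  exact Subalgebra.smul_mem _ (conjSum_mem le_rfl D.idem_mem) _

theorem galIdem_theta_mem_complex {U : Subgroup G} (hU : K ≤ U) :
    galIdem F θ ∈ groupAlg ℂ U :=
  groupAlg_mono hU (mem_groupAlg_complex D.galIdem_theta_mem)

theorem mem_irrSpan_theta (hG : ∀ g : G, ∃ h ∈ H, ∃ k ∈ K, g = h * k) {U : Subgroup G}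
    (hU : K ≤ U) {f : U → ℂ} : f ∈ irrSpan U (galIdem F θ) ↔ IsBlockFun (galIdem F θ) f :=
  mem_irrSpan_iff (D.galIdem_theta_mem_complex hU)
    (fun u _ => (D.single_mul_galIdem_theta hG u).symm) D.galIdem_theta_mul_self

theorem galIdem_phi_mem_complex {U : Subgroup G} (hU : K ≤ U) :
    galIdem F φ ∈ groupAlg ℂ (U ⊓ H) :=
  groupAlg_mono (le_inf (inf_le_right.trans hU) inf_le_left) D.galIdem_phi_mem

theorem mem_irrSpan_phi {U : Subgroup G} (hU : K ≤ U) {f : ↥(U ⊓ H) → ℂ} :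
    f ∈ irrSpan (U ⊓ H) (galIdem F φ) ↔ IsBlockFun (galIdem F φ) f :=
  mem_irrSpan_iff (D.galIdem_phi_mem_complex hU)
    (fun _ hu => (D.single_mul_galIdem_phi hu.2).symm) D.galIdem_phi_mul_self

end ConjFamily

/-! ### Degrees, fields of values and injectivity. -/

namespace MagicCrossedRep

variable {G : Type u} [Group G] [Finite G] {F : Subfield ℂ} {H K : Subgroup G} [K.Normal]
  {θ : K → ℂ} {φ : ↥(H ⊓ K) → ℂ} {S₀ : CornerSubalgebra F ℂ[G]} (σ : MagicCrossedRep F θ φ S₀)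
  {Γ : Type} [Fintype Γ] (D : ConjFamily F H K θ φ Γ) (hS₀ : IsBaseSubalgebra F θ φ S₀)
  (hG : ∀ g : G, ∃ h ∈ H, ∃ k ∈ K, g = h * k)
  {U : Subgroup G} (hU : K ≤ U) {f : U → ℂ}

local notation "𝐢" => idem F θ φ

theorem corr_one : σ.corr D f 1 = (D.n : ℂ)⁻¹ * linExt f 𝐢 := by
  have h := σ.κ_one D
  exact congrArg (fun a => (D.n : ℂ)⁻¹ * linExt f a) h

include hU

/-- f(1) is f(e_(θ,F)), a known multiple of f(i), and f(i) is n times the value of `corr` at 1. -/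
theorem degree_corr (hf : IsBlockFun (galIdem F θ) f) : f 1 / θ 1 = σ.corr D f 1 / φ 1 := by
  have h1 := D.theta_ne
  have h2 := D.phi_ne
  have h3 := D.n_cast_ne
  have h4 := IsCharLike.card_ne_zero K
  have h : f 1 = θ 1 / (Nat.card K * D.n * φ 1) * (Nat.card K * linExt f 𝐢) := by
    have := hf.absorb 1
    rw [← this, OneMemClass.coe_one, ← MonoidAlgebra.one_def, one_mul, D.galIdem_theta_eq_smul,
      linExt_smul, linExt_conjSum hf.comm hU]
  rw [h, σ.corr_one]
  field_simp

include hS₀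

/-- The trace function in t depends only on the trace of t over Z₀, which may be written a i with a
in FL; and κ(x) l i = κ(xl). -/
theorem linExt_κ_mul_base_mem (hf : ∀ x y, f (x * y) = f (y * x)) {x : H} (hx : (x : G) ∈ U)
    (t : S₀) : linExt f (σ.κ x * t) ∈ Submodule.span F (Set.range (σ.corr D f)) := by
  have hn := D.n_cast_ne
  have hc := (D.mem_center_iff hS₀ _).1
    (LinearMap.trace (Subring.center S₀) S₀ (LinearMap.mulLeft _ t)).2
  have h1 := D.finrank_mul_map hS₀ ((linForm f).toAddMonoidHom.comp (AddMonoidHom.mulLeft (σ.κ x)))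
    (fun s t => σ.linExt_κ_mul_comm D hS₀ hU hf x (D.base_mem hS₀ s) (D.base_mem hS₀ t)) t
  rw [D.finrank_center_base hS₀] at h1
  replace h1 : ((D.n ^ 2 : ℕ) : ℂ) * linExt f (σ.κ x * t) = linExt f (σ.κ x * _) := h1
  obtain ⟨a, ha, hza⟩ := ConjFamily.exists_eq_mul_idem_of_mem_Z hc.1
  rw [hza] at h1
  have h2 : linExt f (σ.κ x * (a * 𝐢)) ∈ Submodule.span F (Set.range (σ.corr D f)) := by
    clear h1 hza
    induction ha using groupAlg_induction with
    | single l hl =>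
      have h3 := σ.κ_mul D x ⟨l, hl.1⟩
      rw [σ.κ_of_mem D (x := ⟨l, hl.1⟩) hl.2] at h3
      have h4 : linExt f (σ.κ x * (⟪l⟫ * 𝐢)) =
          (D.n : F) • σ.corr D f ⟨x * l, mul_mem hx (hU hl.2), mul_mem x.2 hl.1⟩ := by
        rw [← h3, ← algebraMap_smul (A := ℂ) (D.n : F), smul_eq_mul, map_natCast, corr,
          mul_inv_cancel_left₀ hn]
        rfl
      rw [h4]
      exact Submodule.smul_mem _ _ (Submodule.subset_span ⟨_, rfl⟩)
    | zero => simp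
    | add a b _ _ ha hb => rw [add_mul, mul_add, linExt_add]; exact add_mem ha hb
    | smul c a _ ha =>
      rw [smul_mul_assoc, mul_smul_comm, linExt_smul_of_algebra, ← smul_eq_mul, algebraMap_smul]
      exact Submodule.smul_mem _ _ ha
  have h5 : linExt f (σ.κ x * t) = ((D.n ^ 2 : ℕ) : F)⁻¹ • linExt f (σ.κ x * (a * 𝐢)) := by
    rw [← h1, ← algebraMap_smul (A := ℂ) ((D.n ^ 2 : ℕ) : F)⁻¹, smul_eq_mul, map_inv₀, map_natCast,
      inv_mul_cancel_left₀]
    exact_mod_cast pow_ne_zero 2 hn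
  rw [h5]
  exact Submodule.smul_mem _ _ h2

include hG

/-- The values of `f` are `F`-linear combinations of those of `corr f`. -/
theorem mem_span_range_corr (hf : IsBlockFun (galIdem F θ) f) (y : U) :
    f y ∈ Submodule.span F (Set.range (σ.corr D f)) := by
  -- Writing e_(θ,F) as a sum of conjugates x i x⁻¹ turns f(y) into a sum of values on the corner
  -- elements i (x⁻¹yx) i.
  obtain ⟨c, hc⟩ := D.exists_galIdem_theta_eq_smul
  rw [← hf.absorb y, hc, mul_smul_comm, linExt_smul_of_algebra, ← smul_eq_mul, algebraMap_smul,
    conjSum_apply, Finset.mul_sum, linExt_sum]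
  refine Submodule.smul_mem _ _ (sum_mem fun x _ => ?_)
  have hi : 𝐢 ∈ groupAlg ℂ U := groupAlg_mono hU D.idem_mem_complex
  have h1 : linExt f (⟪(y : G)⟫ * (⟪(x : G)⟫ * 𝐢 * ⟪(x : G)⁻¹⟫)) =
      linExt f (𝐢 * ⟪(x : G)⁻¹ * y * x⟫ * 𝐢) := by
    rw [← mul_assoc, ← linExt_mul_comm hf.comm
      (single_mem_groupAlg (InvMemClass.inv_mem (hU x.2))), ← mul_assoc, ← mul_assoc,
      single_mul_single_one, single_mul_single_one, mul_assoc 𝐢, linExt_mul_comm hf.comm hi,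
      mul_assoc _ 𝐢 𝐢, D.idem_mul_self, mul_assoc]
  rw [h1]
  have h2 := σ.corner_mem_span D hS₀ hU hG
    (mul_mem (mul_mem (InvMemClass.inv_mem (hU x.2)) y.2) (hU x.2))
  generalize 𝐢 * ⟪(x : G)⁻¹ * y * x⟫ * 𝐢 = a at h2
  induction h2 using Submodule.span_induction with
  | mem a ha =>
    obtain ⟨z, hz, t, rfl⟩ := ha
    exact σ.linExt_κ_mul_base_mem D hS₀ hU hf.comm hz t
  | zero => simp
  | add a b _ _ ha hb => rw [linExt_add]; exact add_mem ha hb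
  | smul c a _ ha =>
    rw [linExt_smul_of_algebra, ← smul_eq_mul, algebraMap_smul]
    exact Submodule.smul_mem _ _ ha

theorem eq_zero_of_corr_eq_zero (hf : IsBlockFun (galIdem F θ) f) (h : σ.corr D f = 0) :
    f = 0 := by
  funext y
  have := σ.mem_span_range_corr D hS₀ hG hU hf y
  rw [h] at this
  refine (Submodule.mem_bot F).1 (Submodule.span_le.2 ?_ this)
  rintro _ ⟨x, rfl⟩
  exact (Submodule.mem_bot F).2 rfl

theorem valueField_corr (hf : IsBlockFun (galIdem F θ) f) :
    valueField F f = valueField F (σ.corr D f) := by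
  apply le_antisymm
  · refine IntermediateField.adjoin_le_iff.2 ?_
    rintro _ ⟨y, rfl⟩
    have h : Submodule.span F (Set.range (σ.corr D f)) ≤
        Subalgebra.toSubmodule (valueField F (σ.corr D f)).toSubalgebra := by
      refine Submodule.span_le.2 ?_
      exact IntermediateField.subset_adjoin _ _
    exact h (σ.mem_span_range_corr D hS₀ hG hU hf y)
  · refine IntermediateField.adjoin_le_iff.2 ?_
    rintro _ ⟨y, rfl⟩
    refine mul_mem (InvMemClass.inv_mem (natCast_mem _ _)) ?_
    have h2 : σ.κ ⟨y, y.2.2⟩ ∈ groupAlg (valueField F f) U := by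
      have h1 := σ.κ_mem D hU y.2.1 (x := ⟨y, y.2.2⟩)
      rw [mem_groupAlg_iff] at h1 ⊢
      refine ⟨h1.1, fun x hx => ?_⟩
      obtain ⟨c, hc⟩ := h1.2 x hx
      exact ⟨algebraMap F _ c, hc⟩
    obtain ⟨c, hc⟩ := linExt_mem_of_mem (k := valueField F f) (χ := f)
      (fun x => ⟨⟨f x, IntermediateField.subset_adjoin _ _ ⟨x, rfl⟩⟩, rfl⟩) ⟨U, h2⟩
    rw [← hc]
    exact c.2

end MagicCrossedRep

/-! ### Counting cosets, and the regular character of a block. -/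

section

variable {G : Type u} [Group G] [Finite G]

/-- Count pairs (y, g) in V × (V ∩ H) with y g⁻¹ in K: each g has |K| partners, and each y has |L|
because V = (V ∩ H)K. The function is the same at both members of a pair. -/
theorem card_mul_sum_inf {H K V : Subgroup G} [K.Normal]
    (hG : ∀ g : G, ∃ h ∈ H, ∃ k ∈ K, g = h * k) (hV : K ≤ V) {f : G → ℂ}
    (hf : ∀ k ∈ K, ∀ x, f (k * x) = f x) :
    (Nat.card K : ℂ) * ∑ g : ↥(V ⊓ H), f g = Nat.card ↥(H ⊓ K) * ∑ y : V, f y := by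
  have h1 : ∀ g : ↥(V ⊓ H), (Nat.card K : ℂ) * f g =
      ∑ y : V, Set.indicator {z : G | z * (g : G)⁻¹ ∈ K} f y := by
    intro g
    have h2 : ∑ k : K, f (k * g) =
        ∑ y : V, Set.indicator {z : G | z * (g : G)⁻¹ ∈ K} f y := by
      refine Fintype.sum_of_injective (fun k : K => (⟨k * g, mul_mem (hV k.2) g.2.1⟩ : V)) ?_
        (fun k : K => f (k * g)) (fun y : V => Set.indicator {z : G | z * (g : G)⁻¹ ∈ K} f y) ?_ ?_
      · exact fun k l h => Subtype.ext (mul_right_cancel (congrArg Subtype.val h))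
      · intro y hy
        refine Set.indicator_of_notMem (s := {z : G | z * (g : G)⁻¹ ∈ K})
          (fun h => hy ⟨⟨(y : G) * (g : G)⁻¹, h⟩, Subtype.ext ?_⟩) f
        simp
      · intro k
        refine (Set.indicator_of_mem (s := {z : G | z * (g : G)⁻¹ ∈ K}) ?_ f).symm
        simp
    rw [← h2, Finset.sum_congr rfl fun (k : K) _ => hf k k.2 g, Finset.sum_const, Finset.card_univ,
      ← Nat.card_eq_fintype_card, nsmul_eq_mul]
  have h3 : ∀ y : V, (Nat.card ↥(H ⊓ K) : ℂ) * f y =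
      ∑ g : ↥(V ⊓ H), Set.indicator {z : G | z * (g : G)⁻¹ ∈ K} f y := by
    intro y
    obtain ⟨h, hh, x, hx, hy⟩ := hG y
    have hhV : h ∈ V := by
      have := mul_mem y.2 (inv_mem (hV hx))
      rwa [hy, mul_inv_cancel_right] at this
    have hyh : (y : G) * h⁻¹ ∈ K := by
      rw [hy]
      exact ‹K.Normal›.conj_mem x hx h
    have h2 : ∑ _l : ↥(H ⊓ K), f y =
        ∑ g : ↥(V ⊓ H), Set.indicator {z : G | z * (g : G)⁻¹ ∈ K} f y := by
      refine Fintype.sum_of_injective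
        (fun l => ⟨l * h, mul_mem (hV l.2.2) hhV, mul_mem l.2.1 hh⟩) ?_ _ _ ?_ ?_
      · exact fun k l h => Subtype.ext (mul_right_cancel (congrArg Subtype.val h))
      · intro g hg
        refine Set.indicator_of_notMem (fun h1 => hg ⟨⟨g * h⁻¹, ?_⟩, Subtype.ext ?_⟩) _
        · refine ⟨H.mul_mem g.2.2 (H.inv_mem hh), ?_⟩
          have h3 : (y : G) * (g : G)⁻¹ ∈ K := h1
          have := mul_mem (inv_mem h3) hyh
          simpa [mul_assoc] using this
        · simp
      · intro l
        refine (Set.indicator_of_mem (s := {z : G | z * ((l : G) * h)⁻¹ ∈ K}) ?_ f).symm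
        have := mul_mem hyh (inv_mem l.2.2)
        simpa [mul_assoc] using this
    rw [← h2, Finset.sum_const, Finset.card_univ, ← Nat.card_eq_fintype_card, nsmul_eq_mul]
  rw [Finset.mul_sum, Finset.mul_sum, Finset.sum_congr rfl fun g _ => h1 g,
    Finset.sum_congr rfl fun y _ => h3 y, Finset.sum_comm]

theorem card_mul_card_inf {H K V : Subgroup G} [K.Normal]
    (hG : ∀ g : G, ∃ h ∈ H, ∃ k ∈ K, g = h * k) (hV : K ≤ V) :
    (Nat.card K : ℂ) * Nat.card ↥(V ⊓ H) = Nat.card ↥(H ⊓ K) * Nat.card V := by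
  have := card_mul_sum_inf hG hV (f := fun _ => 1) fun _ _ _ => rfl
  simpa only [Finset.sum_const, Finset.card_univ, ← Nat.card_eq_fintype_card, nsmul_eq_mul,
    mul_one] using this

variable {U : Subgroup G}

/-- The part of the regular character of `U` that belongs to `e`, up to the factor `|U|`. -/
def blockReg (U : Subgroup G) (e : ℂ[G]) : U → ℂ := fun x => (⟪(x : G)⟫ * e).coeff 1

theorem linExt_blockReg (e : ℂ[G]) {a : ℂ[G]} (ha : a ∈ groupAlg ℂ U) :
    linExt (blockReg U e) a = (a * e).coeff 1 := by
  induction ha using groupAlg_induction with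
  | single x hx => rw [linExt_single_mem _ hx, one_mul, blockReg]
  | zero => simp
  | add a b _ _ ha hb => rw [linExt_add, ha, hb, add_mul]; rfl
  | smul c a _ ha => rw [linExt_smul, ha, smul_mul_assoc]; rfl

theorem blockReg_comm {e : ℂ[G]} (hcen : ∀ u ∈ U, e * ⟪u⟫ = ⟪u⟫ * e) (x y : U) :
    blockReg U e (x * y) = blockReg U e (y * x) := by
  have h : ⟪((y * x : U) : G)⟫ * e = ⟪(y : G)⟫ * (⟪((x * y : U) : G)⟫ * e) * ⟪(y : G)⁻¹⟫ := by
    rw [mul_assoc, mul_assoc ⟪((x * y : U) : G)⟫, hcen _ (inv_mem y.2), ← mul_assoc ⟪_⟫ ⟪_⟫ e,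
      single_mul_single_one, ← mul_assoc, single_mul_single_one]
    simp [mul_assoc]
  rw [blockReg, blockReg, h]
  simp [MonoidAlgebra.coeff_single_mul_apply, MonoidAlgebra.coeff_mul_single_apply]

theorem blockReg_eq_sum {e : ℂ[G]} (he : e ∈ groupAlg ℂ U)
    (hcen : ∀ u ∈ U, e * ⟪u⟫ = ⟪u⟫ * e) :
    blockReg U e = ∑ χ ∈ irrFinset U, (linExt χ e / Nat.card U) • χ := by
  rw [classFun_eq_sum_charIdem (blockReg_comm hcen)]
  refine Finset.sum_congr rfl fun χ hχ => ?_
  have hχ' := (mem_irrFinset.1 hχ).isCharLike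
  rw [linExt_blockReg e (charIdem_mem_groupAlg χ), ← charIdem_mul_comm hχ'.comm he,
    coeff_one_mul_charIdem]
  congr 1
  have := hχ'.one_ne_zero
  field_simp

theorem IsIrrChar.eq_of_smul_eq {Γ : Type*} [Group Γ] [Finite Γ] {χ ψ : Γ → ℂ} (hχ : IsIrrChar χ)
    (hψ : IsIrrChar ψ) {a b : ℂ} (ha : a ≠ 0) (h : a • χ = b • ψ) : χ = ψ := by
  by_contra hne
  have h1 := hψ.sum_mul_inv_eq_zero hχ (Ne.symm hne)
  have h2 : a * ∑ x, χ x * χ x⁻¹ = b * ∑ x, ψ x * χ x⁻¹ := by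
    rw [Finset.mul_sum, Finset.mul_sum]
    refine Finset.sum_congr rfl fun x _ => ?_
    have := congrFun h x
    simp only [Pi.smul_apply, smul_eq_mul] at this
    rw [← mul_assoc, this, mul_assoc]
  rw [h1, mul_zero, hχ.isCharLike.norm] at h2
  refine (mul_eq_zero.1 h2).elim ha ?_
  exact_mod_cast Nat.card_pos.ne'

end

/-! ### Images of irreducible characters are multiples of irreducible characters. -/

namespace MagicCrossedRep

variable {G : Type u} [Group G] [Finite G] {F : Subfield ℂ} {H K : Subgroup G} [K.Normal]
  {θ : K → ℂ} {φ : ↥(H ⊓ K) → ℂ} {S₀ : CornerSubalgebra F ℂ[G]} (σ : MagicCrossedRep F θ φ S₀)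
  {Γ : Type} [Fintype Γ] (D : ConjFamily F H K θ φ Γ) (hS₀ : IsBaseSubalgebra F θ φ S₀)
  (hG : ∀ g : G, ∃ h ∈ H, ∃ k ∈ K, g = h * k)
  {U : Subgroup G} (hU : K ≤ U)

local notation "𝐢" => idem F θ φ

theorem coeff_one_single_mul_eq_zero {V : Subgroup G} {x : G} (hx : x ∉ V) {a : ℂ[G]}
    (ha : a ∈ groupAlg ℂ V) : (⟪x⟫ * a).coeff 1 = 0 := by
  rw [MonoidAlgebra.coeff_single_mul_apply, one_mul, mul_one]
  exact coeff_eq_zero_of_mem ha fun h => hx (by simpa using InvMemClass.inv_mem h)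

/-- `corr` as a linear map. -/
def corrLin (U : Subgroup G) : (U → ℂ) →ₗ[ℂ] (↥(U ⊓ H) → ℂ) where
  toFun := σ.corr D
  map_add' := σ.corr_add D
  map_smul' := σ.corr_smul D

include hU

/-- κ(h) has support in hK, so its coefficient at 1 vanishes unless h lies in L, where κ(h) = h i
and the components can be compared one by one. -/
theorem corr_blockReg : σ.corr D (blockReg U (galIdem F θ)) =
    (θ 1 * Nat.card ↥(H ⊓ K) / (φ 1 * Nat.card K) : ℂ) •
      blockReg (U ⊓ H) (galIdem F φ) := by
  funext x
  have h1 := D.theta_ne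
  have h2 := D.phi_ne
  have h3 := D.n_cast_ne
  have h4 := IsCharLike.card_ne_zero K
  have h5 := IsCharLike.card_ne_zero (H ⊓ K)
  set y : H := ⟨x, x.2.2⟩
  have hκ : σ.κ y * galIdem F θ = σ.κ y := by
    rw [← σ.κ_mul_idem D, mul_assoc, D.idem_mul_galIdem_theta]
  rw [Pi.smul_apply, corr, linExt_blockReg _ (σ.κ_mem_complex D hU x.2.1), hκ, blockReg]
  by_cases hx : (x : G) ∈ K
  · have hxL : (x : G) ∈ H ⊓ K := ⟨x.2.2, hx⟩
    have hl : ⟪(x : G)⟫ ∈ groupAlg ℂ (H ⊓ K) := single_mem_groupAlg hxL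
    have hA : (⟪(x : G)⟫ * 𝐢).coeff 1 =
        ∑ γ, θ 1 / Nat.card K * (D.n * D.Φ γ ⟨x, hxL⟩) := by
      rw [D.idem_eq_sum, Finset.mul_sum]
      rw [MonoidAlgebra.coeff_sum, Finsupp.finsetSum_apply]
      refine Finset.sum_congr rfl fun γ _ => ?_
      rw [ConjFamily.f, ← mul_assoc, ConjFamily.eΘ, coeff_one_mul_charIdem, D.Θ_one,
        ← D.linExt_mul_idem, D.linExt_inf_mul_idem γ hl, linExt_single_mem _ hxL, one_mul]
    have hB : (⟪(x : G)⟫ * galIdem F φ).coeff 1 =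
        ∑ γ, φ 1 / Nat.card ↥(H ⊓ K) * D.Φ γ ⟨x, hxL⟩ := by
      rw [D.galIdem_phi_eq, Finset.mul_sum]
      rw [MonoidAlgebra.coeff_sum, Finsupp.finsetSum_apply]
      refine Finset.sum_congr rfl fun γ _ => ?_
      rw [ConjFamily.eΦ, coeff_one_mul_charIdem, D.Φ_one, linExt_single_mem _ hxL, one_mul]
    rw [σ.κ_of_mem D hx, hA, hB, smul_eq_mul, Finset.mul_sum, Finset.mul_sum]
    refine Finset.sum_congr rfl fun γ _ => ?_
    field_simp
  · rw [coeff_one_single_mul_eq_zero (V := H ⊓ K) (fun h => hx h.2) D.galIdem_phi_mem, κ,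
      coeff_one_single_mul_eq_zero (V := K) hx (mem_groupAlg_complex (σ.inv_mem_groupAlg D _)),
      smul_zero, mul_zero]

include D hS₀ hG

/-- The image κ(b) commutes with κ(U ∩ H) because b is central, and with S₀ because all of κ does;
together these span the corner. -/
theorem κLin_comm_corner {b : ℂ[G]} (hb : b ∈ groupAlg ℂ (U ⊓ H))
    (hcen : ∀ z ∈ U ⊓ H, b * ⟪z⟫ = ⟪z⟫ * b) {y : G} (hy : y ∈ U) :
    σ.κLin b * (𝐢 * ⟪y⟫ * 𝐢) = 𝐢 * ⟪y⟫ * 𝐢 * σ.κLin b := by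
  have h := σ.corner_mem_span D hS₀ hU hG hy
  generalize 𝐢 * ⟪y⟫ * 𝐢 = a at h
  have hbH : b ∈ groupAlg ℂ H := groupAlg_mono inf_le_right hb
  induction h using Submodule.span_induction with
  | mem a ha =>
    obtain ⟨z, hz, t, rfl⟩ := ha
    have h1 := congrArg σ.κLin (hcen z ⟨hz, z.2⟩)
    rw [σ.κLin_mul D hbH (single_mem_groupAlg z.2), σ.κLin_mul D (single_mem_groupAlg z.2) hbH,
      σ.κLin_single] at h1
    rw [← mul_assoc, h1, mul_assoc, mul_assoc, σ.base_mul_κLin D hS₀]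
  | zero => simp
  | add a b _ _ ha hb => rw [mul_add, add_mul, ha, hb]
  | smul c a _ ha => rw [mul_smul_comm, smul_mul_assoc, ha]

variable {χ : U → ℂ} (hχ : χ ∈ irrOver U (galIdem F θ))

include hχ

omit hS₀ in
theorem isBlockFun_of_mem_irrOver : IsBlockFun (galIdem F θ) χ :=
  (D.mem_irrSpan_theta hG hU).1 (Submodule.subset_span hχ)

omit hS₀ in
theorem corr_one_ne_zero : σ.corr D χ 1 ≠ 0 := by
  intro h
  have h1 := σ.degree_corr D hU (isBlockFun_of_mem_irrOver D hG hU hχ)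
  rw [h, zero_div, div_eq_zero_iff] at h1
  exact h1.elim hχ.1.isCharLike.one_ne_zero D.theta_ne

/-- If an irreducible character occurs in `corr χ`, then `corr χ` is a multiple of it. -/
theorem corr_eq_smul_of_ne {ψ : ↥(U ⊓ H) → ℂ} (hψ : IsIrrChar ψ)
    (h : linExt (σ.corr D χ) (charIdem ψ) ≠ 0) :
    ∃ c : ℂ, c ≠ 0 ∧ σ.corr D χ = c • ψ := by
  have hc := hχ.1.isCharLike
  have hψ' := hψ.isCharLike
  have hi : linExt χ 𝐢 ≠ 0 := by
    have := σ.corr_one_ne_zero D hG hU hχ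
    rw [σ.corr_one D] at this
    exact right_ne_zero_of_mul this
  have hpsi := charIdem_mem_groupAlg ψ
  -- By Schur's lemma for the corner, κ(e_ψ) is a scalar multiple of i on the χ-part; the scalar is
  -- nonzero because ψ occurs.
  have h1 := hc.smul_mul_charIdem_of_comm_corner (groupAlg_mono hU D.idem_mem_complex)
    (σ.κLin_mem D hU hpsi) (σ.idem_mul_κLin D _) (σ.κLin_mul_idem D _)
    (fun y hy => σ.κLin_comm_corner D hS₀ hG hU hpsi hψ'.charIdem_central hy)
  have h2 : linExt χ (σ.κLin (charIdem ψ)) ≠ 0 := by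
    rw [σ.linExt_corr D χ hpsi] at h
    exact right_ne_zero_of_mul h
  refine ⟨linExt (σ.corr D χ) (charIdem ψ) / ψ 1, div_ne_zero h hψ'.one_ne_zero, ?_⟩
  conv_lhs => rw [classFun_eq_sum_charIdem (σ.corr_comm D hU hc.comm)]
  refine Finset.sum_eq_single ψ (fun ψ' hψ1 hne => ?_) fun h => absurd (mem_irrFinset.2 hψ) h
  have h3 := charIdem_mem_groupAlg ψ'
  -- Multiplying by κ(e_ψ') gives zero on one side, by orthogonality, and a nonzero multiple of
  -- κ(e_ψ')e_χ on the other.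
  have h4 : σ.κLin (charIdem ψ') * charIdem χ = 0 := by
    have h5 := congrArg (fun a => σ.κLin (charIdem ψ') * a) h1
    simp only [mul_smul_comm, ← mul_assoc] at h5
    rw [← σ.κLin_mul D (groupAlg_mono inf_le_right h3) (groupAlg_mono inf_le_right hpsi),
      (mem_irrFinset.1 hψ1).isCharLike.charIdem_mul_eq_zero hψ' hne, map_zero, zero_mul, smul_zero,
      σ.κLin_mul_idem D] at h5
    exact (smul_eq_zero.1 h5.symm).resolve_left h2
  rw [σ.linExt_corr D χ h3, ← hc.linExt_mul_charIdem, h4, linExt_zero, mul_zero, zero_div, zero_smul]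

end MagicCrossedRep

theorem eq_one_of_mul_self_eq_one {c : ℂ} {a b : ℕ} (hb : (b : ℂ) ≠ 0) (hc : c = a / b)
    (h : c * c = 1) : c = 1 := by
  refine (mul_self_eq_one_iff.1 h).resolve_right fun h1 => ?_
  have h2 : (a : ℂ) + b = 0 := by
    rw [h1, eq_div_iff hb] at hc
    linear_combination -hc
  have h3 : a + b = 0 := by exact_mod_cast h2
  exact hb (by rw [(Nat.add_eq_zero_iff.1 h3).2, Nat.cast_zero])

/-! ### The bijection of irreducible characters and the isometry. -/

namespace MagicCrossedRep

variable {G : Type u} [Group G] [Finite G] {F : Subfield ℂ} {H K : Subgroup G} [K.Normal]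
  {θ : K → ℂ} {φ : ↥(H ⊓ K) → ℂ} {S₀ : CornerSubalgebra F ℂ[G]} (σ : MagicCrossedRep F θ φ S₀)
  {Γ : Type} [Fintype Γ] (D : ConjFamily F H K θ φ Γ) (hS₀ : IsBaseSubalgebra F θ φ S₀)
  (hG : ∀ g : G, ∃ h ∈ H, ∃ k ∈ K, g = h * k)
  {U : Subgroup G} (hU : K ≤ U)

local notation "𝐢" => idem F θ φ

include hU in
-- Both sides compute the ψ-part of the image of the regular character of the θ-block: through its
-- decomposition into irreducibles, and through `corr_blockReg`.
theorem sum_mul_linExt_corr (hG : ∀ g : G, ∃ h ∈ H, ∃ k ∈ K, g = h * k) {ψ : ↥(U ⊓ H) → ℂ}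
    (hψ : IsIrrChar ψ) :
    ∑ χ ∈ irrFinset U, linExt χ (galIdem F θ) * linExt (σ.corr D χ) (charIdem ψ) =
      θ 1 / φ 1 * (ψ 1 * linExt ψ (galIdem F φ)) := by
  have h2 := D.phi_ne
  have h4 := IsCharLike.card_ne_zero K
  have h5 := IsCharLike.card_ne_zero U
  have h6 := IsCharLike.card_ne_zero (U ⊓ H)
  have h1 := congrArg (fun f => linExt (σ.corr D f) (charIdem ψ))
    (blockReg_eq_sum (D.galIdem_theta_mem_complex hU)
      (fun u _ => (D.single_mul_galIdem_theta hG u).symm))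
  have hl : ∀ f : U → ℂ, linExt (σ.corr D f) (charIdem ψ) =
      ((Fintype.linearCombination ℂ fun x : ↥(U ⊓ H) => (charIdem ψ).coeff (x : G)) ∘ₗ
        σ.corrLin D U) f := by
    intro f
    rw [LinearMap.comp_apply, Fintype.linearCombination_apply, linExt]
    exact Finset.sum_congr rfl fun x _ => mul_comm _ _
  have h3 : linExt (σ.corr D (∑ χ ∈ irrFinset U, (linExt χ (galIdem F θ) / Nat.card U) • χ))
      (charIdem ψ) = ∑ χ ∈ irrFinset U, (linExt χ (galIdem F θ) / Nat.card U) *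
        linExt (σ.corr D χ) (charIdem ψ) := by
    simp only [hl]
    rw [map_sum]
    exact Finset.sum_congr rfl fun χ _ => by rw [map_smul, smul_eq_mul]
  have h7 : ∀ (c : ℂ) (f : ↥(U ⊓ H) → ℂ) (a : ℂ[G]), linExt (c • f) a = c * linExt f a := by
    intro c f a
    rw [linExt, linExt, Finset.mul_sum]
    exact Finset.sum_congr rfl fun x _ => by rw [Pi.smul_apply, smul_eq_mul]; ring
  rw [h3, σ.corr_blockReg D hU, h7, linExt_blockReg _ (charIdem_mem_groupAlg ψ),
    ← charIdem_mul_comm hψ.isCharLike.comm (D.galIdem_phi_mem_complex hU),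
    coeff_one_mul_charIdem] at h1
  have h8 : ∑ χ ∈ irrFinset U, linExt χ (galIdem F θ) * linExt (σ.corr D χ) (charIdem ψ) =
      Nat.card U * ∑ χ ∈ irrFinset U, (linExt χ (galIdem F θ) / Nat.card U) *
        linExt (σ.corr D χ) (charIdem ψ) := by
    rw [Finset.mul_sum]
    exact Finset.sum_congr rfl fun χ _ => by field_simp
  rw [h8, ← h1]
  have h9 := card_mul_card_inf hG hU
  field_simp
  linear_combination (-θ 1 * ψ 1 * linExt ψ (galIdem F φ)) * h9

include hS₀ hG

theorem corr_injOn {f g : U → ℂ} (hf : f ∈ irrSpan U (galIdem F θ))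
    (hg : g ∈ irrSpan U (galIdem F θ)) (h : σ.corr D f = σ.corr D g) (hU : K ≤ U) : f = g := by
  refine sub_eq_zero.1 (σ.eq_zero_of_corr_eq_zero D hS₀ hG hU
    ((D.mem_irrSpan_theta hG hU).1 (sub_mem hf hg)) ?_)
  exact (map_sub (σ.corrLin D U) f g).trans (sub_eq_zero.2 h)

include hU

theorem eq_of_corr_eq_smul {χ χ' : U → ℂ} (hχ : χ ∈ irrOver U (galIdem F θ))
    (hχ' : χ' ∈ irrOver U (galIdem F θ)) {ψ : ↥(U ⊓ H) → ℂ} {a b : ℂ} (hb : b ≠ 0)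
    (h : σ.corr D χ = a • ψ) (h' : σ.corr D χ' = b • ψ) : χ = χ' := by
  refine hχ.1.eq_of_smul_eq hχ'.1 hb (b := a) ?_
  refine σ.corr_injOn D hS₀ hG (Submodule.smul_mem _ _ (Submodule.subset_span hχ))
    (Submodule.smul_mem _ _ (Submodule.subset_span hχ')) ?_ hU
  rw [σ.corr_smul, σ.corr_smul, h, h', smul_smul, smul_smul, mul_comm]

/-- Some χ must map to a nonzero multiple cψ, and by injectivity only one does. The regular
characters then give χ(1)c = θ(1)ψ(1)/φ(1), the degree formula gives χ(1)/θ(1) = cψ(1)/φ(1), and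
together c² = 1. -/
theorem exists_corr_eq {ψ : ↥(U ⊓ H) → ℂ} (hψ : ψ ∈ irrOver (U ⊓ H) (galIdem F φ)) :
    ∃ χ ∈ irrOver U (galIdem F θ), σ.corr D χ = ψ := by
  have hc := hψ.1.isCharLike
  have h1 := σ.sum_mul_linExt_corr D hU hG hψ.1
  have hN := D.theta_ne
  have hd := D.phi_ne
  have hp := hc.one_ne_zero
  have h2 : linExt ψ (galIdem F φ) = ψ 1 :=
    ((hc.absorb_or (D.galIdem_phi_mem_complex hU)
      (fun u hu => (D.single_mul_galIdem_phi hu.2).symm) D.galIdem_phi_mul_self).resolve_left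
        fun h => hψ.2 h.1).1
  rw [h2] at h1
  obtain ⟨χ, hχ, hne⟩ := Finset.exists_ne_zero_of_sum_ne_zero
    (h1 ▸ mul_ne_zero (div_ne_zero hN hd) (mul_ne_zero hp hp))
  have hχ' : χ ∈ irrOver U (galIdem F θ) := ⟨mem_irrFinset.1 hχ, left_ne_zero_of_mul hne⟩
  obtain ⟨c, hc0, hcψ⟩ := σ.corr_eq_smul_of_ne D hS₀ hG hU hχ' hψ.1 (right_ne_zero_of_mul hne)
  rw [Finset.sum_eq_single χ] at h1
  · have hcχ := hχ'.1.isCharLike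
    have h3 : linExt χ (galIdem F θ) = χ 1 :=
      ((hcχ.absorb_or (D.galIdem_theta_mem_complex hU)
        (fun u _ => (D.single_mul_galIdem_theta hG u).symm) D.galIdem_theta_mul_self).resolve_left
          fun h => hχ'.2 h.1).1
    have h4 : linExt (σ.corr D χ) (charIdem ψ) = c * ψ 1 := by
      rw [hcψ, ← hc.linExt_charIdem, linExt, linExt, Finset.mul_sum]
      exact Finset.sum_congr rfl fun x _ => by rw [Pi.smul_apply, smul_eq_mul]; ring
    have h5 := σ.degree_corr D hU (isBlockFun_of_mem_irrOver D hG hU hχ')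
    rw [h3, h4] at h1
    rw [hcψ, Pi.smul_apply, smul_eq_mul] at h5
    have hx := hcχ.one_ne_zero
    obtain ⟨n1, -, e1⟩ := hc.deg
    obtain ⟨n2, -, e2⟩ := hcχ.deg
    obtain ⟨n3, e3⟩ := D.exists_theta_one
    obtain ⟨n4, e4⟩ := D.exists_phi_one
    have h6 : χ 1 * c = θ 1 / φ 1 * ψ 1 := by
      refine mul_right_cancel₀ hp ?_
      linear_combination h1
    -- The degree formula solved for c; this rules out c = −1.
    have hcval : c = (n4 * n2 : ℕ) / (n3 * n1 : ℕ) := by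
      push_cast
      rw [← e1, ← e2, ← e3, ← e4]
      field_simp at h5 ⊢
      linear_combination -h5
    have : c = 1 := by
      refine eq_one_of_mul_self_eq_one ?_ hcval ?_
      · push_cast
        rw [← e1, ← e3]
        exact mul_ne_zero hN hp
      · have h7 : χ 1 * (c * c) = χ 1 * 1 := by
          rw [← mul_assoc, h6]
          field_simp at h5 ⊢
          linear_combination -h5
        exact mul_left_cancel₀ hx h7
    exact ⟨χ, hχ', by rw [hcψ, this, one_smul]⟩
  · intro χ₁ hχ₁ hne₁
    by_contra h
    have hχ₁' : χ₁ ∈ irrOver U (galIdem F θ) := ⟨mem_irrFinset.1 hχ₁, left_ne_zero_of_mul h⟩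
    obtain ⟨c₁, -, h₁⟩ := σ.corr_eq_smul_of_ne D hS₀ hG hU hχ₁' hψ.1 (right_ne_zero_of_mul h)
    exact hne₁ (σ.eq_of_corr_eq_smul D hS₀ hG hU hχ₁' hχ' hc0 h₁ hcψ)
  · exact fun h => absurd hχ h

/-- The image is a multiple of some ψ in the φ-block, and ψ is itself the image of some χ'.
Proportional images force χ = χ'. -/
theorem corr_mem_irrOver {χ : U → ℂ} (hχ : χ ∈ irrOver U (galIdem F θ)) :
    σ.corr D χ ∈ irrOver (U ⊓ H) (galIdem F φ) := by
  have hcomm := σ.corr_comm D hU hχ.1.isCharLike.comm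
  have h0 := σ.corr_one_ne_zero D hG hU hχ
  obtain ⟨ψ, hψ, hne⟩ : ∃ ψ, IsIrrChar ψ ∧ linExt (σ.corr D χ) (charIdem ψ) ≠ 0 := by
    by_contra! h
    refine h0 ?_
    rw [classFun_eq_sum_charIdem hcomm, Finset.sum_eq_zero]
    · rfl
    · intro ψ hψ
      rw [h ψ (mem_irrFinset.1 hψ), zero_div, zero_smul]
  obtain ⟨c, hc, hcψ⟩ := σ.corr_eq_smul_of_ne D hS₀ hG hU hχ hψ hne
  have hψ' : ψ ∈ irrOver (U ⊓ H) (galIdem F φ) := by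
    refine ⟨hψ, fun h => h0 ?_⟩
    have h1 := (σ.isBlockFun_corr D hU hχ.1.isCharLike.comm).absorb 1
    rw [← h1, OneMemClass.coe_one, ← MonoidAlgebra.one_def, one_mul, hcψ]
    have : linExt (c • ψ) (galIdem F φ) = c * linExt ψ (galIdem F φ) := by
      rw [linExt, linExt, Finset.mul_sum]
      exact Finset.sum_congr rfl fun x _ => by rw [Pi.smul_apply, smul_eq_mul]; ring
    rw [this, h, mul_zero]
  obtain ⟨χ', hχ', h'⟩ := σ.exists_corr_eq D hS₀ hG hU hψ'
  have := σ.eq_of_corr_eq_smul D hS₀ hG hU hχ hχ' one_ne_zero hcψ (by rw [h', one_smul])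
  rw [this, h']
  exact hψ'

theorem corr_mem_irrOver_iff {χ : U → ℂ} (hχ : χ ∈ irrSpan U (galIdem F θ)) :
    χ ∈ irrOver U (galIdem F θ) ↔ σ.corr D χ ∈ irrOver (U ⊓ H) (galIdem F φ) := by
  refine ⟨σ.corr_mem_irrOver D hS₀ hG hU, fun h => ?_⟩
  obtain ⟨χ', hχ', h'⟩ := σ.exists_corr_eq D hS₀ hG hU h
  rwa [σ.corr_injOn D hS₀ hG hχ (Submodule.subset_span hχ') h'.symm hU]

omit hS₀ in
theorem corr_mem_irrSpan {f : U → ℂ} (hf : f ∈ irrSpan U (galIdem F θ)) :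
    σ.corr D f ∈ irrSpan (U ⊓ H) (galIdem F φ) :=
  (D.mem_irrSpan_phi hU).2 (σ.isBlockFun_corr D hU ((D.mem_irrSpan_theta hG hU).1 hf).comm)

/-- The correspondence as a linear equivalence of the spaces of class functions. -/
def corrEquiv : irrSpan U (galIdem F θ) ≃ₗ[ℂ] irrSpan (U ⊓ H) (galIdem F φ) :=
  LinearEquiv.ofBijective
    ((σ.corrLin D U).restrict fun _ hf => σ.corr_mem_irrSpan D hG hU hf) <| by
    constructor
    · intro f g h
      exact Subtype.ext (σ.corr_injOn D hS₀ hG f.2 g.2 (congrArg Subtype.val h) hU)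
    · rintro ⟨ψ, hψ⟩
      have h : irrSpan (U ⊓ H) (galIdem F φ) ≤ (irrSpan U (galIdem F θ)).map (σ.corrLin D U) := by
        refine Submodule.span_le.2 fun ψ hψ => ?_
        obtain ⟨χ, hχ, h⟩ := σ.exists_corr_eq D hS₀ hG hU hψ
        exact ⟨χ, Submodule.subset_span hχ, h⟩
      obtain ⟨f, hf, rfl⟩ := h hψ
      exact ⟨⟨f, hf⟩, rfl⟩

/-- Irreducible characters go injectively to irreducible characters, so orthonormal bases
correspond; sesquilinearity does the rest. -/
theorem charInner_corr {f g : U → ℂ} (hf : f ∈ irrSpan U (galIdem F θ))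
    (hg : g ∈ irrSpan U (galIdem F θ)) :
    charInner (σ.corr D f) (σ.corr D g) = charInner f g := by
  have hadd : ∀ {Δ : Type u} [Group Δ] [Finite Δ] (a b c : Δ → ℂ),
      charInner (a + b) c = charInner a c + charInner b c := by
    intros
    simp only [charInner, Pi.add_apply, add_mul, Finset.sum_add_distrib, mul_add]
  have hsmul : ∀ {Δ : Type u} [Group Δ] [Finite Δ] (r : ℂ) (a c : Δ → ℂ),
      charInner (r • a) c = r * charInner a c := by
    intros
    simp only [charInner, Pi.smul_apply, smul_eq_mul, mul_assoc, ← Finset.mul_sum]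
    ring
  have hadd' : ∀ {Δ : Type u} [Group Δ] [Finite Δ] (a b c : Δ → ℂ),
      charInner c (a + b) = charInner c a + charInner c b := by
    intros
    simp only [charInner, Pi.add_apply, map_add, mul_add, Finset.sum_add_distrib]
  have hsmul' : ∀ {Δ : Type u} [Group Δ] [Finite Δ] (r : ℂ) (a c : Δ → ℂ),
      charInner c (r • a) = (starRingEnd ℂ) r * charInner c a := by
    intros
    simp only [charInner, Pi.smul_apply, smul_eq_mul, map_mul, mul_left_comm _ ((starRingEnd ℂ) _),
      ← Finset.mul_sum]
  induction hf using Submodule.span_induction with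
  | mem f hf =>
    induction hg using Submodule.span_induction with
    | mem g hg =>
      classical
      rw [charInner_irr hf.1 hg.1, charInner_irr (σ.corr_mem_irrOver D hS₀ hG hU hf).1
        (σ.corr_mem_irrOver D hS₀ hG hU hg).1]
      refine if_congr ⟨fun h => ?_, fun h => by rw [h]⟩ rfl rfl
      exact σ.corr_injOn D hS₀ hG (Submodule.subset_span hf) (Submodule.subset_span hg) h hU
    | zero =>
      rw [← zero_smul ℂ (0 : U → ℂ), σ.corr_smul, hsmul', hsmul', map_zero, zero_mul, zero_mul]
    | add a b _ _ ha hb => rw [σ.corr_add, hadd', hadd', ha, hb]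
    | smul c a _ ha => rw [σ.corr_smul, hsmul', hsmul', ha]
  | zero => rw [← zero_smul ℂ (0 : U → ℂ), σ.corr_smul, hsmul, hsmul, zero_mul, zero_mul]
  | add a b _ _ ha hb => rw [σ.corr_add, hadd, hadd, ha, hb]
  | smul c a _ ha => rw [σ.corr_smul, hsmul, hsmul, ha]

end MagicCrossedRep

/-! ### Restriction, induction, conjugation and twists of block functions. -/

section

variable {G : Type u} [Group G] [Finite G] {U V W : Subgroup G}

theorem linExt_resFun (h : V ≤ W) (f : W → ℂ) {a : ℂ[G]} (ha : a ∈ groupAlg ℂ V) :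
    linExt (resFun h f) a = linExt f a := by
  induction ha using groupAlg_induction with
  | single x hx =>
    rw [linExt_single_mem _ hx, linExt_single_mem _ (h hx)]
    rfl
  | zero => simp
  | add a b _ _ ha hb => rw [linExt_add, linExt_add, ha, hb]
  | smul c a _ ha => rw [linExt_smul, linExt_smul, ha]

theorem linExt_single_mul_eq_zero {τ : V → ℂ} {x : G} (hx : x ∉ V) {a : ℂ[G]}
    (ha : a ∈ groupAlg ℂ V) : linExt τ (⟪x⟫ * a) = 0 := by
  induction ha using groupAlg_induction with
  | single y hy =>
    rw [single_mul_single_one, linExt_single_notMem]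
    exact fun h => hx (by simpa using mul_mem h (inv_mem hy))
  | zero => simp
  | add a b _ _ ha hb => rw [mul_add, linExt_add, ha, hb, add_zero]
  | smul c a _ ha => rw [mul_smul_comm, linExt_smul, ha, mul_zero]

theorem linExt_single_mul_single (τ : V → ℂ) (x g : G) :
    linExt τ (⟪g⟫ * ⟪x⟫ * ⟪g⁻¹⟫) = linExt τ ⟪g * x * g⁻¹⟫ := by
  rw [single_mul_single_one, single_mul_single_one]

theorem indFun_apply (τ : V → ℂ) (x : W) :
    indFun V W τ x = (Nat.card V : ℂ)⁻¹ * ∑ y : W, linExt τ ⟪(y : G) * x * (y : G)⁻¹⟫ := by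
  rw [indFun]
  congr 1
  refine Finset.sum_congr (by ext; simp) fun y _ => ?_
  split_ifs with h
  · rw [linExt_single_mem τ h, one_mul]
  · rw [linExt_single_notMem τ h]

theorem linExt_indFun (τ : V → ℂ) {a : ℂ[G]} (ha : a ∈ groupAlg ℂ W) :
    linExt (indFun V W τ) a =
      (Nat.card V : ℂ)⁻¹ * ∑ y : W, linExt τ (⟪(y : G)⟫ * a * ⟪(y : G)⁻¹⟫) := by
  induction ha using groupAlg_induction with
  | single x hx =>
    rw [linExt_single_mem _ hx, one_mul, indFun_apply]
    simp only [linExt_single_mul_single]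
  | zero => simp
  | add a b _ _ ha hb =>
    simp only [mul_add, add_mul, linExt_add, Finset.sum_add_distrib, ha, hb]
  | smul c a _ ha =>
    simp only [mul_smul_comm, smul_mul_assoc, linExt_smul, ← Finset.mul_sum, ha]
    ring

theorem indFun_comm (τ : V → ℂ) (x y : W) :
    indFun V W τ (x * y) = indFun V W τ (y * x) := by
  rw [indFun_apply, indFun_apply]
  congr 1
  refine Fintype.sum_equiv (Equiv.mulRight x) _ _ fun z => ?_
  congr 2
  simp [mul_assoc]

theorem linExt_conjFun (h : G) (f : U → ℂ) (a : ℂ[G]) :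
    linExt (conjFun h f) a = linExt f (⟪h⟫ * a * ⟪h⁻¹⟫) := by
  rw [linExt, linExt]
  have hmem : ∀ x : U, h⁻¹ * (x : G) * h ∈ conjSub h U := by
    intro x
    change h * (h⁻¹ * x * h) * h⁻¹ ∈ U
    simp [mul_assoc]
  refine Fintype.sum_equiv (⟨fun x => ⟨h * x * h⁻¹, x.2⟩, fun x => ⟨h⁻¹ * x * h, hmem x⟩,
    fun x => Subtype.ext ?_, fun x => Subtype.ext ?_⟩ : conjSub h U ≃ U) _ _ ?_
  · simp [mul_assoc]
  · simp [mul_assoc]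
  · intro x
    simp [conjFun, MonoidAlgebra.coeff_single_mul_apply, MonoidAlgebra.coeff_mul_single_apply,
      mul_assoc]

theorem linExt_map {F : Subfield ℂ} (α : ℂ ≃ₐ[F] ℂ) (f : U → ℂ) {a : ℂ[G]}
    (ha : a ∈ groupAlg F V) : linExt (fun x => α (f x)) a = α (linExt f a) := by
  rw [linExt, linExt, map_sum]
  refine Finset.sum_congr rfl fun x _ => ?_
  obtain ⟨c, hc⟩ := coeff_mem_of_mem ha (x : G)
  rw [map_mul, ← hc, α.commutes]

theorem linExt_mul_quotient {K : Subgroup G} [K.Normal] (hU : K ≤ U) (β : U ⧸ K.subgroupOf U → ℂ)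
    (f : U → ℂ) {x : G} (hx : x ∈ U) {a : ℂ[G]} (ha : a ∈ groupAlg ℂ K) :
    linExt (fun x : U => β x * f x) (⟪x⟫ * a) =
      β (⟨x, hx⟩ : U) * linExt f (⟪x⟫ * a) := by
  induction ha using groupAlg_induction with
  | single y hy =>
    rw [single_mul_single_one, linExt_single_mem _ (mul_mem hx (hU hy)),
      linExt_single_mem _ (mul_mem hx (hU hy)), one_mul, one_mul]
    congr 2
    refine (QuotientGroup.eq (s := K.subgroupOf U)).2 (Subgroup.mem_subgroupOf.2 ?_)
    have := ‹K.Normal›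
    simpa using hy
  | zero => simp
  | add a b _ _ ha hb => rw [mul_add, linExt_add, linExt_add, ha, hb, mul_add]
  | smul c a _ ha => rw [mul_smul_comm, linExt_smul, linExt_smul, ha]; ring

theorem IsBlockFun.map {F : Subfield ℂ} (α : ℂ ≃ₐ[F] ℂ) {e : ℂ[G]} (he : e ∈ groupAlg F U)
    {f : U → ℂ} (hf : IsBlockFun e f) : IsBlockFun e fun x => α (f x) where
  comm x y := congrArg α (hf.comm x y)
  absorb x := by
    rw [linExt_map α f (mul_mem (single_mem_groupAlg x.2) he), hf.absorb]

theorem IsBlockFun.resFun {e : ℂ[G]} (h : V ≤ W) (he : e ∈ groupAlg ℂ V) {f : W → ℂ}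
    (hf : IsBlockFun e f) : IsBlockFun e (resFun h f) where
  comm x y := hf.comm (Subgroup.inclusion h x) (Subgroup.inclusion h y)
  absorb x := by
    rw [linExt_resFun h f (mul_mem (single_mem_groupAlg x.2) he)]
    exact hf.absorb (Subgroup.inclusion h x)

theorem IsBlockFun.indFun {e : ℂ[G]} (h : V ≤ W) (he : e ∈ groupAlg ℂ V)
    (hcen : ∀ u ∈ W, ⟪u⟫ * e = e * ⟪u⟫) {τ : V → ℂ}
    (hτ : IsBlockFun e τ) : IsBlockFun e (indFun V W τ) where
  comm := indFun_comm τ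
  absorb x := by
    rw [linExt_indFun τ (mul_mem (single_mem_groupAlg x.2) (groupAlg_mono h he)), indFun_apply]
    congr 1
    refine Finset.sum_congr rfl fun y _ => ?_
    have h1 : ⟪(y : G)⟫ * (⟪(x : G)⟫ * e) * ⟪(y : G)⁻¹⟫ = ⟪(y : G) * x * (y : G)⁻¹⟫ * e := by
      rw [mul_assoc, mul_assoc, ← hcen _ (inv_mem y.2), ← mul_assoc, ← mul_assoc,
        single_mul_single_one, single_mul_single_one]
    rw [h1]
    by_cases h2 : (y : G) * x * (y : G)⁻¹ ∈ V
    · exact hτ.linExt_mul (single_mem_groupAlg h2)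
    · rw [linExt_single_mul_eq_zero h2 he, linExt_single_notMem τ h2]

theorem IsBlockFun.conjFun {e : ℂ[G]} (h : G) (hcen : ⟪h⟫ * e = e * ⟪h⟫) {f : U → ℂ}
    (hf : IsBlockFun e f) : IsBlockFun e (conjFun h f) where
  comm x y := by
    have := hf.comm ⟨h * x * h⁻¹, x.2⟩ ⟨h * y * h⁻¹, y.2⟩
    have e1 : ∀ x y : conjSub h U, (⟨h * x * h⁻¹, x.2⟩ * ⟨h * y * h⁻¹, y.2⟩ : U) =
        ⟨h * (x * y : conjSub h U) * h⁻¹, (x * y).2⟩ := fun x y =>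
      Subtype.ext (by simp [mul_assoc])
    rw [e1, e1] at this
    exact this
  absorb x := by
    have h1 : ⟪h⟫ * (⟪(x : G)⟫ * e) * ⟪h⁻¹⟫ = ⟪h * x * h⁻¹⟫ * e := by
      have h2 : e * ⟪h⁻¹⟫ = ⟪h⁻¹⟫ * e := by
        rw [← one_mul (e * ⟪h⁻¹⟫), ← single_inv_mul h, mul_assoc, ← mul_assoc ⟪h⟫, hcen, mul_assoc e,
          single_mul_inv, mul_one]
      rw [mul_assoc, mul_assoc, h2, ← mul_assoc, ← mul_assoc,
        single_mul_single_one, single_mul_single_one]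
    rw [linExt_conjFun, h1]
    exact hf.absorb ⟨h * x * h⁻¹, x.2⟩

theorem comm_of_mem_span_irr {Δ : Type*} [Group Δ] [Finite Δ] {β : Δ → ℂ}
    (hβ : β ∈ Submodule.span ℂ {β : Δ → ℂ | IsIrrChar β}) (x y : Δ) :
    β (x * y) = β (y * x) := by
  induction hβ using Submodule.span_induction with
  | mem β hβ => exact hβ.isCharLike.comm x y
  | zero => rfl
  | add a b _ _ ha hb => rw [Pi.add_apply, Pi.add_apply, ha, hb]
  | smul c a _ ha => rw [Pi.smul_apply, Pi.smul_apply, ha]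

theorem IsBlockFun.mul_quotient {K : Subgroup G} [K.Normal] (hU : K ≤ U)
    {β : U ⧸ K.subgroupOf U → ℂ} (hβ : ∀ x y, β (x * y) = β (y * x)) {e : ℂ[G]}
    (he : e ∈ groupAlg ℂ K) {f : U → ℂ} (hf : IsBlockFun e f) :
    IsBlockFun e fun x : U => β x * f x where
  comm x y := congrArg₂ (· * ·) (hβ x y) (hf.comm x y)
  absorb x := by rw [linExt_mul_quotient hU β f x.2 he, hf.absorb]

end

/-! ### Compatibility of the correspondence with these operations. -/

namespace MagicCrossedRep

variable {G : Type u} [Group G] [Finite G] {F : Subfield ℂ} {H K : Subgroup G} [K.Normal]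
  {θ : K → ℂ} {φ : ↥(H ⊓ K) → ℂ} {S₀ : CornerSubalgebra F ℂ[G]} (σ : MagicCrossedRep F θ φ S₀)
  {Γ : Type} [Fintype Γ] (D : ConjFamily F H K θ φ Γ)
  (hG : ∀ g : G, ∃ h ∈ H, ∃ k ∈ K, g = h * k)
  {U : Subgroup G} (hU : K ≤ U)

local notation "𝐢" => idem F θ φ

include hU

theorem corr_resFun {W : Subgroup G} (h : U ≤ W) (f : W → ℂ) :
    σ.corr D (resFun h f) = resFun (inf_le_inf_right H h) (σ.corr D f) := by
  funext x
  exact congrArg ((D.n : ℂ)⁻¹ * ·) (linExt_resFun h f (σ.κ_mem_complex D hU x.2.1))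

theorem corr_mul_quotient (β : U ⧸ K.subgroupOf U → ℂ) (f : U → ℂ) :
    σ.corr D (fun x : U => β x * f x) =
      fun x => β (Subgroup.inclusion inf_le_left x : U) * σ.corr D f x := by
  funext x
  simp only [corr, κ]
  rw [linExt_mul_quotient hU β f x.2.1 (mem_groupAlg_complex (σ.inv_mem_groupAlg D _))]
  exact mul_left_comm _ _ _

theorem corr_map (α : ℂ ≃ₐ[F] ℂ) (f : U → ℂ) :
    σ.corr D (fun x => α (f x)) = fun x => α (σ.corr D f x) := by
  funext x
  simp only [corr]
  rw [linExt_map α f (σ.κ_mem D hU x.2.1), map_mul, map_inv₀, map_natCast]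

include D

/-- Conjugation by elements of `H` is compatible with `κ` up to inner automorphisms from `K`. -/
theorem linExt_conj_κ {f : U → ℂ} (hf : ∀ x y, f (x * y) = f (y * x)) (g x : H) :
    linExt f (⟪(g : G)⟫ * σ.κ x * ⟪(g : G)⁻¹⟫) = linExt f (σ.κ (g * x * g⁻¹)) := by
  -- With s = gσ(g)g⁻¹ and t = gσ(g)⁻¹g⁻¹, mutually inverse in S, one has g κ(x) g⁻¹ = s κ(gxg⁻¹) t,
  -- so class functions do not distinguish the two.
  set s := ⟪(g : G)⟫ * σ.toFun g * ⟪(g : G)⁻¹⟫ with hs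
  set t := ⟪(g : G)⟫ * σ.inv g * ⟪(g : G)⁻¹⟫ with ht
  have htS : t ∈ D.S := by
    have := ConjFamily.gconj_mem_S (D := D) (σ.inv_mem g) (InvMemClass.inv_mem g.2)
    rwa [gconj, inv_inv] at this
  have h1 : s * σ.κ g = ⟪(g : G)⟫ * 𝐢 := by
    rw [hs, κ, ← mul_assoc, mul_assoc _ ⟪(g : G)⁻¹⟫, single_inv_mul, mul_one, mul_assoc, σ.mul_inv]
  have h2 : σ.κ g⁻¹ * t = 𝐢 * ⟪(g : G)⁻¹⟫ := by
    rw [ht, ← mul_assoc, ← κ, σ.κ_inv_mul D]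
  have h3 : t * s = 𝐢 := by
    rw [hs, ht, ConjFamily.conj_mul_conj, σ.inv_mul, D.single_mul_idem g.2, mul_assoc,
      single_mul_inv, mul_one]
  clear_value s t
  have h4 : s * σ.κ (g * x * g⁻¹) * t = ⟪(g : G)⟫ * σ.κ x * ⟪(g : G)⁻¹⟫ := by
    have h5 : s * (σ.κ g * σ.κ x * σ.κ g⁻¹) * t = s * σ.κ g * σ.κ x * (σ.κ g⁻¹ * t) := by
      simp only [mul_assoc]
    rw [σ.κ_mul D, σ.κ_mul D, h5, h1, h2, ← mul_assoc, mul_assoc _ _ 𝐢, σ.κ_mul_idem D,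
      mul_assoc _ 𝐢, σ.idem_mul_κ D]
  rw [← h4, ← linExt_mul_comm hf (groupAlg_mono hU (ConjFamily.mem_complex_of_mem_S htS)),
    ← mul_assoc, h3, σ.idem_mul_κ D]

theorem corr_conjFun {f : U → ℂ} (hf : ∀ x y, f (x * y) = f (y * x)) {h : G} (hh : h ∈ H)
    {x : G} (hx : x ∈ conjSub h U ⊓ H) (hx' : x ∈ conjSub h (U ⊓ H)) :
    σ.corr D (conjFun h f) ⟨x, hx⟩ = conjFun h (σ.corr D f) ⟨x, hx'⟩ := by
  rw [corr, linExt_conjFun]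
  exact congrArg ((D.n : ℂ)⁻¹ * ·) (σ.linExt_conj_κ D hU hf ⟨h, hh⟩ ⟨x, hx.2⟩)

omit hU in
theorem linExt_κ_eq_zero {V : Subgroup G} (hV : K ≤ V) {τ : V → ℂ} {x : H} (hx : (x : G) ∉ V) :
    linExt τ (σ.κ x) = 0 :=
  linExt_single_mul_eq_zero hx (groupAlg_mono hV (mem_groupAlg_complex (σ.inv_mem_groupAlg D _)))

/-- The function g ↦ τ(gκ(y)g⁻¹) is unchanged when g is multiplied on the left by K, so its sums
over W and over W ∩ H differ by the factor |K|/|L|, which is also |U|/|U ∩ H|. -/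
theorem corr_indFun (hG : ∀ g : G, ∃ h ∈ H, ∃ k ∈ K, g = h * k) {W : Subgroup G} (hUW : U ≤ W)
    {τ : U → ℂ} (hτ : ∀ x y, τ (x * y) = τ (y * x)) :
    σ.corr D (indFun U W τ) = indFun (U ⊓ H) (W ⊓ H) (σ.corr D τ) := by
  funext x
  have h1 := IsCharLike.card_ne_zero K
  have h2 := IsCharLike.card_ne_zero (H ⊓ K)
  have h3 := IsCharLike.card_ne_zero U
  have h4 := IsCharLike.card_ne_zero (U ⊓ H)
  set y : H := ⟨x, x.2.2⟩ with hy
  have hsum := card_mul_sum_inf hG (hU.trans hUW)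
    (f := fun g => linExt τ (⟪g⟫ * σ.κ y * ⟪g⁻¹⟫)) (by
      intro k hk g
      rw [← linExt_conj hτ (hU hk) (⟪g⟫ * σ.κ y * ⟪g⁻¹⟫), mul_inv_rev, ← single_mul_single_one,
        ← single_mul_single_one]
      simp only [mul_assoc])
  have hterm : ∀ g : ↥(W ⊓ H), linExt (σ.corr D τ) ⟪(g : G) * x * (g : G)⁻¹⟫ =
      (D.n : ℂ)⁻¹ * linExt τ (⟪(g : G)⟫ * σ.κ y * ⟪(g : G)⁻¹⟫) := by
    intro g
    have h5 := σ.linExt_conj_κ D hU hτ ⟨g, g.2.2⟩ y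
    have h5' : linExt τ (⟪(g : G)⟫ * σ.κ y * ⟪(g : G)⁻¹⟫) = _ := h5
    rw [h5']
    by_cases h6 : (g : G) * x * (g : G)⁻¹ ∈ U
    · have h7 : (g : G) * x * (g : G)⁻¹ ∈ U ⊓ H :=
        ⟨h6, H.mul_mem (H.mul_mem g.2.2 x.2.2) (H.inv_mem g.2.2)⟩
      rw [linExt_single_mem _ h7, one_mul]
      rfl
    · have h7 : (g : G) * x * (g : G)⁻¹ ∉ U ⊓ H := fun h => h6 h.1
      rw [linExt_single_notMem _ h7, σ.linExt_κ_eq_zero D hU h6, mul_zero]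
  rw [indFun_apply, corr, linExt_indFun τ (σ.κ_mem_complex D (hU.trans hUW) x.2.1)]
  simp only [hterm, ← Finset.mul_sum]
  have hcard := card_mul_card_inf hG hU
  have h7 : (∑ g : ↥(W ⊓ H), linExt τ (⟪(g : G)⟫ * σ.κ y * ⟪(g : G)⁻¹⟫)) =
      Nat.card ↥(H ⊓ K) / Nat.card K *
        ∑ g : W, linExt τ (⟪(g : G)⟫ * σ.κ y * ⟪(g : G)⁻¹⟫) := by
    rw [div_mul_eq_mul_div, eq_div_iff h1, mul_comm]
    exact hsum
  rw [h7]
  have h8 := D.n_cast_ne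
  field_simp
  linear_combination (∑ g : W, linExt τ (⟪(g : G)⟫ * σ.κ y * ⟪(g : G)⁻¹⟫)) * hcard

end MagicCrossedRep

/-! ### The algebra kUe_χ and its corners. -/

section Block

variable {G : Type u} [Group G] [Finite G] {U : Subgroup G} {k : Type*} [Field k] [Algebra k ℂ]
  {χ : U → ℂ}

theorem charIdem_mem_of_values (hk : ∀ x, ∃ c : k, algebraMap k ℂ c = χ x) :
    charIdem χ ∈ groupAlg k U := by
  choose c hc using hk
  refine mem_groupAlg_iff.2 ⟨fun x hx => coeff_eq_zero_of_mem (charIdem_mem_groupAlg χ) hx,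
    fun x hx => ⟨c 1 / Nat.card U * c ⟨x, hx⟩⁻¹, ?_⟩⟩
  rw [charIdem_coeff χ ⟨x, hx⟩, map_mul, map_div₀, map_natCast, hc, hc]

theorem charIdem_ne_zero (h : IsIrrChar χ) : charIdem χ ≠ 0 := fun h0 => by
  have h1 := h.isCharLike.linExt_charIdem
  rw [h0, linExt_zero] at h1
  exact h.isCharLike.one_ne_zero h1.symm

theorem mem_blockAlg {h : IsIrrChar χ} {b : ℂ[G]} :
    b ∈ (blockAlg k χ h).toNonUnitalSubalgebra ↔ ∃ a ∈ groupAlg k U, b = a * charIdem χ := Iff.rfl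

theorem mem_blockAlg_iff (h : IsIrrChar χ) (hk : ∀ x, ∃ c : k, algebraMap k ℂ c = χ x) {b : ℂ[G]} :
    b ∈ (blockAlg k χ h).toNonUnitalSubalgebra ↔ b ∈ groupAlg k U ∧ b * charIdem χ = b := by
  rw [mem_blockAlg]
  constructor
  · rintro ⟨a, ha, rfl⟩
    exact ⟨mul_mem ha (charIdem_mem_of_values hk), by
      rw [mul_assoc, h.isCharLike.charIdem_idem]⟩
  · exact fun hb => ⟨b, hb.1, hb.2.symm⟩

/-- The algebra `kUe_χ` is central simple when `k` contains the values of `χ`. -/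
theorem isCSA_blockAlg (h : IsIrrChar χ) (hk : ∀ x, ∃ c : k, algebraMap k ℂ c = χ x) :
    IsCSA k (blockAlg k χ h) := by
  have hc := h.isCharLike
  have hmem : ∀ b : blockAlg k χ h, (b : ℂ[G]) ∈ groupAlg k U ∧ (b : ℂ[G]) * charIdem χ = b :=
    fun b => (mem_blockAlg_iff h hk).1 b.2
  have hval : ∀ a ∈ groupAlg k U, ∃ c : k, algebraMap k ℂ c = linExt χ a / χ 1 := by
    intro a ha
    obtain ⟨c, hc⟩ := linExt_mem_of_mem hk ⟨U, ha⟩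
    obtain ⟨d, hd⟩ := hk 1
    exact ⟨c / d, by rw [map_div₀, hc, hd]⟩
  have hsm : ∀ (c : k), ((c • (1 : blockAlg k χ h) : blockAlg k χ h) : ℂ[G]) =
      algebraMap k ℂ c • charIdem χ := by
    intro c
    rw [algebraMap_smul]
    rfl
  have hgrp : ∀ x ∈ U, ⟪x⟫ * charIdem χ ∈ (blockAlg k χ h).toNonUnitalSubalgebra :=
    fun x hx => ⟨_, single_mem_groupAlg hx, rfl⟩
  have hnt : Nontrivial (blockAlg k χ h) :=
    ⟨⟨1, 0, fun h0 => charIdem_ne_zero h (congrArg Subtype.val h0)⟩⟩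
  refine ⟨⟨fun z hz => ?_⟩, IsSimpleRing.of_eq_bot_or_eq_top fun I => ?_, ?_⟩
  · have h1 : ∀ u ∈ U, (z : ℂ[G]) * ⟪u⟫ = ⟪u⟫ * z := by
      intro u hu
      have h2 := congrArg Subtype.val
        (Subalgebra.mem_center_iff.1 hz ⟨_, hgrp u hu⟩)
      simp only [CornerSubalgebra.coe_mul] at h2
      have h3 := (hmem z).2
      have h4 := charIdem_mul_comm hc.comm (mem_groupAlg_complex (hmem z).1)
      rw [mul_assoc, ← h4, h3, ← hc.charIdem_central u hu, ← mul_assoc, h3] at h2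
      exact h2.symm
    obtain ⟨c, hcv⟩ := hval z (hmem z).1
    refine ⟨c, Subtype.ext ?_⟩
    have h2 := hc.mul_charIdem_of_central (mem_groupAlg_complex (hmem z).1) h1
    rw [(hmem z).2, ← hcv] at h2
    rw [h2, ← hsm]
    congr 1
  · by_contra! hI
    obtain ⟨b, hbI, hb0⟩ : ∃ b ∈ I, b ≠ 0 := by
      by_contra! h
      refine hI.1 (le_antisymm (fun y hy => ?_) bot_le)
      rw [TwoSidedIdeal.mem_bot]
      exact h y hy
    obtain ⟨x, hx, hne⟩ : ∃ x ∈ U, linExt χ ((b : ℂ[G]) * ⟪x⟫) ≠ 0 := by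
      by_contra! h0
      refine hb0 (Subtype.ext ?_)
      rw [← (hmem b).2]
      exact hc.mul_charIdem_eq_zero (mem_groupAlg_complex (hmem b).1) h0
    have hbx : (b : ℂ[G]) * ⟪x⟫ ∈ groupAlg k U := mul_mem (hmem b).1 (single_mem_groupAlg hx)
    obtain ⟨c, hcv⟩ := hval _ hbx
    have hc0 : (Nat.card U : k) * c ≠ 0 := by
      intro h0
      have h1 := congrArg (algebraMap k ℂ) h0
      rw [map_mul, map_natCast, hcv, map_zero] at h1
      exact mul_ne_zero (IsCharLike.card_ne_zero U) (div_ne_zero hne hc.one_ne_zero) h1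
    let g : U → blockAlg k χ h := fun u => ⟨_, hgrp u u.2⟩
    -- Averaging bx over U stays in the ideal and yields |U|χ(bx)/χ(1) times the identity; x was
    -- chosen to make this nonzero.
    have key : ((Nat.card U : k) * c) • (1 : blockAlg k χ h) =
        ∑ u : U, g u * (b * g ⟨x, hx⟩) * g u⁻¹ := by
      apply Subtype.ext
      rw [hsm, CornerSubalgebra.coe_sum, map_mul, map_natCast, hcv, ← mul_div_assoc,
        ← hc.conjSum_mul_charIdem (mem_groupAlg_complex hbx), conjSum_apply, Finset.sum_mul]
      refine Finset.sum_congr rfl fun u _ => ?_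
      simp only [CornerSubalgebra.coe_mul, g, Subgroup.coe_inv]
      have e1 : ∀ u ∈ U, ⟪u⟫ * charIdem χ = charIdem χ * ⟪u⟫ := fun u hu =>
        (hc.charIdem_central u hu).symm
      have e2 : ∀ a, charIdem χ * (charIdem χ * a) = charIdem χ * a := fun a => by
        rw [← mul_assoc, hc.charIdem_idem]
      have e3 : ∀ u ∈ U, ∀ a, ⟪u⟫ * (charIdem χ * a) = charIdem χ * (⟪u⟫ * a) := fun u hu a => by
        rw [← mul_assoc, e1 u hu, mul_assoc]
      have e4 : (b : ℂ[G]) * charIdem χ = charIdem χ * b :=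
        charIdem_mul_comm hc.comm (mem_groupAlg_complex (hmem b).1)
      have e5 : ∀ a, (b : ℂ[G]) * (charIdem χ * a) = charIdem χ * (b * a) := fun a => by
        rw [← mul_assoc, e4, mul_assoc]
      simp only [mul_assoc, e1 _ u.2, e1 _ hx, e1 _ (inv_mem u.2), e2, e3 _ u.2, e3 _ hx, e5]
    have hI1 : ((Nat.card U : k) * c) • (1 : blockAlg k χ h) ∈ I := by
      rw [key]
      exact sum_mem fun u _ => I.mul_mem_right _ _ (I.mul_mem_left _ _ (I.mul_mem_right _ _ hbI))
    have h1 : (1 : blockAlg k χ h) ∈ I := by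
      have := I.mul_mem_left (((Nat.card U : k) * c)⁻¹ • (1 : blockAlg k χ h)) _ hI1
      rwa [smul_mul_smul_comm, inv_mul_cancel₀ hc0, one_smul, one_mul] at this
    exact hI.2 ((TwoSidedIdeal.one_mem_iff I).1 h1)
  · have := finiteDimensional_groupAlg k U
    let j : blockAlg k χ h →ₗ[k] groupAlg k U :=
      { toFun := fun s => ⟨s, (hmem s).1⟩
        map_add' := fun _ _ => rfl
        map_smul' := fun _ _ => rfl }
    exact FiniteDimensional.of_injective j fun s t h =>
      Subtype.ext (congrArg (fun x : groupAlg k U => (x : ℂ[G])) h)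

/-- The corner `j kUe_χ j`, for an idempotent `j` of `kU`. -/
def cornerBlock (k : Type*) [Field k] [Algebra k ℂ] (h : IsIrrChar χ) (j : ℂ[G])
    (hj : j ∈ groupAlg k U) (hjj : j * j = j) : CornerSubalgebra k ℂ[G] where
  carrier := {b | b ∈ (blockAlg k χ h).toNonUnitalSubalgebra ∧ j * b = b ∧ b * j = b}
  add_mem' := fun {a b} ha hb => ⟨add_mem ha.1 hb.1, by rw [mul_add, ha.2.1, hb.2.1], by
    rw [add_mul, ha.2.2, hb.2.2]⟩
  zero_mem' := ⟨zero_mem _, mul_zero _, zero_mul _⟩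
  mul_mem' := fun {a b} ha hb => ⟨mul_mem ha.1 hb.1, by rw [← mul_assoc, ha.2.1], by
    rw [mul_assoc, hb.2.2]⟩
  smul_mem' := fun c b hb => ⟨SMulMemClass.smul_mem c hb.1, by rw [mul_smul_comm, hb.2.1], by
    rw [smul_mul_assoc, hb.2.2]⟩
  unit := j * charIdem χ
  unit_mem := ⟨⟨j, hj, rfl⟩, by rw [← mul_assoc, hjj], by
    rw [mul_assoc, ← charIdem_comm h hj, ← mul_assoc, hjj]⟩
  unit_mul := by
    rintro b ⟨⟨a, ha, rfl⟩, hb, -⟩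
    rw [mul_assoc, ← mul_assoc _ a, ← charIdem_comm h ha, mul_assoc a, charIdem_mul_self h, hb]
  mul_unit := by
    rintro b ⟨⟨a, ha, rfl⟩, -, hb⟩
    rw [← mul_assoc, hb, mul_assoc, charIdem_mul_self h]

end Block

theorem mem_groupAlg_of_le {G : Type u} [Group G] [Finite G] {U : Subgroup G} {k k' : Type*} [Field k]
    [Field k'] [Algebra k ℂ] [Algebra k' ℂ] (hk : ∀ c : k, ∃ c' : k', algebraMap k' ℂ c' = algebraMap k ℂ c)
    {a : ℂ[G]} (ha : a ∈ groupAlg k U) : a ∈ groupAlg k' U := by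
  rw [mem_groupAlg_iff] at ha ⊢
  refine ⟨ha.1, fun x hx => ?_⟩
  obtain ⟨c, hc⟩ := ha.2 x hx
  obtain ⟨c', hc'⟩ := hk c
  exact ⟨c', hc'.trans hc⟩

theorem IsCSA.injective {k C A : Type*} [Field k] [Ring C] [Algebra k C] [Ring A] [Algebra k A]
    [Nontrivial A] (hC : IsCSA k C) (f : C →ₐ[k] A) : Function.Injective f :=
  have := hC.simple
  f.toRingHom.injective

/-! ### Brauer classes. -/

namespace MagicCrossedRep

variable {G : Type u} [Group G] [Finite G] {F : Subfield ℂ} {H K : Subgroup G} [K.Normal]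
  {θ : K → ℂ} {φ : ↥(H ⊓ K) → ℂ} {S₀ : CornerSubalgebra F ℂ[G]} (σ : MagicCrossedRep F θ φ S₀)
  {Γ : Type} [Fintype Γ] (D : ConjFamily F H K θ φ Γ) (hS₀ : IsBaseSubalgebra F θ φ S₀)
  (hG : ∀ g : G, ∃ h ∈ H, ∃ k ∈ K, g = h * k)
  {U : Subgroup G} (hU : K ≤ U) {χ : U → ℂ} (hχ : χ ∈ irrOver U (galIdem F θ))
  {k : Type} [Field k] [Algebra k ℂ] (hF : ∀ c : F, ∃ c' : k, algebraMap k ℂ c' = c)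
  (hk : ∀ x, ∃ c : k, algebraMap k ℂ c = χ x)

local notation "𝐢" => idem F θ φ

include D hG hU hχ σ

theorem linExt_idem_ne_zero : linExt χ 𝐢 ≠ 0 := by
  have := σ.corr_one_ne_zero D hG hU hχ
  rw [σ.corr_one D] at this
  exact right_ne_zero_of_mul this

include hS₀

/-- An element of Z₀ commutes with S₀ and with κ, hence with the corner, so it acts on the χ-part of
the corner as a scalar. This is the action of Z₀ on F(χ). -/
theorem center_mul_charIdem {z : S₀} (hz : z ∈ Subring.center S₀) :
    (z : ℂ[G]) * charIdem χ = (linExt χ (z : ℂ[G]) / linExt χ 𝐢) • (𝐢 * charIdem χ) := by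
  have h0 := σ.linExt_idem_ne_zero D hG hU hχ
  have hzU : (z : ℂ[G]) ∈ groupAlg ℂ U :=
    groupAlg_mono hU (ConjFamily.mem_complex_of_mem_S (D.base_mem hS₀ z))
  have h := hχ.1.isCharLike.smul_mul_charIdem_of_comm_corner
    (groupAlg_mono hU D.idem_mem_complex) hzU (D.idem_mul_base hS₀ z) (D.base_mul_idem hS₀ z)
    (fun y hy => by
      have h := σ.corner_mem_span D hS₀ hU hG hy
      generalize 𝐢 * ⟪y⟫ * 𝐢 = a at h
      induction h using Submodule.span_induction with
      | mem a ha =>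
        obtain ⟨x, hx, t, rfl⟩ := ha
        have h1 : (z : ℂ[G]) * t = t * z :=
          (congrArg Subtype.val (Subring.mem_center_iff.1 hz t)).symm
        rw [← mul_assoc, σ.base_mul_κ D hS₀, mul_assoc, h1, mul_assoc]
      | zero => simp
      | add a b _ _ ha hb => rw [mul_add, add_mul, ha, hb]
      | smul c a _ ha => rw [mul_smul_comm, smul_mul_assoc, ha])
  rw [div_eq_inv_mul, mul_smul, ← h, smul_smul, inv_mul_cancel₀ h0, one_smul]

/-- The left side is a scalar multiple of i e_χ by Schur's lemma for the corner; evaluating χ shows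
the scalar is 1. So κ identifies the identity of the ψ-block with that of the corner. -/
theorem κLin_charIdem_mul (hχι : IsIrrChar (σ.corr D χ)) :
    σ.κLin (charIdem (σ.corr D χ)) * charIdem χ = 𝐢 * charIdem χ := by
  have h0 := σ.linExt_idem_ne_zero D hG hU hχ
  have hpsi := charIdem_mem_groupAlg (σ.corr D χ)
  have h := hχ.1.isCharLike.smul_mul_charIdem_of_comm_corner
    (groupAlg_mono hU D.idem_mem_complex)
    (σ.κLin_mem D hU hpsi) (σ.idem_mul_κLin D _) (σ.κLin_mul_idem D _)
    (fun y hy => σ.κLin_comm_corner D hS₀ hG hU hpsi hχι.isCharLike.charIdem_central hy)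
  have h1 := hχι.isCharLike.linExt_charIdem
  rw [σ.linExt_corr D χ hpsi, σ.corr_one D] at h1
  have h2 := mul_left_cancel₀ (inv_ne_zero D.n_cast_ne) h1
  rw [h2] at h
  exact smul_right_injective _ h0 h

include hk hF

theorem exists_central_char : ∃ ω : Subring.center S₀ →+* k, ∀ z : Subring.center S₀,
    algebraMap k ℂ (ω z) = linExt χ ((z : S₀) : ℂ[G]) / linExt χ 𝐢 := by
  have h0 := σ.linExt_idem_ne_zero D hG hU hχ
  have hmem : ∀ a ∈ groupAlg F K, ∃ c : k, algebraMap k ℂ c = linExt χ a := fun a ha =>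
    linExt_mem_of_mem hk ⟨K, mem_groupAlg_of_le hF ha⟩
  have hval : ∀ z : Subring.center S₀, ∃ c : k,
      algebraMap k ℂ c = linExt χ ((z : S₀) : ℂ[G]) / linExt χ 𝐢 := by
    intro z
    obtain ⟨a, ha⟩ := hmem _ (ConjFamily.mem_groupAlg_of_mem_S (D.base_mem hS₀ (z : S₀)))
    obtain ⟨b, hb⟩ := hmem _ D.idem_mem
    exact ⟨a / b, by rw [map_div₀, ha, hb]⟩
  choose ω hω using hval
  have hinj := (algebraMap k ℂ).injective
  have hne : 𝐢 * charIdem χ ≠ 0 := by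
    intro h
    have := hχ.1.isCharLike.linExt_mul_charIdem 𝐢
    rw [h, linExt_zero] at this
    exact h0 this.symm
  refine ⟨{ toFun := ω, map_one' := ?_, map_mul' := ?_, map_zero' := ?_, map_add' := ?_ }, hω⟩
  · refine hinj ?_
    rw [hω, map_one]
    exact (congrArg (linExt χ · / linExt χ 𝐢) (ConjFamily.base_coe_one hS₀)).trans (div_self h0)
  · intro z w
    refine hinj (smul_left_injective ℂ hne ?_)
    change _ • (𝐢 * charIdem χ) = _ • (𝐢 * charIdem χ)
    have h1 := σ.center_mul_charIdem D hS₀ hG hU hχ (z * w).2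
    have h2 := σ.center_mul_charIdem D hS₀ hG hU hχ z.2
    have h3 := σ.center_mul_charIdem D hS₀ hG hU hχ w.2
    rw [map_mul, hω, hω, hω, ← h1,
      mul_comm (linExt χ ((z : S₀) : ℂ[G]) / linExt χ 𝐢), mul_smul, ← h2, ← D.base_mul_idem hS₀ (z : S₀),
      mul_assoc, ← mul_smul_comm, ← h3, ← mul_assoc]
    rfl
  · refine hinj ?_
    rw [hω, map_zero]
    exact (congrArg (· / linExt χ 𝐢) (linExt_zero χ)).trans (zero_div _)
  · intro z w
    refine hinj ?_
    rw [map_add, hω, hω, hω, ← add_div, ← linExt_add]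
    rfl

theorem corr_values (x : ↥(U ⊓ H)) : ∃ c : k, algebraMap k ℂ c = σ.corr D χ x := by
  obtain ⟨c, hc⟩ := linExt_mem_of_mem hk
    ⟨U, mem_groupAlg_of_le hF (σ.κ_mem D hU (x := ⟨x, x.2.2⟩) x.2.1)⟩
  exact ⟨(D.n : k)⁻¹ * c, by rw [map_mul, map_inv₀, map_natCast, hc, corr]⟩

omit hS₀ hG hχ hk in
theorem κLin_mem_of_field {a : ℂ[G]} (ha : a ∈ groupAlg k (U ⊓ H)) :
    σ.κLin a ∈ groupAlg k U := by
  induction ha using groupAlg_induction with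
  | single x hx =>
    rw [σ.κLin_single ⟨x, hx.2⟩]
    exact mem_groupAlg_of_le hF (σ.κ_mem D hU hx.1)
  | zero => rw [map_zero]; exact zero_mem _
  | add a b _ _ ha hb => rw [map_add]; exact add_mem ha hb
  | smul c a _ ha =>
    rw [← algebraMap_smul (A := ℂ), map_smul, algebraMap_smul]
    exact Subalgebra.smul_mem _ ha c

set_option maxHeartbeats 800000 in
/-- The Brauer class of `kUe_χ` is that of `(k ⊗ S₀) ⊗ k(U ∩ H)e_ψ` with `ψ = corr χ`. -/
theorem brauerBaseChangeEq (hχι : IsIrrChar (σ.corr D χ)) (ω : Subring.center S₀ →+* k)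
    (hω : ∀ z : Subring.center S₀,
      algebraMap k ℂ (ω z) = linExt χ ((z : S₀) : ℂ[G]) / linExt χ 𝐢) :
    BrauerBaseChangeEq (blockAlg k χ hχ.1) S₀ (blockAlg k (σ.corr D χ) hχι) ω := by
  let _ := ω.toAlgebra
  have hc := hχ.1.isCharLike
  have h0 := σ.linExt_idem_ne_zero D hG hU hχ
  have hkψ := σ.corr_values D hS₀ hG hU hχ hF hk
  have hA := isCSA_blockAlg hχ.1 hk
  have hB := isCSA_blockAlg hχι hkψ
  have hS : IsCSA k (k ⊗[Subring.center S₀] S₀) :=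
    isCSA_baseChange_of_isField (D.isField_center hS₀) (ConjFamily.isCentral_center S₀)
      (D.base_isSimpleRing hS₀) (D.base_finite_center hS₀)
  have hC := hS.tensorProduct hB
  refine ⟨hA, hS, hB, hA, hC, ?_⟩
  have hi : 𝐢 ∈ groupAlg k U := groupAlg_mono hU (mem_groupAlg_of_le hF D.idem_mem)
  -- The tensor product is mapped to this corner by s ↦ s e_χ and b ↦ κ(b) e_χ. The images commute,
  -- and Z₀ acts on both sides through ω.
  set A' := cornerBlock k hχ.1 𝐢 hi D.idem_mul_self with hA'
  let _ : Algebra (Subring.center S₀) A' := Algebra.compHom A' ω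
  have : IsScalarTower (Subring.center S₀) k A' := ⟨fun z c a => mul_smul (ω z) c a⟩
  have hcomm : ∀ {a : ℂ[G]}, a ∈ groupAlg k U → a * charIdem χ = charIdem χ * a := fun ha =>
    charIdem_mul_comm hc.comm (mem_groupAlg_complex ha)
  have hsU : ∀ s : S₀, (s : ℂ[G]) ∈ groupAlg k U := fun s =>
    groupAlg_mono hU (mem_groupAlg_of_le hF (ConjFamily.mem_groupAlg_of_mem_S (D.base_mem hS₀ s)))
  have hbU : ∀ b : blockAlg k (σ.corr D χ) hχι, (b : ℂ[G]) ∈ groupAlg k (U ⊓ H) := fun b =>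
    ((mem_blockAlg_iff hχι hkψ).1 b.2).1
  have hκU : ∀ b : blockAlg k (σ.corr D χ) hχι, σ.κLin (b : ℂ[G]) ∈ groupAlg k U := fun b =>
    σ.κLin_mem_of_field D hU hF (hbU b)
  have hmul : ∀ {a b : ℂ[G]}, b ∈ groupAlg k U →
      a * b * charIdem χ = a * charIdem χ * (b * charIdem χ) := by
    intro a b hb
    rw [mul_assoc a b, mul_assoc a (charIdem χ), ← mul_assoc (charIdem χ) b, ← hcomm hb,
      mul_assoc b, hc.charIdem_idem]
  have hz : ∀ z : Subring.center S₀,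
      ((z : S₀) : ℂ[G]) * charIdem χ = ω z • (𝐢 * charIdem χ) := fun z => by
    rw [← algebraMap_smul (A := ℂ) (ω z), hω]
    exact σ.center_mul_charIdem D hS₀ hG hU hχ z.2
  let g₁ : S₀ →ₐ[Subring.center S₀] A' :=
    { toFun := fun s => ⟨s * charIdem χ, ⟨_, hsU s, rfl⟩,
        by rw [← mul_assoc, D.idem_mul_base hS₀],
        by rw [mul_assoc, ← hcomm hi, ← mul_assoc, D.base_mul_idem hS₀]⟩
      map_one' := Subtype.ext (congrArg (· * charIdem χ) (ConjFamily.base_coe_one hS₀))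
      map_mul' := fun s t => Subtype.ext (hmul (hsU t))
      map_zero' := Subtype.ext (zero_mul _)
      map_add' := fun s t => Subtype.ext (add_mul _ _ _)
      commutes' := fun z => Subtype.ext (hz z) }
  let g₂ : blockAlg k (σ.corr D χ) hχι →ₐ[k] A' := AlgHom.ofLinearMap
    { toFun := fun b => ⟨σ.κLin b * charIdem χ, ⟨_, hκU b, rfl⟩,
        by rw [← mul_assoc, σ.idem_mul_κLin D],
        by rw [mul_assoc, ← hcomm hi, ← mul_assoc, σ.κLin_mul_idem D]⟩
      map_add' := fun a b => Subtype.ext (by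
        change σ.κLin (a + b) * _ = σ.κLin a * _ + σ.κLin b * _
        rw [map_add, add_mul])
      map_smul' := fun c a => Subtype.ext (by
        change σ.κLin (c • (a : ℂ[G])) * _ = c • (σ.κLin a * _)
        rw [← algebraMap_smul (A := ℂ), map_smul, smul_mul_assoc, algebraMap_smul]) }
    (Subtype.ext (σ.κLin_charIdem_mul D hS₀ hG hU hχ hχι))
    (fun a b => Subtype.ext (by
      change σ.κLin ((a : ℂ[G]) * b) * _ = _
      rw [σ.κLin_mul D (groupAlg_mono inf_le_right (mem_groupAlg_complex (hbU a)))
        (groupAlg_mono inf_le_right (mem_groupAlg_complex (hbU b)))]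
      exact hmul (hκU b)))
  let f₁ : k ⊗[Subring.center S₀] S₀ →ₐ[k] A' :=
    Algebra.TensorProduct.lift (Algebra.ofId k A') g₁ fun c s => Algebra.commutes c (g₁ s)
  have hf₁ : ∀ c s, f₁ (c ⊗ₜ s) = c • g₁ s := fun c s =>
    (Algebra.TensorProduct.lift_tmul _ _ _ _ _).trans (Algebra.smul_def c (g₁ s)).symm
  have hcom : ∀ x b, Commute (f₁ x) (g₂ b) := by
    intro x b
    induction x using TensorProduct.induction_on with
    | zero => rw [map_zero]; exact Commute.zero_left _
    | tmul c s =>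
      rw [hf₁]
      refine Commute.smul_left (Subtype.ext ?_) c
      change (s : ℂ[G]) * charIdem χ * (σ.κLin b * charIdem χ) =
        σ.κLin b * charIdem χ * (s * charIdem χ)
      rw [← hmul (hκU b), ← hmul (hsU s), σ.base_mul_κLin D hS₀]
    | add x y hx hy => rw [map_add]; exact hx.add_left hy
  let f : (k ⊗[Subring.center S₀] S₀) ⊗[k] blockAlg k (σ.corr D χ) hχι →ₐ[k] A' :=
    Algebra.TensorProduct.lift f₁ g₂ hcom
  have hf : ∀ s b, f ((1 ⊗ₜ s) ⊗ₜ b) = g₁ s * g₂ b := fun s b => by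
    refine (Algebra.TensorProduct.lift_tmul _ _ _ _ _).trans ?_
    rw [hf₁, one_smul]
  obtain ⟨ψ, hψ⟩ : ∃ ψ : ((k ⊗[Subring.center S₀] S₀) ⊗[k] blockAlg k (σ.corr D χ) hχι) →ₗ[k]
      blockAlg k χ hχ.1, ∀ c, ((ψ c : blockAlg k χ hχ.1) : ℂ[G]) = ((f c : A') : ℂ[G]) :=
    ⟨{ toFun := fun b : A' => ⟨b, b.2.1⟩, map_add' := fun _ _ => rfl, map_smul' := fun _ _ => rfl } ∘ₗ
      f.toLinearMap, fun _ => rfl⟩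
  have hψ1 : ((ψ 1 : blockAlg k χ hχ.1) : ℂ[G]) = 𝐢 * charIdem χ := by
    rw [hψ, map_one]
    rfl
  have hne : 𝐢 * charIdem χ ≠ 0 := by
    intro h
    have := hc.linExt_mul_charIdem 𝐢
    rw [h, linExt_zero] at this
    exact h0 this.symm
  have hnt : Nontrivial A' := ⟨⟨1, 0, fun h => hne (congrArg Subtype.val h)⟩⟩
  -- The tensor product is simple and the corner is nonzero, so injectivity needs no dimension
  -- count.
  have hfinj := hC.injective f
  clear_value f
  refine brauerClass_eq_of_corner hA hC ψ (fun x y => Subtype.ext ?_) ?_ ?_ ?_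
  · rw [CornerSubalgebra.coe_mul, hψ, hψ, hψ, map_mul, CornerSubalgebra.coe_mul]
  · intro x y h
    refine hfinj (Subtype.ext ?_)
    rw [← hψ, ← hψ, h]
  · intro h
    rw [h] at hψ1
    exact hne hψ1.symm
  · intro a
    obtain ⟨a', ha', ha⟩ := mem_blockAlg.1 a.2
    have h1 : ((ψ 1 * a * ψ 1 : blockAlg k χ hχ.1) : ℂ[G]) = 𝐢 * a' * 𝐢 * charIdem χ := by
      rw [CornerSubalgebra.coe_mul, CornerSubalgebra.coe_mul, hψ1, ha, ← hmul ha', ← hmul hi]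
    suffices h : ∃ c, ((f c : A') : ℂ[G]) = 𝐢 * a' * 𝐢 * charIdem χ by
      obtain ⟨c, hc⟩ := h
      exact ⟨c, Subtype.ext ((hψ c).trans (hc.trans h1.symm))⟩
    clear h1 ha
    induction ha' using groupAlg_induction with
    | single y hy =>
      have h := σ.corner_mem_span D hS₀ hU hG hy
      generalize 𝐢 * ⟪y⟫ * 𝐢 = a at h
      induction h using Submodule.span_induction with
      | mem a ha =>
        obtain ⟨x, hx, t, rfl⟩ := ha
        have hxm : (x : G) ∈ U ⊓ H := ⟨hx, x.2⟩
        -- Since κ(x e_ψ)e_χ = κ(x)e_χ, this is a preimage of κ(x) t e_χ.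
        refine ⟨(1 ⊗ₜ t) ⊗ₜ ⟨⟪(x : G)⟫ * charIdem (σ.corr D χ),
          ⟨_, single_mem_groupAlg hxm, rfl⟩⟩, ?_⟩
        rw [hf]
        change (t : ℂ[G]) * charIdem χ *
          (σ.κLin (⟪(x : G)⟫ * charIdem (σ.corr D χ)) * charIdem χ) = _
        rw [σ.κLin_mul D (single_mem_groupAlg x.2)
          (groupAlg_mono inf_le_right (charIdem_mem_groupAlg _)), σ.κLin_single, mul_assoc (σ.κ x),
          σ.κLin_charIdem_mul D hS₀ hG hU hχ hχι, ← mul_assoc (σ.κ x), σ.κ_mul_idem D,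
          ← hmul (mem_groupAlg_of_le hF (σ.κ_mem D hU hx)), σ.base_mul_κ D hS₀]
      | zero => exact ⟨0, by rw [map_zero, zero_mul]; rfl⟩
      | add a b _ _ ha hb =>
        obtain ⟨c, hc⟩ := ha
        obtain ⟨d, hd⟩ := hb
        exact ⟨c + d, by rw [map_add, CornerSubalgebra.coe_add, hc, hd, add_mul]⟩
      | smul r a _ ha =>
        obtain ⟨c, hc⟩ := ha
        obtain ⟨r', hr⟩ := hF r
        refine ⟨r' • c, ?_⟩
        rw [map_smul, CornerSubalgebra.coe_smul, hc, smul_mul_assoc, ← algebraMap_smul (A := ℂ) r',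
          hr, ← algebraMap_smul (A := ℂ) r]
        rfl
    | zero => exact ⟨0, by rw [map_zero, mul_zero, zero_mul, zero_mul]; rfl⟩
    | add a b _ _ ha hb =>
      obtain ⟨c, hc⟩ := ha
      obtain ⟨d, hd⟩ := hb
      exact ⟨c + d, by rw [map_add, CornerSubalgebra.coe_add, hc, hd, mul_add, add_mul, add_mul]⟩
    | smul r a _ ha =>
      obtain ⟨c, hc⟩ := ha
      exact ⟨r • c, by
        rw [map_smul, CornerSubalgebra.coe_smul, hc, mul_smul_comm, smul_mul_assoc, smul_mul_assoc]⟩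

end MagicCrossedRep

end MagicCrossed

end

open MagicCrossed in
theorem theoremt {G : Type*} [Group G] [Finite G] (F : Subfield ℂ) (H K : Subgroup G) [K.Normal]
    (θ : K → ℂ) (φ : ↥(H ⊓ K) → ℂ) (hyp : SemiInvariantConfig F H K θ φ)
    (S₀ : CornerSubalgebra F ℂ[G]) (hS₀ : IsBaseSubalgebra F θ φ S₀)
    (σ : MagicCrossedRep F θ φ S₀) :
    -- elements of `S₀` of reduced trace one over the centre `Z₀` of `S₀` exist
    (∃ s₀ : S₀, IsReducedTrace (Subring.center S₀) S₀ s₀ 1) ∧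
    ∃ ι : ∀ U : Subgroup G, K ≤ U →
        (irrSpan U (galIdem F θ) ≃ₗ[ℂ] irrSpan (U ⊓ H) (galIdem F φ)),
      -- `χ^ι(h) = χ(s₀ σ(Lh)⁻¹ h)`, for every choice of `s₀`
      (∀ s₀ : S₀, IsReducedTrace (Subring.center S₀) S₀ s₀ 1 →
        ∀ (U : Subgroup G) (hU : K ≤ U) (χ : irrSpan U (galIdem F θ)) (h : ↥(U ⊓ H)),
          (ι U hU χ : ↥(U ⊓ H) → ℂ) h =
            linExt (χ : U → ℂ) ((s₀ : ℂ[G]) *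
              σ.inv ((⟨(h : G), h.2.2⟩ : H) : H ⧸ K.subgroupOf H) *
                MonoidAlgebra.single (h : G) 1)) ∧
      -- `χ` is irreducible if and only if `χ^ι` is
      (∀ (U : Subgroup G) (hU : K ≤ U) (χ : irrSpan U (galIdem F θ)),
        (χ : U → ℂ) ∈ irrOver U (galIdem F θ) ↔
          (ι U hU χ : ↥(U ⊓ H) → ℂ) ∈ irrOver (U ⊓ H) (galIdem F φ)) ∧
      -- isometry
      (∀ (U : Subgroup G) (hU : K ≤ U) (χ₁ χ₂ : irrSpan U (galIdem F θ)),
        charInner (ι U hU χ₁ : ↥(U ⊓ H) → ℂ) (ι U hU χ₂) = charInner (χ₁ : U → ℂ) χ₂) ∧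
      -- `χ(1)/θ(1) = χ^ι(1)/φ(1)`
      (∀ (U : Subgroup G) (hU : K ≤ U) (χ : irrSpan U (galIdem F θ)),
        (χ : U → ℂ) 1 / θ 1 = (ι U hU χ : ↥(U ⊓ H) → ℂ) 1 / φ 1) ∧
      -- restriction
      (∀ (U₁ U₂ : Subgroup G) (h₁ : K ≤ U₁) (h₁₂ : U₁ ≤ U₂) (χ : irrSpan U₂ (galIdem F θ)),
        ∃ hm : resFun h₁₂ (χ : U₂ → ℂ) ∈ irrSpan U₁ (galIdem F θ),
          (ι U₁ h₁ ⟨_, hm⟩ : ↥(U₁ ⊓ H) → ℂ) =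
            resFun (inf_le_inf_right H h₁₂) (ι U₂ (h₁.trans h₁₂) χ : ↥(U₂ ⊓ H) → ℂ)) ∧
      -- induction
      (∀ (U₁ U₂ : Subgroup G) (h₁ : K ≤ U₁) (h₁₂ : U₁ ≤ U₂) (τ : irrSpan U₁ (galIdem F θ)),
        ∃ hm : indFun U₁ U₂ (τ : U₁ → ℂ) ∈ irrSpan U₂ (galIdem F θ),
          (ι U₂ (h₁.trans h₁₂) ⟨_, hm⟩ : ↥(U₂ ⊓ H) → ℂ) =
            indFun (U₁ ⊓ H) (U₂ ⊓ H) (ι U₁ h₁ τ : ↥(U₁ ⊓ H) → ℂ)) ∧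
      -- conjugation by elements of `H`; note `U^h ∩ H = (U ∩ H)^h`
      (∀ (U : Subgroup G) (hU : K ≤ U) (χ : irrSpan U (galIdem F θ)), ∀ h ∈ H,
        ∃ hm : conjFun h (χ : U → ℂ) ∈ irrSpan (conjSub h U) (galIdem F θ),
          ∀ (x : G) (hx : x ∈ conjSub h U ⊓ H), ∃ hx' : x ∈ conjSub h (U ⊓ H),
            (ι (conjSub h U) (le_conjSub h hU) ⟨_, hm⟩ : ↥(conjSub h U ⊓ H) → ℂ) ⟨x, hx⟩ =
              conjFun h (ι U hU χ : ↥(U ⊓ H) → ℂ) ⟨x, hx'⟩) ∧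
      -- multiplication by `β ∈ ℂ[Irr(U/K)]`
      (∀ (U : Subgroup G) (hU : K ≤ U) (χ : irrSpan U (galIdem F θ)),
        ∀ β ∈ Submodule.span ℂ {β : (U ⧸ K.subgroupOf U) → ℂ | IsIrrChar β},
          ∃ hm : (fun x : U => β x * (χ : U → ℂ) x) ∈ irrSpan U (galIdem F θ),
            (ι U hU ⟨_, hm⟩ : ↥(U ⊓ H) → ℂ) =
              fun x => β (Subgroup.inclusion inf_le_left x : U) *
                (ι U hU χ : ↥(U ⊓ H) → ℂ) x) ∧
      -- field automorphisms over `F`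
      (∀ (U : Subgroup G) (hU : K ≤ U) (χ : irrSpan U (galIdem F θ)) (α : ℂ ≃ₐ[F] ℂ),
        ∃ hm : (fun x => α ((χ : U → ℂ) x)) ∈ irrSpan U (galIdem F θ),
          (ι U hU ⟨_, hm⟩ : ↥(U ⊓ H) → ℂ) =
            fun x => α ((ι U hU χ : ↥(U ⊓ H) → ℂ) x)) ∧
      -- `F(χ) = F(χ^ι)`
      (∀ (U : Subgroup G) (hU : K ≤ U) (χ : irrSpan U (galIdem F θ)),
        valueField F (χ : U → ℂ) = valueField F (ι U hU χ : ↥(U ⊓ H) → ℂ)) ∧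
      -- `[χ]_F = [F(χ) ⊗_{Z₀} S₀] [χ^ι]_F` in the Brauer group of `F(χ)`, where `Z₀` acts on
      -- `F(χ)` through `z ↦ χ(z)/χ(i)`, the scalar by which `z` acts on the `i`-part of `χ`
      (∀ (U : Subgroup G) (hU : K ≤ U) (χ : irrSpan U (galIdem F θ))
        (hχ : IsIrrChar (χ : U → ℂ)) (hχι : IsIrrChar (ι U hU χ : ↥(U ⊓ H) → ℂ)),
        ∃ ω : Subring.center S₀ →+* valueField F (χ : U → ℂ),
          (∀ z : Subring.center S₀, (ω z : ℂ) =
            linExt (χ : U → ℂ) ((z : S₀) : ℂ[G]) / linExt (χ : U → ℂ) (idem F θ φ)) ∧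
          BrauerBaseChangeEq
            (blockAlg (valueField F (χ : U → ℂ)) (χ : U → ℂ) hχ) S₀
            (blockAlg (valueField F (χ : U → ℂ)) (ι U hU χ : ↥(U ⊓ H) → ℂ) hχι) ω) := by
  obtain ⟨Γ, _, ⟨D⟩⟩ := hyp.exists_conjFamily
  have hG := hyp.factor
  have hblock : ∀ {U : Subgroup G} (hU : K ≤ U) (χ : irrSpan U (galIdem F θ)),
      IsBlockFun (galIdem F θ) (χ : U → ℂ) := fun hU χ => (D.mem_irrSpan_theta hG hU).1 χ.2
  refine ⟨D.exists_isReducedTrace_one_base hS₀, fun U hU => σ.corrEquiv D hS₀ hG hU,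
    fun s₀ hs U hU χ h => σ.corr_eq D hS₀ hU (hblock hU χ).comm hs h,
    fun U hU χ => σ.corr_mem_irrOver_iff D hS₀ hG hU χ.2,
    fun U hU χ₁ χ₂ => σ.charInner_corr D hS₀ hG hU χ₁.2 χ₂.2,
    fun U hU χ => σ.degree_corr D hU (hblock hU χ),
    fun U₁ U₂ h₁ h₁₂ χ => ⟨(D.mem_irrSpan_theta hG h₁).2 ((hblock (h₁.trans h₁₂) χ).resFun h₁₂
      (D.galIdem_theta_mem_complex h₁)), σ.corr_resFun D h₁ h₁₂ χ⟩,
    fun U₁ U₂ h₁ h₁₂ τ => ⟨(D.mem_irrSpan_theta hG (h₁.trans h₁₂)).2 ((hblock h₁ τ).indFun h₁₂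
      (D.galIdem_theta_mem_complex h₁) fun u _ => D.single_mul_galIdem_theta hG u),
      σ.corr_indFun D h₁ hG h₁₂ (hblock h₁ τ).comm⟩,
    fun U hU χ h hh => ⟨(D.mem_irrSpan_theta hG (le_conjSub h hU)).2 ((hblock hU χ).conjFun h
      (D.single_mul_galIdem_theta hG h)), fun x hx => ⟨⟨hx.1, ?_⟩,
        σ.corr_conjFun D hU (hblock hU χ).comm hh hx _⟩⟩,
    fun U hU χ β hβ => ⟨(D.mem_irrSpan_theta hG hU).2 ((hblock hU χ).mul_quotient hU
      (comm_of_mem_span_irr hβ) (D.galIdem_theta_mem_complex le_rfl)),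
      σ.corr_mul_quotient D hU β χ⟩,
    fun U hU χ α => ⟨(D.mem_irrSpan_theta hG hU).2 ((hblock hU χ).map α
      (groupAlg_mono hU D.galIdem_theta_mem)), σ.corr_map D hU α χ⟩,
    fun U hU χ => σ.valueField_corr D hS₀ hG hU (hblock hU χ),
    fun U hU χ hχ hχι => ?_⟩
  · exact H.mul_mem (H.mul_mem hh hx.2) (H.inv_mem hh)
  -- Absorption at 1 gives χ(e_(θ,F)) = χ(1), which is nonzero.
  · have hχ' : (χ : U → ℂ) ∈ irrOver U (galIdem F θ) := by
      refine ⟨hχ, ?_⟩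
      have h := (hblock hU χ).absorb 1
      rw [OneMemClass.coe_one, ← MonoidAlgebra.one_def, one_mul] at h
      rw [h]
      exact hχ.isCharLike.one_ne_zero
    have hF : ∀ c : F, ∃ c' : valueField F (χ : U → ℂ), algebraMap _ ℂ c' = c :=
      fun c => ⟨algebraMap F _ c, rfl⟩
    have hk : ∀ x, ∃ c : valueField F (χ : U → ℂ), algebraMap _ ℂ c = (χ : U → ℂ) x :=
      fun x => ⟨⟨_, IntermediateField.subset_adjoin _ _ ⟨x, rfl⟩⟩, rfl⟩
    obtain ⟨ω, hω⟩ := σ.exists_central_char D hS₀ hG hU hχ' hF hk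
    exact ⟨ω, hω, σ.brauerBaseChangeEq D hS₀ hG hU hχ' hF hk hχι ω hω⟩
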